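/- Setting. Let $(U_k)_{k\ge 0}$ be i.i.d. random variables uniformly distributed on $[-1,1]$. For $n\ge 0$ let $$\Delta_n=\bigcup_{k_1,\dots,k_n\in\mathbb N\ \text{pairwise distinct}}[2k_1,2k_1+2]\times\cdots\times[2k_n,2k_n+2]$$ ($\Delta_0$ being the one-point set $\mathbb R_+^0$), and let $\hat L^2(\mathbb R_+^n)$ be the space of symmetric functions in $L^2(\mathbb R_+^n)$ that vanish outside $\Delta_n$. Write $\|\cdot\|_{(k)}$ for the norm of $L^2(\mathbb R_+,dx/2)^{\circ k}$, i.e. of $L^2(\mathbb R_+^k,2^{-k}dx_1\cdots dx_k)$; it is the absolute value for $k=0$, and it takes the value $+\infty$ on functions that are not square-integrable. For $f\in\hat L^2(\mathbb R_+^n)\cap L^1(\mathbb R_+^n)$ put $$I_n(f)=\sum_{r=0}^n\frac{(-1)^{n-r}}{2^{n-r}}\binom nr\sum_{k_1,\dots,k_r\ \text{pairwise distinct}}\int_{\mathbb R_+^{n-r}}f(2k_1+1+U_{k_1},\dots,2k_r+1+U_{k_r},y_1,\dots,y_{n-r})\,dy_1\cdots dy_{n-r},$$ and extend $I_n$ to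 $\hat L^2(\mathbb R_+^n)$ by continuity into $L^2(\Omega)$, so that $I_n(f)=\lim_{N\to\infty}I_n(f\mathbf 1_{[0,2N)^n})$ in $L^2(\Omega)$. For a function $f$ of $p\ge 0$ variables and $0\le l\le r\le p$ let $f\,\tilde\star_r^l f$ be the symmetrisation, i.e. the average over all permutations of the $2p-r-l$ variables, of $$(f\star_r^l f)(\gamma,t,s)=2^{-l}\int_{\mathbb R_+^l}f(z,\gamma,t)f(z,\gamma,s)\,dz,\qquad \gamma\in\mathbb R_+^{r-l},\ t,s\in\mathbb R_+^{p-r},$$ and for $0\le k\le 2p$ let $$G^p_kf=\mathbf 1_{\Delta_k}\sum_{r=0}^p\sum_{l=0}^r\mathbf 1_{\{2p-r-l=k\}}\,r!\binom pr^2\binom rl\,f\,\tilde\star_r^l f .$$ The Wasserstein distance $d_W(X,\mathcal N)$ is the supremum of $|E[h(X)]-E[h(Z)]|$, $Z$ standard normal, over all $h:\mathbb R\to\mathbb R$ with Lipschitz constant at most $1$. Statement. Let $n\ge 1$ and let $f_n\in\hat L^2(\mathbb R_+^n)$ be canonical, i.e. $\int_{2k}^{2k+2}f_n(t,y)\,dt=0$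 for every $k\in\mathbb N$ and almost every $y\in\mathbb R_+^{n-1}$. Assume that $$\widehat G^n_kf_n:=\frac12\int_0^\infty G^{n-1}_kf_n(t,\cdot)\,dt$$ belongs to $L^2(\mathbb R_+^k)$ for all $1\le k\le 2n-2$. Then $I_n(f_n)$ is well defined, i.e. the above limit exists in $L^2(\Omega)$, and $$d_W(I_n(f_n),\mathcal N)\le\sqrt{\bigl(1-n!\,\|f_n\|_{(n)}^2\bigr)^2+n^2\sum_{k=1}^{2n-2}k!\,\bigl\|\widehat G^n_kf_n\bigr\|_{(k)}^2}+n^2\sqrt{2\,(n-1)!}\;\|f_n\|_{(n)}\sqrt{\sum_{k=0}^{2n-2}k!\int_0^\infty\bigl\|G^{n-1}_kf_n(t,\cdot)\bigr\|_{(k)}^2\,dt}\,.$$ (The right-hand side may be $+\infty$; products follow the convention $0\cdot\infty=0$.) -/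

import Mathlib

open MeasureTheory ProbabilityTheory Filter
open scoped ENNReal NNReal Nat Topology

noncomputable section

namespace UniformChaos

/-- The measure `dx/2` on the half-line `[0,∞)`, seen as a measure on `ℝ`. -/
def halfLeb : Measure ℝ := (2⁻¹ : ℝ≥0∞) • (volume : Measure ℝ).restrict (Set.Ici 0)

instance : SigmaFinite halfLeb := by
  unfold halfLeb
  rw [← withDensity_const]
  exact SigmaFinite.withDensity_of_ne_top (ae_of_all _ fun _ => by simp)

/-- The product measure `(dx/2)^{⊗ n}` on `[0,∞)^n`. -/
def halfPow (n : ℕ) : Measure (Fin n → ℝ) := Measure.pi fun _ => halfLeb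

/-- `Δ_n`: the union of the boxes `[2k₁,2k₁+2] × ⋯ × [2kₙ,2kₙ+2]` over pairwise distinct
`k₁, …, kₙ ∈ ℕ`. -/
def distinctBlocks (n : ℕ) : Set (Fin n → ℝ) :=
  {x | ∃ k : Fin n → ℕ, Function.Injective k ∧
    ∀ i, x i ∈ Set.Icc (2 * (k i : ℝ)) (2 * (k i : ℝ) + 2)}

/-- `f ∈ L̂²(ℝ₊ⁿ)`: square-integrable, symmetric, vanishing outside `Δ_n` (as an `L²` class). -/
structure MemHatL2 {n : ℕ} (f : (Fin n → ℝ) → ℝ) : Prop where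
  memLp : MemLp f 2 (halfPow n)
  symm : ∀ σ : Equiv.Perm (Fin n), ∀ᵐ x ∂halfPow n, f (x ∘ σ) = f x
  vanish : ∀ᵐ x ∂halfPow n, x ∉ distinctBlocks n → f x = 0

/-- The function `f(t, ·)` of the remaining `m` variables. -/
def sliceAt {m : ℕ} (f : (Fin (m + 1) → ℝ) → ℝ) (t : ℝ) : (Fin m → ℝ) → ℝ :=
  fun y => f (Fin.cons t y)

/-- `f` is canonical: `∫_{2k}^{2k+2} f(t, y) dt = 0` for all `k ∈ ℕ` and almost every `y`. -/
def IsCanonical {m : ℕ} (f : (Fin (m + 1) → ℝ) → ℝ) : Prop :=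
  ∀ k : ℕ, ∀ᵐ y ∂halfPow m, ∫ t in (2 * (k : ℝ))..(2 * (k : ℝ) + 2), sliceAt f t y = 0

section StochasticIntegral

variable {Ω : Type*} [MeasurableSpace Ω]

/-- The explicit formula for the multiple stochastic integral,
`∑_{r=0}^n (-1)^{n-r} 2^{-(n-r)} (n choose r) ∑_{k₁,…,k_r distinct}
  ∫_{[0,∞)^{n-r}} f(2k₁+1+U_{k₁}, …, 2k_r+1+U_{k_r}, y₁, …, y_{n-r}) dy`,
where the factor `2^{-(n-r)}` is part of the measure `(dy/2)^{⊗(n-r)}`. -/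
def explicitIntegral (U : ℕ → Ω → ℝ) {n : ℕ} (f : (Fin n → ℝ) → ℝ) (ω : Ω) : ℝ :=
  ∑ r ∈ Finset.range (n + 1), (-1 : ℝ) ^ (n - r) * (n.choose r : ℝ) *
    ∑' k : Fin r ↪ ℕ, ∫ y : Fin (n - r) → ℝ,
      f (fun j : Fin n =>
        if h : (j : ℕ) < r then 2 * (k ⟨j, h⟩ : ℝ) + 1 + U (k ⟨j, h⟩) ω
        else y ⟨j - r, by omega⟩) ∂halfPow (n - r)

/-- The truncation `f 1_{[0,2N)^n}` (functions are only considered on `[0,∞)^n`). -/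
def truncSupp (N : ℕ) {n : ℕ} (f : (Fin n → ℝ) → ℝ) : (Fin n → ℝ) → ℝ :=
  {x | ∀ i, x i < 2 * (N : ℝ)}.indicator f

/-- `X` is (a version of) the extension to `f ∈ L̂²` of the explicit formula by `L²` continuity.
The truncations of `f` are integrable and square-integrable, so that the explicit formula
applies to them, and they converge to `f` in `L²`. -/
def IsMultipleIntegral (P : Measure Ω) (U : ℕ → Ω → ℝ) {n : ℕ} (f : (Fin n → ℝ) → ℝ)
    (X : Ω → ℝ) : Prop :=
  MemLp X 2 P ∧
    Tendsto (fun N : ℕ => eLpNorm (fun ω => explicitIntegral U (truncSupp N f) ω - X ω) 2 P)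
      atTop (𝓝 0)

open scoped Classical in
/-- The multiple stochastic integral `I_n(f)` (determined up to almost sure equality; the value
`0` is only a default for the case that no `L²` limit exists). -/
def multipleIntegral (P : Measure Ω) (U : ℕ → Ω → ℝ) {n : ℕ} (f : (Fin n → ℝ) → ℝ) : Ω → ℝ :=
  if h : ∃ X : Ω → ℝ, IsMultipleIntegral P U f X then h.choose else 0

end StochasticIntegral

/-- The Wasserstein distance `sup_{h ∈ Lip(1)} |∫ h dμ - ∫ h dν|` between two probability
measures on `ℝ` with finite first moments. -/
def wassersteinDist (μ ν : Measure ℝ) : ℝ≥0∞ :=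
  ⨆ (h : ℝ → ℝ) (_ : LipschitzWith 1 h), ENNReal.ofReal |∫ x, h x ∂μ - ∫ x, h x ∂ν|

/-- The `j`-th coordinate (from `0`) of `x`; the default is never used for in-range `j`. -/
def coordOr0 {N : ℕ} (x : Fin N → ℝ) (j : ℕ) : ℝ := if h : j < N then x ⟨j, h⟩ else 0

/-- The contraction kernel `f ⋆_k^i g` for `0 ≤ i ≤ k ≤ n ∧ m`, a function of the `n+m-k-i`
variables `x = (γ₁,…,γ_{k-i}, t₁,…,t_{n-k}, s₁,…,s_{m-k})`:
`2^{-i} ∫_{[0,∞)^i} f(z,γ,t) g(z,γ,s) dz₁⋯dz_i`. -/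
def contraction (k i : ℕ) {n m N : ℕ} (f : (Fin n → ℝ) → ℝ) (g : (Fin m → ℝ) → ℝ)
    (x : Fin N → ℝ) : ℝ :=
  ∫ z : Fin i → ℝ,
    f (fun a : Fin n => if (a : ℕ) < i then coordOr0 z a else coordOr0 x (a - i)) *
    g (fun b : Fin m => if (b : ℕ) < i then coordOr0 z b
        else if (b : ℕ) < k then coordOr0 x (b - i)
        else coordOr0 x ((n - i) + (b - k))) ∂halfPow i

/-- Symmetrisation over all permutations of the variables. -/
def symmetrize {N : ℕ} (h : (Fin N → ℝ) → ℝ) (x : Fin N → ℝ) : ℝ :=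
  (1 / (N ! : ℝ)) * ∑ σ : Equiv.Perm (Fin N), h (x ∘ σ)

/-- The kernel `G^n_k f = 1_{Δ_k} ∑_{r=0}^n ∑_{l=0}^r 1_{2n-r-l=k} r! (n choose r)² (r choose l)
(f ⋆̃_r^l f)` for a function `f` of `n` variables. -/
def kernelG (n k : ℕ) (f : (Fin n → ℝ) → ℝ) : (Fin k → ℝ) → ℝ :=
  (distinctBlocks k).indicator fun x =>
    ∑ r ∈ Finset.range (n + 1), ∑ l ∈ Finset.range (r + 1),
      if r + l + k = 2 * n then
        (r ! : ℝ) * (n.choose r : ℝ) ^ 2 * (r.choose l : ℝ) * symmetrize (contraction r l f f) x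
      else 0

/-- The averaged kernel `Ĝ^{m+1}_k f = (1/2) ∫_0^∞ G^m_k f(t, ·) dt`
for a function `f` of `m + 1` variables. -/
def kernelGhat (m k : ℕ) (f : (Fin (m + 1) → ℝ) → ℝ) (x : Fin k → ℝ) : ℝ :=
  ∫ t, kernelG m k (sliceAt f t) x ∂halfLeb

end UniformChaos

end

open UniformChaos

/-! Replace `f` by an almost everywhere equal kernel `f'` that is symmetric everywhere, vanishes
when two variables share a block and integrates to zero over each block in each variable
(`exists_kern`). For such a kernel the lower order terms of the explicit formula disappear, so that
the truncation at `2N` yields the homogeneous sum `chaos f' N` in the independent variables `x k =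
2k+1+U k`. Terms over distinct index sets are orthogonal, hence `chaos f' N` is an L²-bounded
martingale in `N`, and its limit is the stochastic integral. It remains to compare `chaos f' N` with
the normal law for large `N`.

Write `n = m + 1`. Stein's equation has solutions with `|g| ≤ 1`, `|g'| ≤ 1`, `|g''| ≤ 2`
(`exists_stein_solution`). Resampling one coordinate at a time and a Taylor expansion bound the
distance by `E|1 - Γ_N| + (2/n) ∑_k E|F_k|³`, where `F_k` (`part`) collects the terms containing the
index `k`, and `Γ_N` (`gam`) is `1/n` times the sum of the conditional variances of the `F_k` in
their `k`-th coordinate (`abs_integral_chaos_sub_gaussian_le`).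

Both quantities are controlled by a product formula in dual form, `tendsto_integral_chaos_sq_mul`:
the square of a multiple sum is only tested against bounded functions of the coordinates in a finite
set `A` that are degenerate in each of them. A pair `(B, C)` of index sets contributes only if `B ∆
C ⊆ A ⊆ B ∪ C`, and counting these pairs by the sizes of `B ∩ C` and `(B ∩ C) \ A` produces exactly
the contractions and coefficients of `G_k` with `k = |A|`. A general bounded function of finitely
many coordinates is split by the Hoeffding decomposition; Pythagoras and Cauchy–Schwarz turn the
bounds on the degenerate pieces into one with constant `√(∑ k! ‖G_k‖²)`, independent of the number
of coordinates (`exists_limit_of_degenerate`). Thus no moment above the second is assumed in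
advance.

For `Γ_N` the formula is applied to the slices `f'(t, ·)` and integrated in `t`, which gives the
averaged kernels; the level `A = ∅` carries `1 - n! ‖f‖²`. Testing with the sign of `1 - Γ_M` bounds
`E|1 - Γ_M|` (`eventually_integral_abs_one_sub_gam_le`). For the third moments, `F_k` with its
`k`-th coordinate frozen at `t` is `n` times the multiple sum of order `n - 1` of the slice. There
`E|F|³ ≤ (E F²)^(1/2) (E F⁴)^(1/2)`, and testing `F²` against its own truncation bounds `E F⁴` by `∑
k! ‖G_k‖²` (`integral_chaos_pow_four_le`). Cauchy–Schwarz in `t` then gives the second summand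
(`sum_lintegral_part_cube_le`). -/

namespace UniformChaos

/-! ### Stein's equation for the standard normal law -/

/-- The unnormalised Gaussian weight. -/
noncomputable def gw (x : ℝ) : ℝ := Real.exp (-(1 / 2) * x ^ 2)

/-- The unnormalised Gaussian tail. -/
noncomputable def gtail (x : ℝ) : ℝ := ∫ y in Set.Ioi x, gw y

lemma gw_pos (x : ℝ) : 0 < gw x := Real.exp_pos _

lemma gw_neg (x : ℝ) : gw (-x) = gw x := by simp [gw]

lemma continuous_gw : Continuous gw := by unfold gw; fun_prop

lemma hasDerivAt_gw (x : ℝ) : HasDerivAt gw (-x * gw x) x := by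
  have h : HasDerivAt (fun x : ℝ => -(1 / 2) * x ^ 2) (-(1 / 2) * (2 * x)) x := by
    simpa using (hasDerivAt_pow 2 x).const_mul (-(1 / 2) : ℝ)
  have h' := h.exp
  unfold gw
  convert h' using 1
  ring

lemma integrable_gw : Integrable gw := integrable_exp_neg_mul_sq (by norm_num : (0 : ℝ) < 1 / 2)

lemma integrable_mul_gw : Integrable (fun x => x * gw x) :=
  integrable_mul_exp_neg_mul_sq (by norm_num : (0 : ℝ) < 1 / 2)

lemma integrable_sq_mul_gw : Integrable (fun x => x ^ 2 * gw x) := by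
  have := integrable_rpow_mul_exp_neg_mul_sq (by norm_num : (0 : ℝ) < 1 / 2)
    (by norm_num : (-1 : ℝ) < 2)
  simpa [gw] using this

lemma integral_gw : ∫ x, gw x = Real.sqrt (2 * Real.pi) := by
  have := integral_gaussian (1 / 2)
  rw [show Real.pi / (1 / 2) = 2 * Real.pi by ring] at this
  exact this

lemma gtail_add_gtail_neg (x : ℝ) : gtail x + gtail (-x) = Real.sqrt (2 * Real.pi) := by
  have h : gtail (-x) = ∫ y in Set.Iic x, gw y := by
    have := integral_comp_neg_Ioi (-x) gw
    simpa [gtail, gw_neg] using this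
  rw [h, ← integral_gw, add_comm]
  exact intervalIntegral.integral_Iic_add_Ioi integrable_gw.integrableOn integrable_gw.integrableOn

/-- Differentiation of a tail integral in its lower end. -/
lemma hasDerivAt_integral_Ioi {u : ℝ → ℝ} (hc : Continuous u)
    (hi : ∀ x, IntegrableOn u (Set.Ioi x)) (x : ℝ) :
    HasDerivAt (fun x => ∫ y in Set.Ioi x, u y) (-u x) x := by
  have h : (fun x => ∫ y in Set.Ioi x, u y)
      = fun x => (∫ y in Set.Ioi 0, u y) - ∫ y in (0 : ℝ)..x, u y := by
    funext x
    rw [← intervalIntegral.integral_interval_add_Ioi (hi 0) (hi x)]; ring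
  rw [h]
  have := (intervalIntegral.integral_hasDerivAt_right (hc.intervalIntegrable 0 x)
    hc.aestronglyMeasurable.stronglyMeasurableAtFilter hc.continuousAt)
  simpa using this.const_sub (∫ y in Set.Ioi 0, u y)

lemma hasDerivAt_gtail (x : ℝ) : HasDerivAt gtail (-gw x) x :=
  hasDerivAt_integral_Ioi continuous_gw (fun _ => integrable_gw.integrableOn) x

lemma continuous_gtail : Continuous gtail :=
  continuous_iff_continuousAt.2 fun x => (hasDerivAt_gtail x).continuousAt

lemma gtail_pos (x : ℝ) : 0 < gtail x := by
  refine (setIntegral_pos_iff_support_of_nonneg_ae (ae_of_all _ fun y => (gw_pos y).le)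
    integrable_gw.integrableOn).2 ?_
  have : Function.support gw = Set.univ := by
    ext y; simp [(gw_pos y).ne']
  simp [this]

lemma tendsto_gw_atTop : Tendsto gw atTop (𝓝 0) := by
  unfold gw
  refine Real.tendsto_exp_atBot.comp ?_
  exact (tendsto_pow_atTop (by norm_num)).const_mul_atTop_of_neg (by norm_num)

lemma tendsto_gw_atBot : Tendsto gw atBot (𝓝 0) := by
  have := tendsto_gw_atTop.comp tendsto_neg_atBot_atTop
  refine this.congr fun x => ?_
  simp [gw_neg]

lemma integral_Ioi_mul_gw (x : ℝ) : ∫ y in Set.Ioi x, y * gw y = gw x := by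
  have h := integral_Ioi_of_hasDerivAt_of_tendsto' (f := fun y => -gw y) (f' := fun y => y * gw y)
    (a := x) (m := 0) (fun y _ => by simpa using (hasDerivAt_gw y).fun_neg)
    integrable_mul_gw.integrableOn (by simpa using tendsto_gw_atTop.neg)
  simpa using h

lemma tendsto_mul_gw_atTop : Tendsto (fun x => x * gw x) atTop (𝓝 0) := by
  refine tendsto_zero_of_hasDerivAt_of_integrableOn_Ioi (a := 0)
    (f' := fun y => gw y - y ^ 2 * gw y) (fun y _ => ?_) ?_ integrable_mul_gw.integrableOn
  · have := (hasDerivAt_id' y).fun_mul (hasDerivAt_gw y)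
    exact this.congr_deriv (by ring)
  · exact (integrable_gw.sub integrable_sq_mul_gw).integrableOn

lemma integral_Ioi_sq_mul_gw (x : ℝ) :
    ∫ y in Set.Ioi x, y ^ 2 * gw y = x * gw x + gtail x := by
  have h := integral_Ioi_of_hasDerivAt_of_tendsto' (f := fun y => -(y * gw y))
    (f' := fun y => y ^ 2 * gw y - gw y)
    (a := x) (m := 0) (fun y _ => by
      have := ((hasDerivAt_id' y).fun_mul (hasDerivAt_gw y)).fun_neg
      exact this.congr_deriv (by ring))
    (integrable_sq_mul_gw.sub integrable_gw).integrableOn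
    (by simpa using tendsto_mul_gw_atTop.neg)
  rw [integral_sub integrable_sq_mul_gw.integrableOn integrable_gw.integrableOn] at h
  simp only [gtail] at *
  linarith

/-- The iterated tail `w - x b`. -/
noncomputable def gtail2 (x : ℝ) : ℝ := gw x - x * gtail x

/-- The quantity equals `∫_x^∞ (y - x) gw y dy`. -/
lemma gtail2_nonneg (x : ℝ) : 0 ≤ gtail2 x := by
  have h : gtail2 x = ∫ y in Set.Ioi x, (y * gw y - x * gw y) := by
    rw [integral_sub integrable_mul_gw.integrableOn
      (integrable_gw.const_mul x).integrableOn, integral_Ioi_mul_gw, integral_const_mul]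
    rfl
  rw [h]
  refine setIntegral_nonneg measurableSet_Ioi fun y hy => ?_
  have := gw_pos y
  rw [← sub_mul]
  exact mul_nonneg (sub_nonneg.2 (le_of_lt hy)) this.le

/-- Birnbaum's inequality for Mills' ratio. -/
lemma gw_sq_le (x : ℝ) : gw x ^ 2 ≤ gtail x ^ 2 + x * gtail x * gw x := by
  have hb := gtail_pos x
  -- `μ` is the mean of the normal law conditioned on exceeding `x`. The inequality is the
  -- nonnegativity of the conditional variance, multiplied by `gtail x`.
  set μ := gw x / gtail x with hμ
  have h : 0 ≤ ∫ y in Set.Ioi x, ((y ^ 2 * gw y - 2 * μ * (y * gw y)) + μ ^ 2 * gw y) := by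
    refine setIntegral_nonneg measurableSet_Ioi fun y _ => ?_
    have := gw_pos y
    nlinarith [mul_nonneg (sq_nonneg (y - μ)) this.le]
  have hi : IntegrableOn (fun y => y ^ 2 * gw y - 2 * μ * (y * gw y)) (Set.Ioi x) :=
    (integrable_sq_mul_gw.sub (integrable_mul_gw.const_mul _)).integrableOn
  rw [integral_add hi (integrable_gw.const_mul _).integrableOn,
    integral_sub integrable_sq_mul_gw.integrableOn (integrable_mul_gw.const_mul _).integrableOn,
    integral_const_mul, integral_const_mul, integral_Ioi_mul_gw, integral_Ioi_sq_mul_gw] at h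
  change 0 ≤ _ - _ + μ ^ 2 * gtail x at h
  have h2 : μ * gtail x = gw x := by rw [hμ]; field_simp
  have h3 : 0 ≤ gtail x * (x * gw x + gtail x - 2 * μ * gw x + μ ^ 2 * gtail x) :=
    mul_nonneg hb.le h
  have h4 : gtail x * (x * gw x + gtail x - 2 * μ * gw x + μ ^ 2 * gtail x)
     = gtail x * (x * gw x + gtail x) - 2 * (μ * gtail x) * gw x + (μ * gtail x) ^ 2 := by ring
  rw [h4, h2] at h3
  nlinarith

/-- The lower bound for Mills' ratio, a consequence of `gw_sq_le`. It decides the signs of the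
coefficients in the formula for the second derivative of the Stein solution. -/
lemma mul_gw_le (x : ℝ) : x * gw x ≤ (1 + x ^ 2) * gtail x := by
  have hb := gtail_pos x
  have hw := gw_pos x
  rcases le_or_gt x 0 with hx | hx
  · have : x * gw x ≤ 0 := mul_nonpos_of_nonpos_of_nonneg hx hw.le
    nlinarith [sq_nonneg x]
  · by_contra hcon
    push Not at hcon
    have h := gw_sq_le x
    have e1 : gtail x * (1 + x ^ 2) < x * gw x := by linarith
    have h1 : (gtail x * (1 + x ^ 2)) ^ 2 ≤ (x * gw x) ^ 2 :=
      pow_le_pow_left₀ (by positivity) e1.le 2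
    have h2 : x * gw x * (1 + x ^ 2) * (gtail x * (1 + x ^ 2))
        ≤ x * gw x * (1 + x ^ 2) * (x * gw x) :=
      mul_le_mul_of_nonneg_left e1.le (by positivity)
    have h3 : (1 + x ^ 2) ^ 2 * gw x ^ 2 ≤ (1 + x ^ 2) ^ 2 * (gtail x ^ 2 + x * gtail x * gw x) :=
      mul_le_mul_of_nonneg_left h (by positivity)
    nlinarith [pow_pos hw 2, sq_nonneg x]

lemma hasDerivAt_gtail2 (x : ℝ) : HasDerivAt gtail2 (-gtail x) x := by
  have := (hasDerivAt_gw x).fun_sub ((hasDerivAt_id' x).fun_mul (hasDerivAt_gtail x))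
  exact this.congr_deriv (by ring)

lemma tendsto_gtail2_atTop : Tendsto gtail2 atTop (𝓝 0) := by
  refine tendsto_of_tendsto_of_tendsto_of_le_of_le' tendsto_const_nhds tendsto_gw_atTop
    (Eventually.of_forall gtail2_nonneg) ?_
  filter_upwards [eventually_ge_atTop 0] with x hx
  have := mul_nonneg hx (gtail_pos x).le
  unfold gtail2; linarith

lemma integrableOn_gtail (x : ℝ) : IntegrableOn gtail (Set.Ioi x) := by
  have h := integrableOn_Ioi_deriv_of_nonpos' (g := gtail2) (g' := fun y => -gtail y) (a := x)
    (fun y _ => hasDerivAt_gtail2 y) (fun y _ => by simpa using (gtail_pos y).le)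
    tendsto_gtail2_atTop
  simpa using h.neg

lemma integral_Ioi_gtail (x : ℝ) : ∫ y in Set.Ioi x, gtail y = gtail2 x := by
  have h := integral_Ioi_of_hasDerivAt_of_nonpos' (g := gtail2) (g' := fun y => -gtail y) (a := x)
    (fun y _ => hasDerivAt_gtail2 y) (fun y _ => by simpa using (gtail_pos y).le)
    tendsto_gtail2_atTop
  rw [integral_neg] at h
  linarith

/-- The tail integral `∫_x^∞ k b`. -/
noncomputable def wtail (k : ℝ → ℝ) (x : ℝ) : ℝ := ∫ y in Set.Ioi x, k y * gtail y

lemma integrableOn_mul_gtail {k : ℝ → ℝ} (hk : Continuous k) (hk1 : ∀ x, |k x| ≤ 1) 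
    (x : ℝ) : IntegrableOn (fun y => k y * gtail y) (Set.Ioi x) := by
  refine Integrable.mono' (integrableOn_gtail x)
    (hk.mul continuous_gtail).aestronglyMeasurable (ae_of_all _ fun y => ?_)
  rw [Real.norm_eq_abs, abs_mul, abs_of_pos (gtail_pos y)]
  exact mul_le_of_le_one_left (gtail_pos y).le (hk1 y)

lemma hasDerivAt_wtail {k : ℝ → ℝ} (hk : Continuous k) (hk1 : ∀ x, |k x| ≤ 1) (x : ℝ) : HasDerivAt (wtail k) (-(k x * gtail x)) x :=
  hasDerivAt_integral_Ioi (hk.mul continuous_gtail) (integrableOn_mul_gtail hk hk1) x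

lemma abs_wtail_le {k : ℝ → ℝ} (hk1 : ∀ x, |k x| ≤ 1) (x : ℝ) : |wtail k x| ≤ gtail2 x := by
  rw [← integral_Ioi_gtail, ← Real.norm_eq_abs]
  refine norm_integral_le_of_norm_le (integrableOn_gtail x) (ae_of_all _ fun y => ?_)
  rw [Real.norm_eq_abs, abs_mul, abs_of_pos (gtail_pos y)]
  exact mul_le_of_le_one_left (gtail_pos y).le (hk1 y)

lemma hasDerivAt_wtail_reflect {k : ℝ → ℝ} (hk : Continuous k) (hk1 : ∀ x, |k x| ≤ 1) 
    (x : ℝ) :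
    HasDerivAt (fun x => wtail (fun u => k (-u)) (-x)) (k x * gtail (-x)) x := by
  have h := hasDerivAt_wtail (k := fun u => k (-u)) (hk.comp continuous_neg)
    (fun u => hk1 (-u)) (-x)
  have := HasDerivAt.scomp x h (hasDerivAt_neg x)
  simpa [Function.comp_def] using this

lemma sqrt_two_pi_ge : (5 / 2 : ℝ) ≤ Real.sqrt (2 * Real.pi) := by
  refine Real.le_sqrt_of_sq_le ?_
  have := Real.pi_gt_d2
  norm_num at *; linarith

/-- This is what makes `|g'| ≤ 1` in Stein's equation. With `θ² = gtail2 x / gw x`, Birnbaum's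
inequality bounds `x θ` by `1 - θ²`, and only an inequality for a polynomial in `θ ∈ [0, 1]`
remains. -/
lemma two_mul_gtail2_mul_le_aux {x : ℝ} (hx : 0 ≤ x) :
    2 * (gtail2 (-x) * gtail2 x) ≤ Real.sqrt (2 * Real.pi) * gw x := by
  have hb := gtail_pos x
  have hw := gw_pos x
  have hB := gtail2_nonneg x
  have hs := sqrt_two_pi_ge
  set c := Real.sqrt (2 * Real.pi) with hc
  have hA : gtail2 (-x) = gtail2 x + x * c := by
    rw [hc, ← gtail_add_gtail_neg x, gtail2, gtail2, gw_neg]; ring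
  have hw1 : gw x ≤ 1 := by
    unfold gw; rw [Real.exp_le_one_iff]; nlinarith [sq_nonneg x]
  have hbir := gw_sq_le x
  set b := gtail x with hbd
  set w := gw x with hwd
  have hBd : gtail2 x = w - x * b := rfl
  set B := gtail2 x with hBdef
  have hBw : B ≤ w := by
    have := mul_nonneg hx hb.le
    linarith
  -- This is Birnbaum's inequality rewritten with `B = w - x b`.
  have h1 : w * B ≤ b ^ 2 := by rw [hBd]; nlinarith
  set θ := Real.sqrt (B / w) with hθ
  have hθ2 : θ ^ 2 = B / w := Real.sq_sqrt (by positivity)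
  have hθ0 : 0 ≤ θ := Real.sqrt_nonneg _
  have hθB : w * θ ^ 2 = B := by rw [hθ2]; field_simp
  have hθ1 : θ ≤ 1 := by
    rw [hθ]; apply Real.sqrt_le_one.mpr
    exact (div_le_one hw).2 hBw
  have hwθ : w * θ ≤ b := by
    refine le_of_sq_le_sq ?_ hb.le
    calc (w * θ) ^ 2 = w * (w * θ ^ 2) := by ring
      _ = w * B := by rw [hθB]
      _ ≤ b ^ 2 := h1
  have hxb : x * (w * θ) ≤ w * (1 - θ ^ 2) := by
    have := mul_le_mul_of_nonneg_left hwθ hx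
    nlinarith
  have hxθ : x * θ ≤ 1 - θ ^ 2 := by
    have : w * (x * θ) ≤ w * (1 - θ ^ 2) := by nlinarith
    exact le_of_mul_le_mul_left this hw
  rw [hA]
  have h5 : 2 * (w * θ ^ 4 + θ * (1 - θ ^ 2) * c) ≤ c := by
    -- The constant `5/2` is the lower bound for `√(2π)` from `sqrt_two_pi_ge`; the factor `w ≤ 1`
    -- has been dropped.
    have hpoly : 2 * θ ^ 4 ≤ (5 / 2) * (1 - 2 * θ + 2 * θ ^ 3) := by
      nlinarith [sq_nonneg (θ - 3 / 4), sq_nonneg (θ ^ 2 - 9 / 16), sq_nonneg (θ ^ 2 - θ),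
        mul_nonneg hθ0 (sub_nonneg.2 hθ1), mul_nonneg (mul_nonneg hθ0 (sub_nonneg.2 hθ1)) hθ0,
        mul_nonneg (mul_nonneg hθ0 (sub_nonneg.2 hθ1)) (sq_nonneg (θ - 3/4)),
        mul_nonneg hθ0 (sq_nonneg (θ - 3/4))]
    have hpos : 0 ≤ 1 - 2 * θ + 2 * θ ^ 3 := by nlinarith [pow_nonneg hθ0 4]
    have : w * θ ^ 4 ≤ θ ^ 4 := mul_le_of_le_one_left (pow_nonneg hθ0 4) hw1
    nlinarith [mul_le_mul_of_nonneg_right hs hpos]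
  have h6 : θ * (x * θ) ≤ θ * (1 - θ ^ 2) := mul_le_mul_of_nonneg_left hxθ hθ0
  have h7 : w * (2 * (w * θ ^ 4 + θ * (1 - θ ^ 2) * c)) ≤ w * c :=
    mul_le_mul_of_nonneg_left h5 hw.le
  have h8 : w * c * (θ * (x * θ)) ≤ w * c * (θ * (1 - θ ^ 2)) :=
    mul_le_mul_of_nonneg_left h6 (by positivity)
  rw [← hθB]
  nlinarith

lemma two_mul_gtail2_mul_le (x : ℝ) :
    2 * (gtail2 (-x) * gtail2 x) ≤ Real.sqrt (2 * Real.pi) * gw x := by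
  rcases le_total 0 x with hx | hx
  · exact two_mul_gtail2_mul_le_aux hx
  · have := two_mul_gtail2_mul_le_aux (x := -x) (by linarith)
    rw [neg_neg, gw_neg] at this
    linarith
end UniformChaos

/-! ### Stein's solution and its bounds. -/

namespace UniformChaos

/-- The solution of Stein's equation for a `C¹` test function with derivative bounded by `1`,
with the classical bounds on its first two derivatives. -/
theorem exists_stein_solution {h k : ℝ → ℝ} (hd : ∀ x, HasDerivAt h (k x) x)
    (hk : Continuous k) (hk1 : ∀ x, |k x| ≤ 1) :
    ∃ g g1 g2 : ℝ → ℝ, (∀ x, HasDerivAt g (g1 x) x) ∧ (∀ x, HasDerivAt g1 (g2 x) x) ∧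
      (∀ x, |g x| ≤ 1) ∧ (∀ x, |g1 x| ≤ 1) ∧ (∀ x, |g2 x| ≤ 2) ∧
      ∃ κ, ∀ x, g1 x - x * g x = h x - κ := by
  set c := Real.sqrt (2 * Real.pi) with hc
  have hc0 : 0 < c := lt_of_lt_of_le (by norm_num) sqrt_two_pi_ge
  -- After reflection `P x` is the integral of `k u * gtail (-u)` over `u < x`, while `Q x` is that
  -- of `k u * gtail u` over `u > x`. Integration by parts suggests that `(P - Q) / c` is `h` minus
  -- its Gaussian mean, so that `g` and its derivatives become explicit combinations of `P` and `Q`.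
  set P : ℝ → ℝ := fun x => wtail (fun u => k (-u)) (-x) with hP
  set Q : ℝ → ℝ := wtail k with hQ
  have hPd : ∀ x, HasDerivAt P (k x * gtail (-x)) x := hasDerivAt_wtail_reflect hk hk1
  have hQd : ∀ x, HasDerivAt Q (-(k x * gtail x)) x := hasDerivAt_wtail hk hk1
  have hPb : ∀ x, |P x| ≤ gtail2 (-x) := fun x => abs_wtail_le (fun u => hk1 (-u)) (-x)
  have hQb : ∀ x, |Q x| ≤ gtail2 x := abs_wtail_le hk1
  have hab : ∀ x, gtail x + gtail (-x) = c := gtail_add_gtail_neg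
  have hB : ∀ x, gtail2 x = gw x - x * gtail x := fun x => rfl
  have hA : ∀ x, gtail2 (-x) = gw x + x * gtail (-x) := fun x => by rw [gtail2, gw_neg]; ring
  have hcw : ∀ x, 0 < c * gw x := fun x => mul_pos hc0 (gw_pos x)
  -- The bounds for `g` and for `g2 - k` are sharp uses of this identity: after `|P| ≤ gtail2 (-x)`
  -- and `|Q| ≤ gtail2 x` the numerator is exactly `c * gw x`.
  have hsum : ∀ x, gtail x * gtail2 (-x) + gtail (-x) * gtail2 x = c * gw x := fun x => by
    rw [hA, hB, ← hab x]; ring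
  set g : ℝ → ℝ := fun x => -(gtail x * P x + gtail (-x) * Q x) / (c * gw x) with hg
  set g1 : ℝ → ℝ := fun x => (gtail2 x * P x - gtail2 (-x) * Q x) / (c * gw x) with hg1
  have hg1' : ∀ x, g1 x = (P x - Q x) / c + x * g x := fun x => by
    have := (gw_pos x).ne'
    simp only [hg, hg1, hA, hB]
    field_simp
    ring
  have hgd : ∀ x, HasDerivAt g (g1 x) x := fun x => by
    have hw := (gw_pos x).ne'
    have ha : HasDerivAt (fun x => gtail (-x)) (gw x) x := by
      have := HasDerivAt.scomp x (hasDerivAt_gtail (-x)) (hasDerivAt_neg x)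
      simpa [Function.comp_def, gw_neg] using this
    have h1 := (((hasDerivAt_gtail x).fun_mul (hPd x)).fun_add (ha.fun_mul (hQd x))).fun_neg
    have h2 := h1.fun_div ((hasDerivAt_gw x).const_mul c) (hcw x).ne'
    refine h2.congr_deriv ?_
    simp only [hg1, hA, hB]
    field_simp
    ring
  have hPQ : ∀ x, HasDerivAt (fun x => (P x - Q x) / c) (k x) x := fun x => by
    refine (((hPd x).fun_sub (hQd x)).div_const c).congr_deriv ?_
    rw [← hab x]
    have := hab x ▸ hc0.ne'
    field_simp
    ring
  set g2 : ℝ → ℝ := fun x => k x + (g x + x * g1 x) with hg2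
  have hg2' : ∀ x, g2 x = k x +
      ((x * gtail2 x - gtail x) * P x - (x * gtail2 (-x) + gtail (-x)) * Q x) / (c * gw x) :=
    fun x => by simp only [hg2, hg, hg1]; ring
  refine ⟨g, g1, g2, hgd, fun x => ?_, fun x => ?_, fun x => ?_, fun x => ?_, ?_⟩
  · have h := (hPQ x).fun_add ((hasDerivAt_id' x).fun_mul (hgd x))
    have e : g1 = fun x => (P x - Q x) / c + x * g x := funext hg1'
    rw [e]
    refine h.congr_deriv ?_
    simp only [hg2, one_mul]
  · simp only [hg]
    rw [abs_div, abs_neg, abs_of_pos (hcw x), div_le_one (hcw x), ← hsum x]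
    refine (abs_add_le _ _).trans ?_
    rw [abs_mul, abs_mul, abs_of_pos (gtail_pos x), abs_of_pos (gtail_pos (-x))]
    have := gtail_pos x
    have := gtail_pos (-x)
    gcongr
    · exact hPb x
    · exact hQb x
  · simp only [hg1]
    rw [abs_div, abs_of_pos (hcw x), div_le_one (hcw x)]
    refine (abs_sub _ _).trans (le_trans ?_ (two_mul_gtail2_mul_le x))
    rw [abs_mul, abs_mul, abs_of_nonneg (gtail2_nonneg x), abs_of_nonneg (gtail2_nonneg (-x))]
    have h1 := mul_le_mul_of_nonneg_left (hPb x) (gtail2_nonneg x)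
    have h2 := mul_le_mul_of_nonneg_left (hQb x) (gtail2_nonneg (-x))
    linarith
  · rw [hg2']
    have h1 : x * gtail2 x - gtail x ≤ 0 := by
      have := mul_gw_le x
      rw [hB]; nlinarith
    have h2 : 0 ≤ x * gtail2 (-x) + gtail (-x) := by
      have := mul_gw_le (-x)
      rw [gw_neg] at this
      rw [hA]; nlinarith
    -- By the signs `h1` and `h2`, the two products `x * gtail2 x * gtail2 (-x)` cancel and `hsum`
    -- remains. Hence `|g''| ≤ |k| + 1`.
    have h3 : |((x * gtail2 x - gtail x) * P x - (x * gtail2 (-x) + gtail (-x)) * Q x)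
        / (c * gw x)| ≤ 1 := by
      rw [abs_div, abs_of_pos (hcw x), div_le_one (hcw x), ← hsum x]
      refine (abs_sub _ _).trans ?_
      rw [abs_mul, abs_mul, abs_of_nonpos h1, abs_of_nonneg h2]
      have e1 := mul_le_mul_of_nonneg_left (hPb x) (neg_nonneg.2 h1)
      have e2 := mul_le_mul_of_nonneg_left (hQb x) h2
      nlinarith
    have := abs_add_le (k x) (((x * gtail2 x - gtail x) * P x -
      (x * gtail2 (-x) + gtail (-x)) * Q x) / (c * gw x))
    have := hk1 x
    linarith
  -- `(P - Q) / c` and `h` have the same derivative, so they differ by a constant. Its value as the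
  -- Gaussian mean is not needed here; it follows from the equation itself in
  -- `integral_gaussian_stein`.
  · refine ⟨h 0 - (P 0 - Q 0) / c, fun x => ?_⟩
    have hdiff : ∀ x, HasDerivAt (fun x => (P x - Q x) / c - h x) 0 x := fun x =>
      ((hPQ x).fun_sub (hd x)).congr_deriv (by ring)
    have := is_const_of_deriv_eq_zero (fun x => (hdiff x).differentiableAt)
      (fun x => (hdiff x).deriv) x 0
    rw [hg1' x]
    linarith

/-- `(h - κ) gw` is the derivative of `g gw`, which vanishes at both ends because `g` is bounded. -/
lemma integral_gaussian_stein {g g1 h : ℝ → ℝ} {κ : ℝ} (hg : ∀ x, HasDerivAt g (g1 x) x)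
    (hgb : ∀ x, |g x| ≤ 1) (hint : Integrable h (gaussianReal 0 1))
    (heq : ∀ x, g1 x - x * g x = h x - κ) : ∫ x, h x ∂gaussianReal 0 1 = κ := by
  have hpdf : ∀ x, gaussianPDFReal 0 1 x = (Real.sqrt (2 * Real.pi))⁻¹ * gw x := fun x => by
    simp only [gaussianPDFReal, gw]
    norm_num
    left; ring
  have hc0 : 0 < Real.sqrt (2 * Real.pi) := lt_of_lt_of_le (by norm_num) sqrt_two_pi_ge
  have h1 : Integrable (fun x => h x - κ) (gaussianReal 0 1) := hint.sub (integrable_const κ)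
  have hi : Integrable (fun x => (h x - κ) * gw x) := by
    rw [gaussianReal_of_var_ne_zero _ one_ne_zero,
      integrable_withDensity_iff_integrable_smul' (measurable_gaussianPDF _ _)
        (ae_of_all _ fun _ => by simp [gaussianPDF])] at h1
    have h2 := h1.const_mul (Real.sqrt (2 * Real.pi))
    refine h2.congr (ae_of_all _ fun x => ?_)
    simp only [gaussianPDF, smul_eq_mul]
    rw [ENNReal.toReal_ofReal (gaussianPDFReal_nonneg _ _ _), hpdf]
    field_simp
  have hd : ∀ x, HasDerivAt (fun x => g x * gw x) ((h x - κ) * gw x) x := fun x =>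
    ((hg x).fun_mul (hasDerivAt_gw x)).congr_deriv (by rw [← heq x]; ring)
  have hb : ∀ x, ‖g x * gw x‖ ≤ gw x := fun x => by
    rw [Real.norm_eq_abs, abs_mul, abs_of_pos (gw_pos x)]
    exact mul_le_of_le_one_left (gw_pos x).le (hgb x)
  have h0 := integral_of_hasDerivAt_of_tendsto hd hi
    (squeeze_zero_norm hb tendsto_gw_atBot) (squeeze_zero_norm hb tendsto_gw_atTop)
  have h2 : ∫ x, (h x - κ) ∂gaussianReal 0 1 = 0 := by
    rw [integral_gaussianReal_eq_integral_smul one_ne_zero]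
    have : (fun x => gaussianPDFReal 0 1 x • (h x - κ))
        = fun x => (Real.sqrt (2 * Real.pi))⁻¹ * ((h x - κ) * gw x) := by
      funext x; rw [hpdf, smul_eq_mul]; ring
    rw [this, integral_const_mul, h0]; simp
  rw [integral_sub hint (integrable_const κ)] at h2
  simp at h2
  linarith

/-! ### Reduction from Lipschitz test functions to Stein's equation. -/

lemma LipschitzWith.abs_le_add {h : ℝ → ℝ} (hh : LipschitzWith 1 h) (x : ℝ) :
    |h x| ≤ |h 0| + |x| := by
  have := hh.dist_le_mul x 0
  simp only [Real.dist_eq, NNReal.coe_one, one_mul, sub_zero] at this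
  have h2 := abs_sub_abs_le_abs_sub (h x) (h 0)
  linarith

lemma LipschitzWith.integrable_of_integrable_id {μ : Measure ℝ} [IsFiniteMeasure μ]
    (hμ : Integrable id μ) {h : ℝ → ℝ} (hh : LipschitzWith 1 h) : Integrable h μ := by
  refine Integrable.mono' ((integrable_const |h 0|).add hμ.abs)
    hh.continuous.aestronglyMeasurable (ae_of_all _ fun x => ?_)
  exact LipschitzWith.abs_le_add hh x

lemma integrable_id_gaussian : Integrable (id : ℝ → ℝ) (gaussianReal 0 1) := by
  have := memLp_id_gaussianReal (μ := 0) (v := 1) 1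
  exact memLp_one_iff_integrable.1 this

/-- A `C¹` approximation of a `1`-Lipschitz function. -/
lemma exists_C1_approx {h : ℝ → ℝ} (hh : LipschitzWith 1 h) {ε : ℝ} (hε : 0 < ε) :
    ∃ h' k : ℝ → ℝ, (∀ x, HasDerivAt h' (k x) x) ∧ Continuous k ∧ (∀ x, |k x| ≤ 1) ∧
      ∀ x, |h' x - h x| ≤ ε := by
  have hc := hh.continuous
  have hp : ∀ x, HasDerivAt (fun x => ∫ t in (0 : ℝ)..x, h t) (h x) x := fun x =>
    intervalIntegral.integral_hasDerivAt_right (hc.intervalIntegrable 0 x)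
      hc.aestronglyMeasurable.stronglyMeasurableAtFilter hc.continuousAt
  have hL : ∀ x y, |h x - h y| ≤ |x - y| := fun x y => by
    simpa [Real.dist_eq] using hh.dist_le_mul x y
  -- The running average over `[x, x + ε]`: its derivative is a difference quotient of `h`, hence
  -- continuous and bounded by the Lipschitz constant.
  refine ⟨fun x => ε⁻¹ * ∫ t in x..(x + ε), h t, fun x => ε⁻¹ * (h (x + ε) - h x), fun x => ?_,
    by fun_prop, fun x => ?_, fun x => ?_⟩
  · have e : (fun x => ε⁻¹ * ∫ t in x..(x + ε), h t)
        = fun x => ε⁻¹ * ((∫ t in (0 : ℝ)..(x + ε), h t) - ∫ t in (0 : ℝ)..x, h t) := by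
      funext x
      rw [intervalIntegral.integral_interval_sub_left (hc.intervalIntegrable _ _)
        (hc.intervalIntegrable _ _)]
    rw [e]
    exact (((hp (x + ε)).comp_add_const x ε).fun_sub (hp x)).const_mul _
  · rw [abs_mul, abs_of_pos (inv_pos.2 hε)]
    have := hL (x + ε) x
    rw [add_sub_cancel_left, abs_of_pos hε] at this
    rw [inv_mul_le_iff₀ hε]; linarith
  · have e : ε⁻¹ * (∫ t in x..(x + ε), h t) - h x = ε⁻¹ * ∫ t in x..(x + ε), (h t - h x) := by
      rw [intervalIntegral.integral_sub (hc.intervalIntegrable _ _) (by simp)]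
      simp; field_simp
    rw [e, abs_mul, abs_of_pos (inv_pos.2 hε), inv_mul_le_iff₀ hε]
    have := intervalIntegral.norm_integral_le_of_norm_le_const (a := x) (b := x + ε) (C := ε)
      (f := fun t => h t - h x) (fun t ht => by
        rw [Set.uIoc_of_le (by linarith)] at ht
        refine (hL t x).trans ?_
        rw [abs_of_nonneg (by linarith [ht.1])]; linarith [ht.2])
    rw [Real.norm_eq_abs, add_sub_cancel_left, abs_of_pos hε] at this
    exact this

/-- It suffices to test the distance to the normal law through Stein's equation. -/
theorem abs_integral_sub_gaussian_le_of_stein {μ : Measure ℝ} [IsProbabilityMeasure μ]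
    (hμ : Integrable id μ) {C : ℝ}
    (H : ∀ g g1 g2 : ℝ → ℝ, (∀ x, HasDerivAt g (g1 x) x) → (∀ x, HasDerivAt g1 (g2 x) x) →
      (∀ x, |g x| ≤ 1) → (∀ x, |g1 x| ≤ 1) → (∀ x, |g2 x| ≤ 2) →
      |∫ x, (g1 x - x * g x) ∂μ| ≤ C) {h : ℝ → ℝ} (hh : LipschitzWith 1 h) :
    |∫ x, h x ∂μ - ∫ x, h x ∂gaussianReal 0 1| ≤ C := by
  refine le_of_forall_pos_le_add fun ε hε => ?_
  obtain ⟨h', k, hd, hk, hk1, happ⟩ := exists_C1_approx hh (half_pos hε)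
  have hi := LipschitzWith.integrable_of_integrable_id hμ hh
  have hiG := LipschitzWith.integrable_of_integrable_id integrable_id_gaussian hh
  have hlip : LipschitzWith 1 h' := by
    refine lipschitzWith_of_nnnorm_deriv_le (fun x => (hd x).differentiableAt) fun x => ?_
    rw [(hd x).deriv]
    exact_mod_cast hk1 x
  have hi' := LipschitzWith.integrable_of_integrable_id hμ hlip
  have hiG' := LipschitzWith.integrable_of_integrable_id integrable_id_gaussian hlip
  obtain ⟨g, g1, g2, h1, h2, h3, h4, h5, κ, h6⟩ := exists_stein_solution hd hk hk1
  have hκ := integral_gaussian_stein h1 h3 hiG' h6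
  have hC := H g g1 g2 h1 h2 h3 h4 h5
  have e : ∫ x, (g1 x - x * g x) ∂μ = ∫ x, h' x ∂μ - κ := by
    rw [integral_congr_ae (ae_of_all _ h6), integral_sub hi' (integrable_const _)]
    simp
  rw [e, ← hκ] at hC
  have hclose : ∀ (ν : Measure ℝ) [IsProbabilityMeasure ν], Integrable h ν → Integrable h' ν →
      |∫ x, h' x ∂ν - ∫ x, h x ∂ν| ≤ ε / 2 := fun ν _ a b => by
    rw [← integral_sub b a]
    have := norm_integral_le_of_norm_le_const (μ := ν) (f := fun x => h' x - h x)
      (ae_of_all _ happ)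
    simpa using this
  have c1 := abs_le.1 (hclose μ hi hi')
  have c2 := abs_le.1 (hclose (gaussianReal 0 1) hiG hiG')
  have c3 := abs_le.1 hC
  rw [abs_le]
  constructor <;> linarith [c1.1, c1.2, c2.1, c2.2, c3.1, c3.2]

end UniformChaos

namespace UniformChaos

/-! ### Coordinate selections in product spaces -/

section Selection
variable {ι κ : Type*} [Fintype ι] [Fintype κ]

/-- Selecting coordinates means splitting the product into chosen and discarded factors, projecting
and relabelling. The projection preserves measure when the discarded factors are probability
measures; in general it only respects null sets. Both uses follow. -/
lemma exists_selection_factor (M : κ → Measure ℝ) [∀ c, SigmaFinite (M c)] {s : ι → κ}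
    (hs : Function.Injective s) :
    ∃ (M₁ : Measure ({c // ∃ i, s i = c} → ℝ)) (M₂ : Measure ({c // ¬ ∃ i, s i = c} → ℝ))
      (T : (κ → ℝ) → ({c // ∃ i, s i = c} → ℝ) × ({c // ¬ ∃ i, s i = c} → ℝ))
      (R : ({c // ∃ i, s i = c} → ℝ) → (ι → ℝ)),
      SigmaFinite M₂ ∧ ((∀ c, (¬ ∃ i, s i = c) → IsProbabilityMeasure (M c)) →
        IsProbabilityMeasure M₂) ∧ MeasurePreserving T (Measure.pi M) (M₁.prod M₂) ∧
      MeasurePreserving R M₁ (Measure.pi fun i => M (s i)) ∧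
      (fun x : κ → ℝ => x ∘ s) = R ∘ Prod.fst ∘ T := by
  classical
  let e : ι ≃ {c // ∃ i, s i = c} := Equiv.ofInjective s hs
  have h1 := measurePreserving_piEquivPiSubtypeProd M (fun c => ∃ i, s i = c)
  have h2 := (measurePreserving_piCongrLeft
    (fun c : {c // ∃ i, s i = c} => M c) e).symm
  refine ⟨Measure.pi fun c => M c, Measure.pi fun c => M c, _, _, inferInstance, fun h => ?_, h1,
    h2, ?_⟩
  · have : ∀ c : {c // ¬ ∃ i, s i = c}, IsProbabilityMeasure (M c) := fun c => h c c.2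
    infer_instance
  · funext x i
    simp [MeasurableEquiv.piCongrLeft, MeasurableEquiv.piEquivPiSubtypeProd, e,
      Equiv.piCongrLeft, Equiv.piCongrLeft']
    rfl

lemma quasiMeasurePreserving_selection (M : κ → Measure ℝ) [∀ c, SigmaFinite (M c)] {s : ι → κ}
    (hs : Function.Injective s) :
    Measure.QuasiMeasurePreserving (fun x : κ → ℝ => x ∘ s) (Measure.pi M)
      (Measure.pi fun i => M (s i)) := by
  obtain ⟨M₁, M₂, T, R, h1, -, hT, hR, e⟩ := exists_selection_factor M hs
  rw [e]
  exact hR.quasiMeasurePreserving.comp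
    (Measure.quasiMeasurePreserving_fst.comp hT.quasiMeasurePreserving)

lemma measurePreserving_selection (M : κ → Measure ℝ) [∀ c, SigmaFinite (M c)] {s : ι → κ}
    (hs : Function.Injective s) (hM : ∀ c, (¬ ∃ i, s i = c) → IsProbabilityMeasure (M c)) :
    MeasurePreserving (fun x : κ → ℝ => x ∘ s) (Measure.pi M)
      (Measure.pi fun i => M (s i)) := by
  obtain ⟨M₁, M₂, T, R, h1, h2, hT, hR, e⟩ := exists_selection_factor M hs
  have := h2 hM
  rw [e]
  exact hR.comp (measurePreserving_fst.comp hT)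

lemma measurePreserving_sumElim (μ : ι → Measure ℝ) (ν : κ → Measure ℝ) [∀ i, SigmaFinite (μ i)]
    [∀ i, SigmaFinite (ν i)] :
    MeasurePreserving (fun q : (ι → ℝ) × (κ → ℝ) => (Sum.elim q.1 q.2 : ι ⊕ κ → ℝ))
      ((Measure.pi μ).prod (Measure.pi ν)) (Measure.pi (Sum.elim μ ν)) := by
  have : ∀ c, SigmaFinite (Sum.elim μ ν c) := by rintro (i | i) <;> simp <;> infer_instance
  have h := measurePreserving_sumPiEquivProdPi_symm (X := fun _ : ι ⊕ κ => ℝ) (Sum.elim μ ν)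
  have e : (fun q : (ι → ℝ) × (κ → ℝ) => (Sum.elim q.1 q.2 : ι ⊕ κ → ℝ))
      = (MeasurableEquiv.sumPiEquivProdPi fun _ : ι ⊕ κ => ℝ).symm := by
    funext q c
    rcases c with c | c <;> rfl
  rw [e]
  exact h

end Selection

/-! ### Blocks and the law of the configuration -/

/-- The `k`-th block `[2k, 2k+2)`. -/
def block (k : ℕ) : Set ℝ := Set.Ico (2 * (k : ℝ)) (2 * (k : ℝ) + 2)

lemma measurableSet_block (k : ℕ) : MeasurableSet (block k) := measurableSet_Ico

/-- The uniform law on the `k`-th block. -/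
noncomputable def blockMeas (k : ℕ) : Measure ℝ := halfLeb.restrict (block k)

lemma blockMeas_eq (k : ℕ) : blockMeas k = (2⁻¹ : ℝ≥0∞) • (volume : Measure ℝ).restrict (block k) := by
  rw [blockMeas, halfLeb, Measure.restrict_smul, Measure.restrict_restrict (measurableSet_block k)]
  congr 2
  refine Set.inter_eq_left.2 fun x hx => ?_
  have : (0 : ℝ) ≤ 2 * (k : ℝ) := by positivity
  exact this.trans hx.1

instance (k : ℕ) : IsProbabilityMeasure (blockMeas k) := ⟨by
  rw [blockMeas_eq]
  simp only [block, Measure.smul_apply, Measure.restrict_apply MeasurableSet.univ, Set.univ_inter,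
    Real.volume_Ico, smul_eq_mul, add_sub_cancel_left]
  rw [ENNReal.ofReal_ofNat]
  exact ENNReal.inv_mul_cancel (by norm_num) (by norm_num)⟩

lemma blockMeas_ae_mem (k : ℕ) : ∀ᵐ t ∂blockMeas k, t ∈ block k :=
  ae_restrict_mem (measurableSet_block k)

/-- The law of the configuration `(2k+1+U_k)_k`. -/
noncomputable def conf : Measure (ℕ → ℝ) := Measure.infinitePi blockMeas

instance : IsProbabilityMeasure conf := by unfold conf; infer_instance

lemma measurePreserving_conf_eval (k : ℕ) : MeasurePreserving (fun x : ℕ → ℝ => x k) conf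
    (blockMeas k) := measurePreserving_eval_infinitePi blockMeas k

lemma conf_ae_mem : ∀ᵐ x ∂conf, ∀ k, x k ∈ block k :=
  ae_all_iff.2 fun k =>
    (measurePreserving_conf_eval k).quasiMeasurePreserving.ae (blockMeas_ae_mem k)

lemma measurePreserving_conf_comp {ι : Type*} [Fintype ι] {e : ι → ℕ}
    (he : Function.Injective e) :
    MeasurePreserving (fun x : ℕ → ℝ => x ∘ e) conf (Measure.pi fun i => blockMeas (e i)) :=
  ⟨measurable_pi_iff.2 fun i => measurable_pi_apply (e i), by
    rw [← Measure.infinitePi_eq_pi]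
    exact Measure.map_infinitePi_infinitePi_of_inj (P := blockMeas) he⟩

lemma measurable_extend_pair {ι : Type*} (e : ι → ℕ) :
    Measurable (fun q : (ι → ℝ) × (ℕ → ℝ) => Function.extend e q.1 q.2) := by
  classical
  refine measurable_pi_iff.2 fun k => ?_
  by_cases h : ∃ i, e i = k
  · simp only [Function.extend, h, dite_true]
    exact (measurable_pi_apply _).comp measurable_fst
  · simp only [Function.extend, h, dite_false]
    exact (measurable_pi_apply _).comp measurable_snd

/-- Resampling finitely many coordinates preserves the law of the configuration. -/
lemma measurePreserving_extend {ι : Type*} [Fintype ι] {e : ι → ℕ} (he : Function.Injective e) :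
    MeasurePreserving (fun q : (ι → ℝ) × (ℕ → ℝ) => Function.extend e q.1 q.2)
      ((Measure.pi fun i => blockMeas (e i)).prod conf) conf := by
  classical
  refine ⟨measurable_extend_pair e, Measure.eq_infinitePi _ fun s t ht => ?_⟩
  rw [Measure.map_apply (measurable_extend_pair e)
    (MeasurableSet.pi s.countable_toSet fun i _ => ht i)]
  -- Cylinders determine the product law. Their preimages are rectangles: the resampled coordinates
  -- constrain the first factor, all others the second.
  have : (fun q : (ι → ℝ) × (ℕ → ℝ) => Function.extend e q.1 q.2) ⁻¹' (Set.pi s t)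
      = (Set.univ.pi fun i => if e i ∈ s then t (e i) else Set.univ) ×ˢ
        (Set.pi (s.filter fun k => ¬ ∃ i, e i = k) t) := by
    ext q
    simp only [Set.mem_preimage, Set.mem_pi, Set.mem_prod, Set.mem_univ, true_implies,
      Finset.mem_coe, Finset.mem_filter]
    constructor
    · intro h
      refine ⟨fun i => ?_, fun k hk => ?_⟩
      · split_ifs with hi
        · have := h _ hi
          rwa [he.extend_apply] at this
        · trivial
      · have := h k hk.1
        rwa [Function.extend_apply' _ _ _ hk.2] at this
    · rintro ⟨h1, h2⟩ k hk
      by_cases hex : ∃ i, e i = k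
      · obtain ⟨i, rfl⟩ := hex
        have := h1 i
        rw [if_pos hk] at this
        rwa [he.extend_apply]
      · rw [Function.extend_apply' _ _ _ hex]
        exact h2 k ⟨hk, hex⟩
  rw [this, Measure.prod_prod, Measure.pi_pi, conf, Measure.infinitePi_pi _ (fun i _ => ht i)]
  rw [← Finset.prod_filter_mul_prod_filter_not s (fun k => ∃ i, e i = k)]
  congr 1
  have h1 : ∀ i, (blockMeas (e i)) (if e i ∈ s then t (e i) else Set.univ)
      = if e i ∈ s then blockMeas (e i) (t (e i)) else 1 := fun i => by
    split_ifs <;> simp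
  rw [Finset.prod_congr rfl fun i _ => h1 i, ← Finset.prod_filter]
  refine Finset.prod_bij (fun i _ => e i) (fun i hi => ?_) (fun i _ j _ h => he h)
    (fun k hk => ?_) (fun i _ => rfl)
  · simpa using hi
  · simp only [Finset.mem_filter] at hk
    obtain ⟨hk, i, rfl⟩ := hk
    exact ⟨i, by simpa using hk, rfl⟩

/-- Resampling one coordinate preserves the law of the configuration. -/
lemma measurePreserving_update (k : ℕ) :
    MeasurePreserving (fun q : (ℕ → ℝ) × ℝ => Function.update q.1 k q.2)
      (conf.prod (blockMeas k)) conf := by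
  have h1 := measurePreserving_extend (e := fun _ : Unit => k) (Function.injective_of_subsingleton _)
  have h2 := (measurePreserving_funUnique (blockMeas k) Unit).symm
  have h3 := (h2.prod (MeasurePreserving.id conf)).comp
    (Measure.measurePreserving_swap (μ := conf) (ν := blockMeas k))
  have h4 := h1.comp h3
  convert h4 using 1
  funext q j
  simp only [Function.comp_apply, Prod.swap, Prod.map_apply, id_eq]
  by_cases hj : j = k
  · subst hj
    have : Function.Injective (fun _ : Unit => j) := Function.injective_of_subsingleton _
    rw [Function.update_self]
    exact (this.extend_apply (MeasurableEquiv.funUnique Unit ℝ |>.symm q.2) q.1 ()).symm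
  · rw [Function.update_of_ne hj, Function.extend_apply']
    rintro ⟨-, h⟩
    exact hj h.symm

lemma halfLeb_eq_restrict : halfLeb = halfLeb.restrict (⋃ k, block k) := by
  have h : (⋃ k, block k) = Set.Ici 0 := by
    ext x
    simp only [block, Set.mem_iUnion, Set.mem_Ico, Set.mem_Ici]
    constructor
    · rintro ⟨k, h, -⟩
      exact le_trans (by positivity) h
    · intro hx
      refine ⟨⌊x / 2⌋₊, ?_, ?_⟩
      · have := Nat.floor_le (show 0 ≤ x / 2 by positivity)
        linarith
      · have := Nat.lt_floor_add_one (x / 2)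
        linarith
  rw [h, halfLeb, Measure.restrict_smul, Measure.restrict_restrict measurableSet_Ici,
    Set.inter_self]

lemma block_eq_of_mem {x : ℝ} {i j : ℕ} (hi : x ∈ block i) (hj : x ∈ block j) : i = j := by
  have h1 : (i : ℝ) < j + 1 := by linarith [hi.1, hj.2]
  have h2 : (j : ℝ) < i + 1 := by linarith [hj.1, hi.2]
  have h1' : i < j + 1 := by exact_mod_cast h1
  have h2' : j < i + 1 := by exact_mod_cast h2
  omega

lemma pi_blockMeas_eq {ι : Type*} [Fintype ι] (e : ι → ℕ) :
    (Measure.pi fun i => blockMeas (e i))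
      = (Measure.pi fun _ : ι => halfLeb).restrict (Set.univ.pi fun i => block (e i)) :=
  (Measure.restrict_pi_pi _ _).symm

/-- The half-open blocks tile `[0, ∞)`. This is the bridge between norms of kernels and sums of
expectations over the configuration. -/
lemma pi_halfLeb_eq_sum {ι : Type*} [Fintype ι] :
    (Measure.pi fun _ : ι => halfLeb)
      = Measure.sum fun e : ι → ℕ => Measure.pi fun i => blockMeas (e i) := by
  classical
  have h1 : (Measure.pi fun _ : ι => halfLeb)
      = (Measure.pi fun _ : ι => halfLeb).restrict (⋃ e : ι → ℕ, Set.univ.pi fun i => block (e i)) := by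
    have h2 : (⋃ e : ι → ℕ, Set.univ.pi fun i => block (e i))
        = Set.univ.pi fun _ : ι => ⋃ k, block k := Set.iUnion_univ_pi (fun _ k => block k)
    rw [h2, Measure.restrict_pi_pi, ← halfLeb_eq_restrict]
  rw [h1, Measure.restrict_iUnion]
  · simp_rw [pi_blockMeas_eq]
  · intro e e' hne
    refine Set.disjoint_left.2 fun x hx hx' => hne ?_
    funext i
    exact block_eq_of_mem (hx i trivial) (hx' i trivial)
  · exact fun e => MeasurableSet.univ_pi fun i => measurableSet_block _

lemma halfLeb_eq_sum : halfLeb = Measure.sum blockMeas := by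
  conv_lhs => rw [halfLeb_eq_restrict]
  rw [Measure.restrict_iUnion]
  · rfl
  · intro i j hne
    exact Set.disjoint_left.2 fun x hx hx' => hne (block_eq_of_mem hx hx')
  · exact measurableSet_block

lemma pi_blockMeas_le {n : ℕ} (e : Fin n → ℕ) :
    (Measure.pi fun i => blockMeas (e i)) ≤ halfPow n := by
  rw [pi_blockMeas_eq]; exact Measure.restrict_le_self

/-- Lets kernels be modified on null sets: the law of finitely many distinct coordinates is
dominated by `halfPow`. -/
lemma quasiMeasurePreserving_conf_comp {n : ℕ} {e : Fin n → ℕ} (he : Function.Injective e) :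
    Measure.QuasiMeasurePreserving (fun x : ℕ → ℝ => x ∘ e) conf (halfPow n) :=
  (measurePreserving_conf_comp he).quasiMeasurePreserving.mono_right
    (Measure.absolutelyContinuous_of_le (pi_blockMeas_le e))

instance (n : ℕ) : SigmaFinite (halfPow n) := by unfold halfPow; infer_instance

end UniformChaos

namespace UniformChaos

/-! ### Symmetric functions evaluated at finite sets of coordinates -/

section SetEval
variable {β : Type*} [Zero β] {p : ℕ}

/-- The value of a symmetric function of `p` variables at the coordinates in `B`. -/
noncomputable def setEval (g : (Fin p → ℝ) → β) (B : Finset ℕ) (x : ℕ → ℝ) : β :=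
  if h : B.card = p then g (x ∘ B.orderEmbOfFin h) else 0

/-- Invariance under permutations of the variables. -/
def SymmFun (g : (Fin p → ℝ) → β) : Prop := ∀ (σ : Equiv.Perm (Fin p)) x, g (x ∘ σ) = g x

lemma exists_perm_comp {B : Finset ℕ} {e e' : Fin p → ℕ} 
    (he' : Function.Injective e') (hB : Finset.univ.image e = B)
    (hB' : Finset.univ.image e' = B) : ∃ σ : Equiv.Perm (Fin p), e' = e ∘ σ := by
  have h : ∀ i, ∃ j, e j = e' i := fun i => by
    have : e' i ∈ Finset.univ.image e := by
      rw [hB, ← hB']; exact Finset.mem_image_of_mem _ (Finset.mem_univ i)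
    simpa using this
  choose s hs using h
  have hinj : Function.Injective s := fun i j hij => he' (by rw [← hs i, ← hs j, hij])
  refine ⟨Equiv.ofBijective s (Finite.injective_iff_bijective.1 hinj), ?_⟩
  funext i
  exact (hs i).symm

lemma setEval_eq {g : (Fin p → ℝ) → β} (hg : SymmFun g) {B : Finset ℕ} {e : Fin p → ℕ}
    (he : Function.Injective e) (hB : Finset.univ.image e = B) (x : ℕ → ℝ) :
    setEval g B x = g (x ∘ e) := by
  have hc : B.card = p := by
    rw [← hB, Finset.card_image_of_injective _ he, Finset.card_univ, Fintype.card_fin]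
  rw [setEval, dif_pos hc]
  obtain ⟨σ, hσ⟩ := exists_perm_comp (e := B.orderEmbOfFin hc) he
    (by simp) hB
  rw [hσ, ← Function.comp_assoc, hg]

lemma exists_enum {B : Finset ℕ} (hB : B.card = p) :
    ∃ e : Fin p → ℕ, Function.Injective e ∧ Finset.univ.image e = B :=
  ⟨B.orderEmbOfFin hB, (B.orderEmbOfFin hB).injective, by simp⟩

lemma setEval_of_card_ne {g : (Fin p → ℝ) → β} {B : Finset ℕ} (hB : B.card ≠ p) (x : ℕ → ℝ) :
    setEval g B x = 0 := dif_neg hB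

lemma setEval_congr (g : (Fin p → ℝ) → β) {B : Finset ℕ} {x y : ℕ → ℝ}
    (h : ∀ i ∈ B, x i = y i) : setEval g B x = setEval g B y := by
  unfold setEval
  split_ifs with hc
  · congr 1
    funext i
    exact h _ (B.orderEmbOfFin_mem hc i)
  · rfl

lemma setEval_update (g : (Fin p → ℝ) → β) {B : Finset ℕ} {k : ℕ} (hk : k ∉ B) (x : ℕ → ℝ)
    (s : ℝ) : setEval g B (Function.update x k s) = setEval g B x :=
  setEval_congr g fun i hi => Function.update_of_ne (by rintro rfl; exact hk hi) _ _

lemma measurable_setEval [MeasurableSpace β] {g : (Fin p → ℝ) → β} (hg : Measurable g)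
    (B : Finset ℕ) : Measurable (setEval g B) := by
  unfold setEval
  split_ifs with h
  · exact hg.comp (measurable_pi_iff.2 fun i => measurable_pi_apply _)
  · exact measurable_const

end SetEval

/-- All enumerations of `B` arise from a fixed one by permuting its arguments. -/
lemma card_injective_image {p : ℕ} {S B : Finset ℕ} (hB : B ∈ Finset.powersetCard p S) :
    ((Fintype.piFinset fun _ : Fin p => S).filter fun e =>
      Function.Injective e ∧ Finset.univ.image e = B).card = p ! := by
  obtain ⟨hBS, hc⟩ := Finset.mem_powersetCard.1 hB
  obtain ⟨e₀, h₀, hB₀⟩ := exists_enum hc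
  have : (Finset.univ : Finset (Equiv.Perm (Fin p))).card = p ! := by
    rw [Finset.card_univ, Fintype.card_perm, Fintype.card_fin]
  rw [← this]
  symm
  refine Finset.card_bij (fun σ _ => e₀ ∘ σ) (fun σ _ => ?_) (fun σ _ τ _ h => ?_) fun e he => ?_
  · have him : Finset.univ.image (e₀ ∘ σ) = B := by
      rw [← hB₀, ← Finset.image_image]
      congr 1
      ext i; simp only [Finset.mem_image, Finset.mem_univ, true_and, iff_true]
      exact σ.surjective i
    refine Finset.mem_filter.2 ⟨Fintype.mem_piFinset.2 fun i => hBS ?_, h₀.comp σ.injective, him⟩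
    rw [← him]; exact Finset.mem_image_of_mem _ (Finset.mem_univ i)
  · ext i
    exact congrArg _ (h₀ (congrFun h i))
  · obtain ⟨-, hi, him⟩ := Finset.mem_filter.1 he
    obtain ⟨σ, hσ⟩ := exists_perm_comp hi hB₀ him
    exact ⟨σ, Finset.mem_univ _, hσ.symm⟩

/-- Summation over injective maps against summation over their images. -/
lemma sum_injective_image {p : ℕ} {R : Type*} [CommSemiring R] (S : Finset ℕ)
    (u : Finset ℕ → R) :
    ∑ e ∈ (Fintype.piFinset fun _ : Fin p => S).filter Function.Injective,
      u (Finset.univ.image e) = (p ! : R) * ∑ B ∈ Finset.powersetCard p S, u B := by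
  rw [← Finset.sum_fiberwise_of_maps_to (t := Finset.powersetCard p S)
    (g := fun e => Finset.univ.image e), Finset.mul_sum]
  · refine Finset.sum_congr rfl fun B hB => ?_
    rw [Finset.filter_filter, Finset.sum_congr rfl (g := fun _ => u B), Finset.sum_const,
      card_injective_image hB, nsmul_eq_mul]
    intro e he
    rw [(Finset.mem_filter.1 he).2.2]
  · intro e he
    obtain ⟨he, hi⟩ := Finset.mem_filter.1 he
    refine Finset.mem_powersetCard.2 ⟨?_, ?_⟩
    · intro k hk
      obtain ⟨i, -, rfl⟩ := Finset.mem_image.1 hk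
      exact Fintype.mem_piFinset.1 he i
    · rw [Finset.card_image_of_injective _ hi, Finset.card_univ, Fintype.card_fin]

/-- The sum over sets of coordinates is dominated by the integral over the half-lines. -/
lemma sum_lintegral_setEval_le {p : ℕ} {h : (Fin p → ℝ) → ℝ≥0∞} (hm : Measurable h)
    (hs : SymmFun h) (S : Finset ℕ) :
    (p ! : ℝ≥0∞) * ∑ B ∈ Finset.powersetCard p S, ∫⁻ x, setEval h B x ∂conf
      ≤ ∫⁻ y, h y ∂halfPow p := by
  rw [← sum_injective_image S (fun B => ∫⁻ x, setEval h B x ∂conf)]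
  rw [halfPow, pi_halfLeb_eq_sum, lintegral_sum_measure]
  -- The integral is a sum over all tuples of blocks; the left side keeps the injective tuples with
  -- entries in `S`.
  refine le_trans (le_of_eq ?_) (ENNReal.sum_le_tsum
    ((Fintype.piFinset fun _ : Fin p => S).filter Function.Injective))
  refine Finset.sum_congr rfl fun e he => ?_
  have hi := (Finset.mem_filter.1 he).2
  rw [← (measurePreserving_conf_comp hi).lintegral_comp hm]
  refine lintegral_congr fun x => ?_
  rw [setEval_eq hs hi rfl]

/-! ### Resampling and degenerate functions -/

/-- `v` integrates to zero in the `k`-th coordinate. -/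
def Degen (v : (ℕ → ℝ) → ℝ) (k : ℕ) : Prop :=
  ∀ᵐ x ∂conf, ∫ s, v (Function.update x k s) ∂blockMeas k = 0

lemma integrable_resample {u : (ℕ → ℝ) → ℝ} (hu : Integrable u conf) (k : ℕ) :
    Integrable (fun q : (ℕ → ℝ) × ℝ => u (Function.update q.1 k q.2))
      (conf.prod (blockMeas k)) :=
  (measurePreserving_update k).integrable_comp_of_integrable hu

lemma integral_resample {u : (ℕ → ℝ) → ℝ} (hu : Integrable u conf) (k : ℕ) :
    ∫ x, ∫ s, u (Function.update x k s) ∂blockMeas k ∂conf = ∫ x, u x ∂conf := by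
  rw [← integral_prod (fun q : (ℕ → ℝ) × ℝ => u (Function.update q.1 k q.2))
    (integrable_resample hu k)]
  have h := (measurePreserving_update k)
  have h2 : AEStronglyMeasurable u
    (Measure.map (fun q : (ℕ → ℝ) × ℝ => Function.update q.1 k q.2) (conf.prod (blockMeas k))) := by
    rw [h.map_eq]; exact hu.aestronglyMeasurable
  rw [← integral_map h.aemeasurable h2, h.map_eq]

lemma lintegral_resample {u : (ℕ → ℝ) → ℝ≥0∞} (hu : Measurable u) (k : ℕ) :
    ∫⁻ x, ∫⁻ s, u (Function.update x k s) ∂blockMeas k ∂conf = ∫⁻ x, u x ∂conf := by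
  rw [← (measurePreserving_update k).lintegral_comp hu, lintegral_prod]
  exact (hu.comp (measurePreserving_update k).measurable).aemeasurable

/-- The source of every orthogonality relation below: integrate the `k`-th coordinate first, and `u`
leaves the inner integral. A non-integrable product has integral zero by convention. -/
lemma integral_mul_eq_zero_of_degen {u v : (ℕ → ℝ) → ℝ} {k : ℕ}
    (hu : ∀ x s, u (Function.update x k s) = u x) (hv : Degen v k) :
    ∫ x, u x * v x ∂conf = 0 := by
  by_cases hi : Integrable (fun x => u x * v x) conf
  · rw [← integral_resample hi k]
    refine integral_eq_zero_of_ae ?_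
    filter_upwards [hv] with x hx
    simp only [hu, integral_const_mul, hx, mul_zero, Pi.zero_apply]
  · exact integral_undef hi

/-! ### Degenerate kernels -/

/-- Everywhere symmetric, square integrable kernels on pairwise distinct blocks that integrate
to zero in each variable over each block. -/
structure Kern {p : ℕ} (g : (Fin p → ℝ) → ℝ) : Prop where
  meas : Measurable g
  symm : SymmFun g
  vanish : ∀ (e : Fin p → ℕ) (x : Fin p → ℝ), (∀ i, x i ∈ block (e i)) →
    ¬ Function.Injective e → g x = 0
  memLp : MemLp g 2 (halfPow p)
  degen : ∀ B : Finset ℕ, ∀ b ∈ B, Degen (setEval g B) b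

variable {p : ℕ} {g : (Fin p → ℝ) → ℝ}

lemma memLp_setEval (hg : Kern g) (B : Finset ℕ) : MemLp (setEval g B) 2 conf := by
  by_cases hB : B.card = p
  · obtain ⟨e, he, him⟩ := exists_enum hB
    have : setEval g B = g ∘ fun x : ℕ → ℝ => x ∘ e := by
      funext x; exact setEval_eq hg.symm he him x
    rw [this]
    exact (hg.memLp.mono_measure (pi_blockMeas_le e)).comp_measurePreserving
      (measurePreserving_conf_comp he)
  · have : setEval g B = fun _ => 0 := by funext x; exact setEval_of_card_ne hB x
    rw [this]; exact MemLp.zero'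

/-- The multiple sum `∑ g(x_{k₁}, …, x_{k_p})` over pairwise distinct indices below `N`. -/
noncomputable def chaos (g : (Fin p → ℝ) → ℝ) (N : ℕ) (x : ℕ → ℝ) : ℝ :=
  (p ! : ℝ) * ∑ B ∈ Finset.powersetCard p (Finset.range N), setEval g B x

lemma measurable_chaos (hg : Measurable g) (N : ℕ) : Measurable (chaos g N) :=
  (Finset.measurable_sum _ fun B _ => measurable_setEval hg B).const_mul _

lemma memLp_chaos (hg : Kern g) (N : ℕ) : MemLp (chaos g N) 2 conf :=
  (memLp_finsetSum _ fun B _ => memLp_setEval hg B).const_mul _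

lemma chaos_update (g : (Fin p → ℝ) → ℝ) {N k : ℕ} (hk : N ≤ k) (x : ℕ → ℝ) (s : ℝ) :
    chaos g N (Function.update x k s) = chaos g N x := by
  unfold chaos
  congr 1
  refine Finset.sum_congr rfl fun B hB => setEval_update g (fun h => ?_) x s
  have := (Finset.mem_powersetCard.1 hB).1 h
  simp at this; omega

/-- Two different sets of the same size leave an index of `C` outside `B`, and the degeneracy in
that coordinate applies. -/
lemma integral_setEval_mul_setEval (hg : Kern g) {B C : Finset ℕ} (h : B ≠ C) :
    ∫ x, setEval g B x * setEval g C x ∂conf = 0 := by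
  by_cases hB : B.card = p
  swap
  · simp [setEval_of_card_ne hB]
  by_cases hC : C.card = p
  swap
  · simp [setEval_of_card_ne hC]
  have : ∃ c ∈ C, c ∉ B := by
    by_contra hcon
    push Not at hcon
    exact h (Finset.eq_of_subset_of_card_le hcon (by rw [hB, hC])).symm
  obtain ⟨c, hc, hcB⟩ := this
  exact integral_mul_eq_zero_of_degen (fun x s => setEval_update g hcB x s) (hg.degen C c hc)

lemma integrable_setEval_mul (hg : Kern g) (B C : Finset ℕ) :
    Integrable (fun x => setEval g B x * setEval g C x) conf :=
  MemLp.integrable_mul (memLp_setEval hg B) (memLp_setEval hg C)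

/-- Orthogonality of the terms of a multiple sum. -/
lemma integral_sum_setEval_sq (hg : Kern g) (𝓑 : Finset (Finset ℕ)) :
    ∫ x, (∑ B ∈ 𝓑, setEval g B x) ^ 2 ∂conf = ∑ B ∈ 𝓑, ∫ x, setEval g B x ^ 2 ∂conf := by
  simp_rw [sq, Finset.sum_mul_sum]
  rw [integral_finsetSum _ fun B _ => integrable_finsetSum _ fun C _ =>
    integrable_setEval_mul hg B C]
  refine Finset.sum_congr rfl fun B hB => ?_
  rw [integral_finsetSum _ fun C _ => integrable_setEval_mul hg B C]
  rw [Finset.sum_eq_single B (fun C _ hne => integral_setEval_mul_setEval hg hne.symm)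
    (fun h => absurd hB h)]

/-- The squared `L²`-norm of the kernel. -/
noncomputable def normSq (g : (Fin p → ℝ) → ℝ) : ℝ := ∫ y, g y ^ 2 ∂halfPow p

lemma sum_integral_setEval_sq_le {h : (Fin p → ℝ) → ℝ} (hm : Measurable h) (hs : SymmFun h)
    (hL : MemLp h 2 (halfPow p)) (S : Finset ℕ) :
    (p ! : ℝ) * ∑ B ∈ Finset.powersetCard p S, ∫ x, setEval h B x ^ 2 ∂conf ≤ normSq h := by
  have h1 := sum_lintegral_setEval_le (h := fun y => ENNReal.ofReal (h y ^ 2))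
    (by fun_prop) (fun σ x => by simp only [hs σ x]) S
  have h2 : ∀ B x, setEval (fun y => ENNReal.ofReal (h y ^ 2)) B x
      = ENNReal.ofReal (setEval h B x ^ 2) := fun B x => by
    unfold setEval; split_ifs <;> simp
  have h3 : ∫⁻ y, ENNReal.ofReal (h y ^ 2) ∂halfPow p = ENNReal.ofReal (normSq h) :=
    (ofReal_integral_eq_lintegral_ofReal hL.integrable_sq (ae_of_all _ fun _ => sq_nonneg _)).symm
  rw [h3] at h1
  have h4 : ∀ B, (∫ x, setEval h B x ^ 2 ∂conf)
      = (∫⁻ x, setEval (fun y => ENNReal.ofReal (h y ^ 2)) B x ∂conf).toReal := fun B => by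
    rw [integral_eq_lintegral_of_nonneg_ae (ae_of_all _ fun _ => sq_nonneg _)
      ((measurable_setEval hm B).pow_const 2).aestronglyMeasurable]
    simp only [h2]
  simp_rw [h4]
  have h0 : 0 ≤ normSq h := integral_nonneg fun _ => sq_nonneg _
  refine (ENNReal.ofReal_le_ofReal_iff h0).1 (le_trans (le_of_eq ?_) h1)
  have hp : (0 : ℝ) < (p ! : ℝ) := by exact_mod_cast Nat.factorial_pos p
  have hp' : (p ! : ℝ≥0∞) ≠ 0 := by exact_mod_cast (Nat.factorial_pos p).ne'
  have hfin : ∑ B ∈ Finset.powersetCard p S,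
      ∫⁻ x, setEval (fun y => ENNReal.ofReal (h y ^ 2)) B x ∂conf ≠ ∞ := fun htop => by
    rw [htop, ENNReal.mul_top hp'] at h1
    exact absurd h1 (by simp)
  rw [ENNReal.ofReal_mul hp.le, ENNReal.ofReal_natCast,
    ← ENNReal.toReal_sum (fun B hB => ?_), ENNReal.ofReal_toReal hfin]
  exact (ENNReal.sum_ne_top.1 hfin) B hB

lemma integral_chaos_sq (hg : Kern g) (N : ℕ) :
    ∫ x, chaos g N x ^ 2 ∂conf = (p ! : ℝ) ^ 2 *
      ∑ B ∈ Finset.powersetCard p (Finset.range N), ∫ x, setEval g B x ^ 2 ∂conf := by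
  unfold chaos
  simp_rw [mul_pow]
  rw [integral_const_mul, integral_sum_setEval_sq hg]

lemma integral_chaos_sq_le (hg : Kern g) (N : ℕ) :
    ∫ x, chaos g N x ^ 2 ∂conf ≤ (p ! : ℝ) * normSq g := by
  rw [integral_chaos_sq hg, sq, mul_assoc]
  exact mul_le_mul_of_nonneg_left
    (sum_integral_setEval_sq_le hg.meas hg.symm hg.memLp _) (by positivity)

end UniformChaos

namespace UniformChaos

/-! ### Duality along the Hoeffding decomposition of bounded functions -/

/-- Bounded measurable functions of the coordinates in `S ∪ K`, degenerate in those of `K`. -/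
structure TestFun (S K : Finset ℕ) (ψ : (ℕ → ℝ) → ℝ) : Prop where
  meas : Measurable ψ
  bdd : ∃ C, ∀ x, |ψ x| ≤ C
  dep : ∀ x y : ℕ → ℝ, (∀ i ∈ S ∪ K, x i = y i) → ψ x = ψ y
  degen : ∀ k ∈ K, Degen ψ k

/-- Averaging over the coordinate `s`. -/
noncomputable def avg (s : ℕ) (ψ : (ℕ → ℝ) → ℝ) (x : ℕ → ℝ) : ℝ :=
  ∫ t, ψ (Function.update x s t) ∂blockMeas s

lemma measurable_update_pair (s : ℕ) :
    Measurable (fun q : (ℕ → ℝ) × ℝ => Function.update q.1 s q.2) :=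
  (measurePreserving_update s).measurable

lemma measurable_avg {ψ : (ℕ → ℝ) → ℝ} (h : Measurable ψ) (s : ℕ) : Measurable (avg s ψ) := by
  have h1 : Measurable (Function.uncurry fun (x : ℕ → ℝ) (t : ℝ) => ψ (Function.update x s t)) :=
    h.comp (measurable_update_pair s)
  exact (h1.stronglyMeasurable.integral_prod_right (ν := blockMeas s)).measurable

lemma integrable_of_bdd {α : Type*} [MeasurableSpace α] {μ : Measure α} [IsFiniteMeasure μ]
    {ψ : α → ℝ} (h : Measurable ψ) {C : ℝ} (hC : ∀ x, |ψ x| ≤ C) : Integrable ψ μ :=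
  Integrable.of_bound h.aestronglyMeasurable C (ae_of_all _ hC)

lemma integrable_update_of_bdd {ψ : (ℕ → ℝ) → ℝ} (h : Measurable ψ) {C : ℝ}
    (hC : ∀ x, |ψ x| ≤ C) (s : ℕ) (x : ℕ → ℝ) :
    Integrable (fun t => ψ (Function.update x s t)) (blockMeas s) :=
  integrable_of_bdd (h.comp (measurable_update x)) fun _ => hC _

lemma abs_avg_le {ψ : (ℕ → ℝ) → ℝ} {C : ℝ} (hC : ∀ x, |ψ x| ≤ C) (s : ℕ) (x : ℕ → ℝ) :
    |avg s ψ x| ≤ C := by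
  have := norm_integral_le_of_norm_le_const (μ := blockMeas s)
    (f := fun t => ψ (Function.update x s t)) (C := C) (ae_of_all _ fun t => hC _)
  simpa [avg] using this

lemma avg_update (ψ : (ℕ → ℝ) → ℝ) (s : ℕ) (x : ℕ → ℝ) (t : ℝ) :
    avg s ψ (Function.update x s t) = avg s ψ x := by
  simp [avg]

/-- Averages over different coordinates commute by Fubini. -/
lemma degen_avg {ψ : (ℕ → ℝ) → ℝ} (h : Measurable ψ) {C : ℝ} (hC : ∀ x, |ψ x| ≤ C) {s k : ℕ}
    (hsk : k ≠ s) (hk : Degen ψ k) : Degen (avg s ψ) k := by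
  have h1 := Measure.ae_ae_of_ae_prod
    ((measurePreserving_update s).quasiMeasurePreserving.ae hk)
  filter_upwards [h1] with x hx
  simp only [avg]
  rw [integral_integral_swap]
  · refine integral_eq_zero_of_ae ?_
    filter_upwards [hx] with u hu
    simp_rw [Function.update_comm hsk]
    exact hu
  · refine integrable_of_bdd ?_ (C := C) fun q => hC _
    refine h.comp ?_
    exact (measurable_update_pair s).comp
      (((measurable_update x).comp measurable_fst).prodMk measurable_snd)

lemma TestFun.avg {S K : Finset ℕ} {s : ℕ} {ψ : (ℕ → ℝ) → ℝ} (h : TestFun (insert s S) K ψ)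
    (hs : s ∉ S) (hK : s ∉ K) : TestFun S K (avg s ψ) := by
  obtain ⟨C, hC⟩ := h.bdd
  refine ⟨measurable_avg h.meas s, ⟨C, abs_avg_le hC s⟩, fun x y hxy => ?_, fun k hk => ?_⟩
  · simp only [UniformChaos.avg]
    congr 1
    funext t
    refine h.dep _ _ fun i hi => ?_
    by_cases his : i = s
    · subst his; simp
    · rw [Function.update_of_ne his, Function.update_of_ne his]
      refine hxy i ?_
      simp only [Finset.mem_union, Finset.mem_insert] at hi ⊢
      tauto
  · exact degen_avg h.meas hC (fun e => hK (e ▸ hk)) (h.degen k hk)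

/-- One step of the Hoeffding decomposition: the part of `ψ` that remains after averaging over `s`
has become degenerate in `s`, so `s` moves from the free coordinates to the degenerate ones. -/
lemma TestFun.sub_avg {S K : Finset ℕ} {s : ℕ} {ψ : (ℕ → ℝ) → ℝ} (h : TestFun (insert s S) K ψ)
    (hs : s ∉ S) (hK : s ∉ K) :
    TestFun S (insert s K) (fun x => ψ x - UniformChaos.avg s ψ x) := by
  have h' := h.avg hs hK
  obtain ⟨C, hC⟩ := h.bdd
  refine ⟨h.meas.sub h'.meas, ⟨C + C, fun x => ?_⟩, fun x y hxy => ?_, fun k hk => ?_⟩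
  · exact (abs_sub _ _).trans (add_le_add (hC x) (abs_avg_le hC s x))
  · rw [h.dep x y fun i hi => hxy i ?_, h'.dep x y fun i hi => hxy i ?_]
    · simp only [Finset.mem_union, Finset.mem_insert] at hi ⊢
      tauto
    · simp only [Finset.mem_union, Finset.mem_insert] at hi ⊢
      tauto
  · have hint : ∀ x k, Integrable (fun t => ψ (Function.update x k t)) (blockMeas k) :=
      fun x k => integrable_update_of_bdd h.meas hC k x
    have hint' : ∀ x k, Integrable (fun t => UniformChaos.avg s ψ (Function.update x k t))
      (blockMeas k) := fun x k => integrable_update_of_bdd h'.meas (abs_avg_le hC s) k x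
    rcases Finset.mem_insert.1 hk with rfl | hk
    · refine ae_of_all _ fun x => ?_
      rw [integral_sub (hint x k) (hint' x k)]
      simp only [avg_update, integral_const, probReal_univ, one_smul]
      simp [UniformChaos.avg]
    · filter_upwards [h.degen k hk, h'.degen k hk] with x h1 h2
      rw [integral_sub (hint x k) (hint' x k), h1, h2, sub_zero]

/-- Pythagoras: the average does not depend on the coordinate `s` and the remainder is degenerate in
it. -/
lemma TestFun.integral_sq_eq {S K : Finset ℕ} {s : ℕ} {ψ : (ℕ → ℝ) → ℝ}
    (h : TestFun (insert s S) K ψ) (hs : s ∉ S) (hK : s ∉ K) :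
    ∫ x, ψ x ^ 2 ∂conf = ∫ x, UniformChaos.avg s ψ x ^ 2 ∂conf
      + ∫ x, (ψ x - UniformChaos.avg s ψ x) ^ 2 ∂conf := by
  have h1 := h.avg hs hK
  have h2 := h.sub_avg hs hK
  obtain ⟨C, hC⟩ := h.bdd
  have hz := integral_mul_eq_zero_of_degen (avg_update ψ s) (h2.degen s (Finset.mem_insert_self _ _))
  have hC2 := abs_avg_le hC s
  have hi1 : Integrable (fun x => UniformChaos.avg s ψ x ^ 2) conf :=
    integrable_of_bdd (h1.meas.pow_const 2) (C := C ^ 2) fun x => by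
      rw [abs_pow]; exact pow_le_pow_left₀ (abs_nonneg _) (hC2 x) 2
  have hC3 : ∀ x, |ψ x - UniformChaos.avg s ψ x| ≤ C + C := fun x =>
    (abs_sub _ _).trans (add_le_add (hC x) (hC2 x))
  have hi2 : Integrable (fun x => (ψ x - UniformChaos.avg s ψ x) ^ 2) conf :=
    integrable_of_bdd (h2.meas.pow_const 2) (C := (C + C) ^ 2) fun x => by
      rw [abs_pow]; exact pow_le_pow_left₀ (abs_nonneg _) (hC3 x) 2
  have hi3 : Integrable (fun x => UniformChaos.avg s ψ x * (ψ x - UniformChaos.avg s ψ x)) conf :=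
    integrable_of_bdd (h1.meas.mul h2.meas) (C := C * (C + C)) fun x => by
      rw [abs_mul]
      exact mul_le_mul (hC2 x) (hC3 x) (abs_nonneg _) ((abs_nonneg _).trans (hC2 x))
  have e : ∀ x, ψ x ^ 2 = (UniformChaos.avg s ψ x ^ 2 + (ψ x - UniformChaos.avg s ψ x) ^ 2)
      + 2 * (UniformChaos.avg s ψ x * (ψ x - UniformChaos.avg s ψ x)) := fun x => by ring
  simp_rw [e]
  have hi4 : Integrable (fun x => UniformChaos.avg s ψ x ^ 2 + (ψ x - UniformChaos.avg s ψ x) ^ 2)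
    conf := hi1.add hi2
  rw [integral_add hi4 (hi3.const_mul 2), integral_add hi1 hi2, integral_const_mul, hz]
  ring

lemma sqrt_mul_add_sqrt_mul_le {a b u v : ℝ} (ha : 0 ≤ a) (hb : 0 ≤ b) (hu : 0 ≤ u) (hv : 0 ≤ v) :
    √a * √u + √b * √v ≤ √(a + b) * √(u + v) := by
  have h1 := Real.sq_sqrt ha
  have h2 := Real.sq_sqrt hb
  have h3 := Real.sq_sqrt hu
  have h4 := Real.sq_sqrt hv
  refine le_of_sq_le_sq ?_ (by positivity)
  rw [mul_pow, Real.sq_sqrt (add_nonneg ha hb), Real.sq_sqrt (add_nonneg hu hv)]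
  have e : (√a * √u + √b * √v) ^ 2
      = √a ^ 2 * √u ^ 2 + √b ^ 2 * √v ^ 2 + 2 * ((√a * √v) * (√b * √u)) := by ring
  have e2 : (√a * √v - √b * √u) ^ 2
      = √a ^ 2 * √v ^ 2 + √b ^ 2 * √u ^ 2 - 2 * ((√a * √v) * (√b * √u)) := by ring
  rw [h1, h2, h3, h4] at e e2
  nlinarith [sq_nonneg (√a * √v - √b * √u)]

/-- A sequence of functionals whose limits on degenerate functions are controlled is controlled
on all bounded functions of finitely many coordinates. -/
theorem exists_limit_of_degenerate {L : ℕ → ((ℕ → ℝ) → ℝ) → ℝ} {κ : Finset ℕ → ℝ}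
    (hadd : ∀ N (u v : (ℕ → ℝ) → ℝ), Measurable u → Measurable v → (∃ C, ∀ x, |u x| ≤ C) →
      (∃ C, ∀ x, |v x| ≤ C) → L N (fun x => u x + v x) = L N u + L N v)
    (hL : ∀ A ψ, TestFun ∅ A ψ → ∃ ℓ, Tendsto (fun N => L N ψ) atTop (𝓝 ℓ) ∧
      |ℓ| ≤ κ A * √(∫ x, ψ x ^ 2 ∂conf))
    (hκ : ∀ A, 0 ≤ κ A) (S : Finset ℕ) :
    ∀ K ψ, Disjoint S K → TestFun S K ψ → ∃ ℓ, Tendsto (fun N => L N ψ) atTop (𝓝 ℓ) ∧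
      |ℓ| ≤ √(∑ A ∈ S.powerset, κ (A ∪ K) ^ 2) * √(∫ x, ψ x ^ 2 ∂conf) := by
  induction S using Finset.induction_on with
  | empty =>
    intro K ψ _ hψ
    obtain ⟨ℓ, h1, h2⟩ := hL K ψ hψ
    refine ⟨ℓ, h1, ?_⟩
    simpa [Real.sqrt_sq (hκ K)] using h2
  | insert s S hs ih =>
    intro K ψ hd hψ
    have hsK : s ∉ K := fun h => (Finset.disjoint_left.1 hd) (Finset.mem_insert_self s S) h
    have hSK : Disjoint S K := hd.mono_left (Finset.subset_insert s S)
    -- Split `ψ` into its average over `s` and a remainder degenerate in `s`. The induction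
    -- hypothesis holds for all `K`, so it applies to the first piece with `K` and to the second
    -- with `insert s K`.
    have h1 := hψ.avg hs hsK
    have h2 := hψ.sub_avg hs hsK
    have hSK' : Disjoint S (insert s K) := Finset.disjoint_insert_right.2 ⟨hs, hSK⟩
    obtain ⟨ℓ₁, t₁, b₁⟩ := ih K _ hSK h1
    obtain ⟨ℓ₂, t₂, b₂⟩ := ih (insert s K) _ hSK' h2
    refine ⟨ℓ₁ + ℓ₂, ?_, ?_⟩
    · refine (t₁.add t₂).congr fun N => ?_
      rw [← hadd N _ _ h1.meas h2.meas h1.bdd h2.bdd]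
      congr 1
      funext x; ring
    -- Subsets without `s` supply the constant of the averaged piece, subsets with `s` that of the
    -- remainder; the two bounds combine by Cauchy–Schwarz in the plane.
    · rw [Finset.sum_powerset_insert hs, hψ.integral_sq_eq hs hsK]
      have e : ∀ A, insert s A ∪ K = A ∪ insert s K := fun A => by
        rw [Finset.insert_union, Finset.union_insert]
      simp_rw [e]
      refine (abs_add_le _ _).trans ((add_le_add b₁ b₂).trans ?_)
      exact sqrt_mul_add_sqrt_mul_le (Finset.sum_nonneg fun _ _ => sq_nonneg _)
        (Finset.sum_nonneg fun _ _ => sq_nonneg _) (integral_nonneg fun _ => sq_nonneg _)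
        (integral_nonneg fun _ => sq_nonneg _)

end UniformChaos

namespace UniformChaos

/-! ### Counting injective maps with prescribed images of labelled classes -/

section Label
variable {J I : Type*} [Fintype J] [DecidableEq J] [Fintype I] [DecidableEq I] (lab : J → I)

/-- The image of the class with label `i`. -/
def cls (ε : J → ℕ) (i : I) : Finset ℕ := (Finset.univ.filter fun j => lab j = i).image ε

lemma mem_cls {ε : J → ℕ} {i : I} {a : ℕ} : a ∈ cls lab ε i ↔ ∃ j, lab j = i ∧ ε j = a := by
  simp [cls]

/-- Injections with the same class images differ by a permutation that preserves the labels, that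
is, an element of the stabilizer of `lab`. -/
lemma card_cls_fiber {S : Finset ℕ} {ε₀ : J → ℕ} (h₀ : Function.Injective ε₀)
    (hS : ∀ j, ε₀ j ∈ S) :
    ((Fintype.piFinset fun _ : J => S).filter fun ε =>
      Function.Injective ε ∧ cls lab ε = cls lab ε₀).card
      = ∏ i, (Fintype.card {j // lab j = i})! := by
  rw [← DomMulAct.stabilizer_card lab, Fintype.card_subtype]
  symm
  refine Finset.card_bij (fun π _ => ε₀ ∘ π) (fun π hπ => ?_) (fun π _ τ _ h => ?_)
    fun ε hε => ?_
  · have hπ' : ∀ j, lab (π j) = lab j := fun j => congrFun (Finset.mem_filter.1 hπ).2 j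
    refine Finset.mem_filter.2 ⟨Fintype.mem_piFinset.2 fun j => hS _, h₀.comp π.injective, ?_⟩
    funext i
    ext a
    simp only [mem_cls, Function.comp_apply]
    constructor
    · rintro ⟨j, hj, rfl⟩
      exact ⟨π j, (hπ' j).trans hj, rfl⟩
    · rintro ⟨j, hj, rfl⟩
      exact ⟨π.symm j, by rw [← hπ' (π.symm j)]; simpa using hj, by simp⟩
  · ext j
    exact h₀ (congrFun h j)
  · obtain ⟨-, hi, hc⟩ := Finset.mem_filter.1 hε
    have h : ∀ j, ∃ j', lab j' = lab j ∧ ε₀ j' = ε j := fun j => by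
      rw [← mem_cls, ← hc, mem_cls]
      exact ⟨j, rfl, rfl⟩
    choose s hs1 hs2 using h
    have hinj : Function.Injective s := fun i j hij => hi (by rw [← hs2 i, ← hs2 j, hij])
    refine ⟨Equiv.ofBijective s (Finite.injective_iff_bijective.1 hinj), ?_, ?_⟩
    · simp only [Finset.mem_filter, Finset.mem_univ, true_and]
      funext j; exact hs1 j
    · funext j; exact hs2 j

/-- Choose a bijection for each class separately; disjointness makes the glued map injective. -/
lemma exists_of_classes {V : I → Finset ℕ} (hd : ∀ i j, i ≠ j → Disjoint (V i) (V j))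
    (hc : ∀ i, (V i).card = Fintype.card {j // lab j = i}) :
    ∃ ε : J → ℕ, Function.Injective ε ∧ cls lab ε = V := by
  have he : ∀ i, Nonempty ({j // lab j = i} ≃ V i) := fun i =>
    ⟨Fintype.equivOfCardEq (by rw [← hc i, Fintype.card_coe])⟩
  let e := fun i => Classical.choice (he i)
  let ε : J → ℕ := fun j => (e (lab j) ⟨j, rfl⟩ : ℕ)
  have h1 : ∀ i j (h : lab j = i), ε j = e i ⟨j, h⟩ := by rintro i j rfl; rfl
  refine ⟨ε, fun j j' h => ?_, ?_⟩
  · have hl : lab j' = lab j := by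
      by_contra hne
      refine Finset.disjoint_left.1 (hd _ _ hne) (e (lab j') ⟨j', rfl⟩).2 ?_
      rw [← h1 _ j' rfl, ← h, h1 _ j rfl]
      exact (e (lab j) ⟨j, rfl⟩).2
    rw [h1 _ j rfl, h1 _ j' hl] at h
    simpa using h
  · funext i
    ext a
    rw [mem_cls]
    constructor
    · rintro ⟨j, hj, rfl⟩
      rw [h1 i j hj]
      exact (e i ⟨j, hj⟩).2
    · intro ha
      refine ⟨(e i).symm ⟨a, ha⟩, ((e i).symm ⟨a, ha⟩).2, ?_⟩
      rw [h1 i _ ((e i).symm ⟨a, ha⟩).2]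
      simp

/-- Families of pairwise disjoint subsets of `S` with the sizes of the label classes. -/
def disjointFamilies (S : Finset ℕ) : Finset (I → Finset ℕ) :=
  (Fintype.piFinset fun i => Finset.powersetCard (Fintype.card {j // lab j = i}) S).filter
    fun V => ∀ i j, i ≠ j → Disjoint (V i) (V j)

lemma mem_disjointFamilies {S : Finset ℕ} {V : I → Finset ℕ} :
    V ∈ disjointFamilies lab S ↔ (∀ i, V i ⊆ S ∧ (V i).card = Fintype.card {j // lab j = i}) ∧
      ∀ i j, i ≠ j → Disjoint (V i) (V j) := by
  simp [disjointFamilies, Finset.mem_powersetCard]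

lemma sum_injective_cls {R : Type*} [CommSemiring R] (S : Finset ℕ) (u : (I → Finset ℕ) → R) :
    ∑ ε ∈ (Fintype.piFinset fun _ : J => S).filter Function.Injective, u (cls lab ε)
      = ((∏ i, (Fintype.card {j // lab j = i})! : ℕ) : R) *
        ∑ V ∈ disjointFamilies lab S, u V := by
  rw [← Finset.sum_fiberwise_of_maps_to (t := disjointFamilies lab S) (g := fun ε => cls lab ε),
    Finset.mul_sum]
  · refine Finset.sum_congr rfl fun V hV => ?_
    obtain ⟨hV1, hd⟩ := Finset.mem_filter.1 hV
    have hV2 := fun i => Finset.mem_powersetCard.1 (Fintype.mem_piFinset.1 hV1 i)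
    obtain ⟨ε₀, h₀, rfl⟩ := exists_of_classes lab hd fun i => (hV2 i).2
    have hS : ∀ j, ε₀ j ∈ S := fun j => (hV2 (lab j)).1 ((mem_cls lab).2 ⟨j, rfl, rfl⟩)
    rw [Finset.filter_filter, Finset.sum_congr rfl (g := fun _ => u (cls lab ε₀)),
      Finset.sum_const, card_cls_fiber lab h₀ hS, nsmul_eq_mul]
    intro ε hε
    rw [(Finset.mem_filter.1 hε).2.2]
  · intro ε hε
    obtain ⟨hε, hi⟩ := Finset.mem_filter.1 hε
    refine Finset.mem_filter.2 ⟨Fintype.mem_piFinset.2 fun i =>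
      Finset.mem_powersetCard.2 ⟨fun a ha => ?_, ?_⟩, fun i j hij => ?_⟩
    · obtain ⟨j, -, rfl⟩ := (mem_cls lab).1 ha
      exact Fintype.mem_piFinset.1 hε j
    · rw [cls, Finset.card_image_of_injective _ hi, Fintype.card_subtype]
    · refine Finset.disjoint_left.2 fun a ha hb => hij ?_
      obtain ⟨x, rfl, rfl⟩ := (mem_cls lab).1 ha
      obtain ⟨y, rfl, hy⟩ := (mem_cls lab).1 hb
      rw [hi hy]

end Label

/-! ### The two selections of variables in a contraction -/

section Contr
variable {p k r l : ℕ}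

/-- The variables of the first factor of `f ⋆_r^l f` among `z` and `(γ, t, s)`. -/
def sel₁ (hl : l ≤ r) (hr : r ≤ p) (hk : r + l + k = 2 * p) (a : Fin p) : Fin l ⊕ Fin k :=
  if h : (a : ℕ) < l then Sum.inl ⟨a, h⟩ else Sum.inr ⟨a - l, by omega⟩

/-- The variables of the second factor of `f ⋆_r^l f` among `z` and `(γ, t, s)`. -/
def sel₂ (hl : l ≤ r) (hr : r ≤ p) (hk : r + l + k = 2 * p) (b : Fin p) : Fin l ⊕ Fin k :=
  if h : (b : ℕ) < l then Sum.inl ⟨b, h⟩ else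
    if h' : (b : ℕ) < r then Sum.inr ⟨b - l, by omega⟩ else Sum.inr ⟨(p - l) + (b - r), by omega⟩

/-- The classes of variables of a contraction: `0` for `z`, `1` for `γ`, `2` for `t`, `3` for `s`. -/
def contrLabel (p r : ℕ) : Fin l ⊕ Fin k → Fin 4
  | Sum.inl _ => 0
  | Sum.inr i => if (i : ℕ) < r - l then 1 else if (i : ℕ) < p - l then 2 else 3

variable (hl : l ≤ r) (hr : r ≤ p) (hk : r + l + k = 2 * p)

lemma sel₁_injective : Function.Injective (sel₁ hl hr hk) := by
  intro a b h
  unfold sel₁ at h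
  split_ifs at h <;> simp at h <;> ext <;> omega

lemma sel₂_injective : Function.Injective (sel₂ hl hr hk) := by
  intro a b h
  unfold sel₂ at h
  split_ifs at h <;> simp at h <;> ext <;> omega

/-- The first factor of a contraction omits precisely the variables `s`; likewise the second omits
precisely `t`. So the integrated variables `z` occur in both. -/
lemma exists_sel₁_iff (c : Fin l ⊕ Fin k) :
    (∃ a, sel₁ hl hr hk a = c) ↔ contrLabel p r c ≠ 3 := by
  rcases c with i | i
  · simp only [contrLabel]
    refine iff_of_true ⟨⟨i, by omega⟩, ?_⟩ (by decide)
    simp [sel₁]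
  · have hi := i.2
    simp only [contrLabel]
    constructor
    · rintro ⟨a, ha⟩
      unfold sel₁ at ha
      split_ifs at ha with h
      have : (a : ℕ) - l = i := by simpa using congrArg (Fin.val) (Sum.inr.inj ha)
      have : (i : ℕ) < p - l := by omega
      split_ifs <;> simp
    · intro h
      have : (i : ℕ) < p - l := by
        by_contra hc
        rw [if_neg (by omega), if_neg hc] at h
        exact h rfl
      refine ⟨⟨i + l, by omega⟩, ?_⟩
      simp [sel₁]

lemma exists_sel₂_iff (c : Fin l ⊕ Fin k) :
    (∃ a, sel₂ hl hr hk a = c) ↔ contrLabel p r c ≠ 2 := by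
  rcases c with i | i
  · simp only [contrLabel]
    refine iff_of_true ⟨⟨i, by omega⟩, ?_⟩ (by decide)
    simp [sel₂]
  · have hi := i.2
    simp only [contrLabel]
    constructor
    · rintro ⟨a, ha⟩
      unfold sel₂ at ha
      split_ifs at ha with h h'
      · have : (a : ℕ) - l = i := by simpa using congrArg (Fin.val) (Sum.inr.inj ha)
        rw [if_pos (by omega)]; decide
      · have : (p - l) + ((a : ℕ) - r) = i := by simpa using congrArg (Fin.val) (Sum.inr.inj ha)
        rw [if_neg (by omega), if_neg (by omega)]; decide
    · intro h
      by_cases h1 : (i : ℕ) < r - l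
      · refine ⟨⟨i + l, by omega⟩, ?_⟩
        have : (i : ℕ) + l < r := by omega
        simp [sel₂, this]
      · have h2 : ¬ (i : ℕ) < p - l := fun h2 => by
          rw [if_neg h1, if_pos h2] at h
          exact h rfl
        refine ⟨⟨i - (p - l) + r, by omega⟩, ?_⟩
        unfold sel₂
        rw [dif_neg (by simp; omega), dif_neg (by simp)]
        congr 1
        ext
        simp; omega

lemma image_sel₁ (ε : Fin l ⊕ Fin k → ℕ) :
    Finset.univ.image (ε ∘ sel₁ hl hr hk) = cls (contrLabel p r) ε 0 ∪ cls (contrLabel p r) ε 1 ∪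
      cls (contrLabel p r) ε 2 := by
  ext a
  simp only [Finset.mem_image, Finset.mem_univ, true_and, Finset.mem_union, mem_cls,
    Function.comp_apply]
  constructor
  · rintro ⟨b, rfl⟩
    have := (exists_sel₁_iff hl hr hk (sel₁ hl hr hk b)).1 ⟨b, rfl⟩
    generalize sel₁ hl hr hk b = c at this
    have h4 : contrLabel p r c = 0 ∨ contrLabel p r c = 1 ∨ contrLabel p r c = 2 := by
      revert this; generalize contrLabel p r c = m; revert m; decide
    rcases h4 with h | h | h
    · exact Or.inl (Or.inl ⟨c, h, rfl⟩)
    · exact Or.inl (Or.inr ⟨c, h, rfl⟩)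
    · exact Or.inr ⟨c, h, rfl⟩
  · have : ∀ c, contrLabel p r c ≠ 3 → ∃ b, ε (sel₁ hl hr hk b) = ε c := fun c hc => by
      obtain ⟨b, hb⟩ := (exists_sel₁_iff hl hr hk c).2 hc
      exact ⟨b, by rw [hb]⟩
    rintro ((⟨c, h, rfl⟩ | ⟨c, h, rfl⟩) | ⟨c, h, rfl⟩) <;> refine this c ?_ <;> rw [h] <;> decide

lemma image_sel₂ (ε : Fin l ⊕ Fin k → ℕ) :
    Finset.univ.image (ε ∘ sel₂ hl hr hk) = cls (contrLabel p r) ε 0 ∪ cls (contrLabel p r) ε 1 ∪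
      cls (contrLabel p r) ε 3 := by
  ext a
  simp only [Finset.mem_image, Finset.mem_univ, true_and, Finset.mem_union, mem_cls,
    Function.comp_apply]
  constructor
  · rintro ⟨b, rfl⟩
    have := (exists_sel₂_iff hl hr hk (sel₂ hl hr hk b)).1 ⟨b, rfl⟩
    generalize sel₂ hl hr hk b = c at this
    have h4 : contrLabel p r c = 0 ∨ contrLabel p r c = 1 ∨ contrLabel p r c = 3 := by
      revert this; generalize contrLabel p r c = m; revert m; decide
    rcases h4 with h | h | h
    · exact Or.inl (Or.inl ⟨c, h, rfl⟩)
    · exact Or.inl (Or.inr ⟨c, h, rfl⟩)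
    · exact Or.inr ⟨c, h, rfl⟩
  · have : ∀ c, contrLabel p r c ≠ 2 → ∃ b, ε (sel₂ hl hr hk b) = ε c := fun c hc => by
      obtain ⟨b, hb⟩ := (exists_sel₂_iff hl hr hk c).2 hc
      exact ⟨b, by rw [hb]⟩
    rintro ((⟨c, h, rfl⟩ | ⟨c, h, rfl⟩) | ⟨c, h, rfl⟩) <;> refine this c ?_ <;> rw [h] <;> decide

lemma image_inr (ε : Fin l ⊕ Fin k → ℕ) :
    Finset.univ.image (ε ∘ Sum.inr) = cls (contrLabel p r) ε 1 ∪ cls (contrLabel p r) ε 2 ∪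
      cls (contrLabel p r) ε 3 := by
  ext a
  simp only [Finset.mem_image, Finset.mem_univ, true_and, Finset.mem_union, mem_cls,
    Function.comp_apply]
  constructor
  · rintro ⟨i, rfl⟩
    have h4 : contrLabel p r (Sum.inr i : Fin l ⊕ Fin k) = 1 ∨
        contrLabel p r (Sum.inr i : Fin l ⊕ Fin k) = 2 ∨
        contrLabel p r (Sum.inr i : Fin l ⊕ Fin k) = 3 := by
      simp only [contrLabel]; split_ifs <;> simp
    rcases h4 with h | h | h
    · exact Or.inl (Or.inl ⟨_, h, rfl⟩)
    · exact Or.inl (Or.inr ⟨_, h, rfl⟩)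
    · exact Or.inr ⟨_, h, rfl⟩
  · rintro ((⟨c, h, rfl⟩ | ⟨c, h, rfl⟩) | ⟨c, h, rfl⟩) <;> rcases c with c | c <;>
      first | exact ⟨c, rfl⟩ | exact absurd h (by simp [contrLabel])

lemma card_Fin_filter_Ico (a b : ℕ) (hb : b ≤ k) :
    (Finset.univ.filter fun i : Fin k => a ≤ (i : ℕ) ∧ (i : ℕ) < b).card = b - a := by
  rw [← Nat.card_Ico, ← Finset.card_map Fin.valEmbedding]
  congr 1
  ext x
  simp only [Finset.mem_map, Finset.mem_filter, Finset.mem_univ, true_and, Fin.valEmbedding_apply,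
    Finset.mem_Ico]
  constructor
  · rintro ⟨i, h, rfl⟩; exact h
  · intro h; exact ⟨⟨x, by omega⟩, h, rfl⟩

lemma card_inr_label (m : Fin 4) (a b : ℕ) (hb : b ≤ k) (hm : m ≠ 0)
    (h : ∀ i : Fin k, contrLabel p r (Sum.inr i : Fin l ⊕ Fin k) = m ↔ a ≤ (i : ℕ) ∧ (i : ℕ) < b) :
    Fintype.card {c : Fin l ⊕ Fin k // contrLabel p r c = m} = b - a := by
  rw [← card_Fin_filter_Ico a b hb, Fintype.card_subtype]
  symm
  refine Finset.card_bij (fun i _ => Sum.inr i) (fun i hi => ?_) (fun i _ j _ e => Sum.inr.inj e)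
    fun c hc => ?_
  · exact Finset.mem_filter.2 ⟨Finset.mem_univ _, (h i).2 (Finset.mem_filter.1 hi).2⟩
  · have hc' := (Finset.mem_filter.1 hc).2
    rcases c with c | c
    · exact absurd hc'.symm hm
    · exact ⟨c, Finset.mem_filter.2 ⟨Finset.mem_univ _, (h c).1 hc'⟩, rfl⟩

lemma card_contrLabel (hl : l ≤ r) (hr : r ≤ p) (hk : r + l + k = 2 * p) :
    Fintype.card {c : Fin l ⊕ Fin k // contrLabel p r c = 0} = l ∧
    Fintype.card {c : Fin l ⊕ Fin k // contrLabel p r c = 1} = r - l ∧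
    Fintype.card {c : Fin l ⊕ Fin k // contrLabel p r c = 2} = p - r ∧
    Fintype.card {c : Fin l ⊕ Fin k // contrLabel p r c = 3} = p - r := by
  refine ⟨?_, ?_, ?_, ?_⟩
  · conv_rhs => rw [← Fintype.card_fin l]
    rw [Fintype.card_subtype, ← Finset.card_univ]
    symm
    refine Finset.card_bij (fun i _ => Sum.inl i) (fun i _ => Finset.mem_filter.2 ⟨Finset.mem_univ _, rfl⟩)
      (fun i _ j _ e => Sum.inl.inj e) fun c hc => ?_
    have hc' := (Finset.mem_filter.1 hc).2
    rcases c with c | c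
    · exact ⟨c, Finset.mem_univ _, rfl⟩
    · exfalso
      simp only [contrLabel] at hc'
      split_ifs at hc'
      all_goals exact absurd hc' (by decide)
  · rw [card_inr_label 1 0 (r - l) (by omega) (by decide) fun i => ?_]
    · omega
    · simp only [contrLabel]; split_ifs with h1 h2 <;> simp <;> omega
  · rw [card_inr_label 2 (r - l) (p - l) (by omega) (by decide) fun i => ?_]
    · omega
    · simp only [contrLabel]; split_ifs with h1 h2 <;> simp <;> omega
  · rw [card_inr_label 3 (p - l) k (by omega) (by decide) fun i => ?_]
    · omega
    · simp only [contrLabel]; split_ifs with h1 h2 <;> simp <;> omega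

end Contr
end UniformChaos

namespace UniformChaos

/-! ### The pairs of index sets that survive the integration -/

/-- Pairs `(B, C)` of `p`-subsets of `S` with `B ∆ C ⊆ A ⊆ B ∪ C` and prescribed sizes of
`B ∩ C` and `(B ∩ C) \ A`. -/
def goodPairs (p : ℕ) (S A : Finset ℕ) (r l : ℕ) : Finset (Finset ℕ × Finset ℕ) :=
  (Finset.powersetCard p S ×ˢ Finset.powersetCard p S).filter fun q =>
    (q.1 \ q.2 ⊆ A ∧ q.2 \ q.1 ⊆ A ∧ A ⊆ q.1 ∪ q.2) ∧
      (q.1 ∩ q.2).card = r ∧ ((q.1 ∩ q.2) \ A).card = l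

variable {p k r l : ℕ}

/-- The dictionary between classes of variables and pairs: for index sets `B`, `C` of the two
factors, `z` ranges over `(B ∩ C) \ A`, `γ` over `B ∩ C ∩ A`, `t` over `B \ C` and `s` over `C \ B`.
-/
lemma goodPair_of_family (hl : l ≤ r) (hr : r ≤ p) (hk : r + l + k = 2 * p) {A S : Finset ℕ}
    {V : Fin 4 → Finset ℕ}
    (hV : V ∈ (disjointFamilies (contrLabel p r : Fin l ⊕ Fin k → Fin 4) S).filter
        (fun V => V 1 ∪ V 2 ∪ V 3 = A)) :
    (V 0 ∪ V 1 ∪ V 2, V 0 ∪ V 1 ∪ V 3) ∈ goodPairs p S A r l := by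
  obtain ⟨c0, c1, c2, c3⟩ := card_contrLabel (k := k) hl hr hk
  obtain ⟨hV, hA⟩ := Finset.mem_filter.1 hV
  obtain ⟨hV', hd⟩ := (mem_disjointFamilies _).1 hV
  have d01 := hd 0 1 (by decide)
  have d02 := hd 0 2 (by decide)
  have d03 := hd 0 3 (by decide)
  have d12 := hd 1 2 (by decide)
  have d13 := hd 1 3 (by decide)
  have d23 := hd 2 3 (by decide)
  obtain ⟨s0, n0⟩ := hV' 0
  obtain ⟨s1, n1⟩ := hV' 1
  obtain ⟨s2, n2⟩ := hV' 2
  obtain ⟨s3, n3⟩ := hV' 3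
  rw [c0] at n0
  rw [c1] at n1
  rw [c2] at n2
  rw [c3] at n3
  generalize V 0 = V0 at *
  generalize V 1 = V1 at *
  generalize V 2 = V2 at *
  generalize V 3 = V3 at *
  subst hA
  have hcap : (V0 ∪ V1 ∪ V2) ∩ (V0 ∪ V1 ∪ V3) = V0 ∪ V1 := by
    ext a
    have := fun h : a ∈ V2 => Finset.disjoint_left.1 d23 h
    simp only [Finset.mem_inter, Finset.mem_union]
    tauto
  have hz : (V0 ∪ V1) \ (V1 ∪ V2 ∪ V3) = V0 := by
    ext a
    have h1 := fun h : a ∈ V0 => Finset.disjoint_left.1 d01 h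
    have h2 := fun h : a ∈ V0 => Finset.disjoint_left.1 d02 h
    have h3 := fun h : a ∈ V0 => Finset.disjoint_left.1 d03 h
    simp only [Finset.mem_sdiff, Finset.mem_union]
    tauto
  refine Finset.mem_filter.2 ⟨Finset.mem_product.2 ⟨Finset.mem_powersetCard.2 ⟨?_, ?_⟩,
    Finset.mem_powersetCard.2 ⟨?_, ?_⟩⟩, ⟨?_, ?_, ?_⟩, ?_, ?_⟩
  · exact Finset.union_subset (Finset.union_subset s0 s1) s2
  · simp only
    rw [Finset.card_union_of_disjoint (Finset.disjoint_union_left.2 ⟨d02, d12⟩),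
      Finset.card_union_of_disjoint d01]
    omega
  · exact Finset.union_subset (Finset.union_subset s0 s1) s3
  · simp only
    rw [Finset.card_union_of_disjoint (Finset.disjoint_union_left.2 ⟨d03, d13⟩),
      Finset.card_union_of_disjoint d01]
    omega
  · intro a
    simp only [Finset.mem_sdiff, Finset.mem_union]; tauto
  · intro a
    simp only [Finset.mem_sdiff, Finset.mem_union]; tauto
  · intro a
    simp only [Finset.mem_union]; tauto
  · simp only
    rw [hcap, Finset.card_union_of_disjoint d01]; omega
  · simp only
    rw [hcap, hz]; exact n0

lemma family_of_goodPair (hl : l ≤ r) (hr : r ≤ p) (hk : r + l + k = 2 * p) {A S : Finset ℕ}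
    {B C : Finset ℕ}
    (hq : (B, C) ∈ goodPairs p S A r l) :
    ![(B ∩ C) \ A, B ∩ C ∩ A, B \ C, C \ B] ∈
      (disjointFamilies (contrLabel p r : Fin l ⊕ Fin k → Fin 4) S).filter
        (fun V => V 1 ∪ V 2 ∪ V 3 = A) := by
  obtain ⟨c0, c1, c2, c3⟩ := card_contrLabel (k := k) hl hr hk
  obtain ⟨hBC, ⟨h1, h2, h3⟩, hr', hl'⟩ := Finset.mem_filter.1 hq
  obtain ⟨hB, hC⟩ := Finset.mem_product.1 hBC
  obtain ⟨hBS, hBp⟩ := Finset.mem_powersetCard.1 hB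
  obtain ⟨hCS, hCp⟩ := Finset.mem_powersetCard.1 hC
  simp only at *
  refine Finset.mem_filter.2 ⟨(mem_disjointFamilies _).2 ⟨fun i => ?_,
    fun i j hij => ?_⟩, ?_⟩
  · have e1 : (B ∩ C ∩ A).card = r - l := by
      have := Finset.card_inter_add_card_sdiff (B ∩ C) A
      omega
    have e2 : (B \ C).card = p - r := by
      have := Finset.card_inter_add_card_sdiff B C
      omega
    have e3 : (C \ B).card = p - r := by
      have := Finset.card_inter_add_card_sdiff C B
      rw [Finset.inter_comm] at this
      omega
    fin_cases i
    · refine ⟨fun a ha => hBS ?_, hl'.trans c0.symm⟩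
      exact (Finset.mem_inter.1 (Finset.mem_sdiff.1 ha).1).1
    · refine ⟨fun a ha => hBS ?_, e1.trans c1.symm⟩
      exact (Finset.mem_inter.1 (Finset.mem_inter.1 ha).1).1
    · refine ⟨fun a ha => hBS ?_, e2.trans c2.symm⟩
      exact (Finset.mem_sdiff.1 ha).1
    · refine ⟨fun a ha => hCS ?_, e3.trans c3.symm⟩
      exact (Finset.mem_sdiff.1 ha).1
  · refine Finset.disjoint_left.2 fun a ha hb => ?_
    clear hq hBC h1 h2 h3 hr' hl' hB hC hBS hCS c0 c1 c2 c3
    fin_cases i <;> fin_cases j <;> first | exact hij rfl | (clear hij; simp at ha hb; tauto)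
  · ext a
    have h1' := @h1 a
    have h2' := @h2 a
    have h3' := @h3 a
    simp at h1' h2' h3' ⊢
    tauto

lemma sum_disjointFamilies (hl : l ≤ r) (hr : r ≤ p) (hk : r + l + k = 2 * p) {A S : Finset ℕ}
    (T : Finset ℕ → Finset ℕ → ℝ) :
    ∑ V ∈ (disjointFamilies (contrLabel p r : Fin l ⊕ Fin k → Fin 4) S).filter
        (fun V => V 1 ∪ V 2 ∪ V 3 = A), T (V 0 ∪ V 1 ∪ V 2) (V 0 ∪ V 1 ∪ V 3)
      = ∑ q ∈ goodPairs p S A r l, T q.1 q.2 := by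
  refine Finset.sum_bij' (fun V _ => (V 0 ∪ V 1 ∪ V 2, V 0 ∪ V 1 ∪ V 3))
    (fun q _ => ![(q.1 ∩ q.2) \ A, q.1 ∩ q.2 ∩ A, q.1 \ q.2, q.2 \ q.1])
    (fun V hV => goodPair_of_family hl hr hk hV) (fun q hq => family_of_goodPair hl hr hk hq)
    ?_ ?_ ?_
  · intro V hV
    obtain ⟨hV, hA⟩ := Finset.mem_filter.1 hV
    obtain ⟨-, hd⟩ := (mem_disjointFamilies _).1 hV
    have d : ∀ i j, i ≠ j → ∀ a, a ∈ V i → a ∉ V j := fun i j hij a ha =>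
      Finset.disjoint_left.1 (hd i j hij) ha
    funext i
    ext a
    have d01 := d 0 1 (by decide) a
    have d02 := d 0 2 (by decide) a
    have d03 := d 0 3 (by decide) a
    have d12 := d 1 2 (by decide) a
    have d13 := d 1 3 (by decide) a
    have d23 := d 2 3 (by decide) a
    rw [← hA]
    clear hA hV hd d
    fin_cases i <;> simp <;> grind
  · rintro ⟨B, C⟩ hq
    obtain ⟨-, ⟨h1, h2, h3⟩, -⟩ := Finset.mem_filter.1 hq
    simp only at *
    refine Prod.ext ?_ ?_ <;> ext a <;> simp <;> tauto
  · intro V hV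
    rfl

/-- An injection whose free variables have image `A` is a reordering of the enumeration `α` together
with arbitrary remaining values; symmetrisation provides the reorderings. -/
lemma sum_perm_sum_eq {α : Fin k → ℕ} (hα : Function.Injective α) {A S : Finset ℕ}
    (hA : Finset.univ.image α = A) (hAS : A ⊆ S) (u : (Fin l ⊕ Fin k → ℕ) → ℝ) :
    ∑ σ : Equiv.Perm (Fin k), ∑ ρ ∈ Fintype.piFinset fun _ : Fin l => S,
        (if Function.Injective (Sum.elim ρ (α ∘ σ)) then u (Sum.elim ρ (α ∘ σ)) else 0)
      = ∑ ε ∈ (Fintype.piFinset fun _ : Fin l ⊕ Fin k => S).filter Function.Injective,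
        if Finset.univ.image (ε ∘ Sum.inr) = A then u ε else 0 := by
  classical
  rw [← Finset.sum_product', ← Finset.sum_filter, ← Finset.sum_filter]
  have him : ∀ σ : Equiv.Perm (Fin k), Finset.univ.image (α ∘ σ) = A := fun σ => by
    rw [← hA, ← Finset.image_image]
    congr 1
    ext i; simp only [Finset.mem_image, Finset.mem_univ, true_and, iff_true]
    exact σ.surjective i
  refine Finset.sum_bij (fun q _ => Sum.elim q.2 (α ∘ q.1)) ?_ ?_ ?_ ?_
  · rintro ⟨σ, ρ⟩ hq
    obtain ⟨h1, h2⟩ := Finset.mem_filter.1 hq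
    obtain ⟨-, hρ⟩ := Finset.mem_product.1 h1
    refine Finset.mem_filter.2 ⟨Finset.mem_filter.2 ⟨Fintype.mem_piFinset.2 ?_, h2⟩, ?_⟩
    · rintro (i | i)
      · exact Fintype.mem_piFinset.1 hρ i
      · refine hAS ?_
        rw [← hA]; exact Finset.mem_image_of_mem _ (Finset.mem_univ _)
    · simpa using him σ
  · rintro ⟨σ, ρ⟩ _ ⟨σ', ρ'⟩ _ h
    have h1 : ρ = ρ' := funext fun i => congrFun h (Sum.inl i)
    have h2 : σ = σ' := by
      ext i
      exact congrArg _ (hα (congrFun h (Sum.inr i)))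
    rw [h1, h2]
  · intro ε hε
    obtain ⟨h1, h2⟩ := Finset.mem_filter.1 hε
    obtain ⟨h1, h3⟩ := Finset.mem_filter.1 h1
    obtain ⟨σ, hσ⟩ := exists_perm_comp (e := α) (h3.comp Sum.inr_injective) hA h2
    have e : Sum.elim (ε ∘ Sum.inl) (α ∘ σ) = ε := by
      funext c
      rcases c with c | c
      · rfl
      · exact (congrFun hσ c).symm
    refine ⟨(σ, ε ∘ Sum.inl), Finset.mem_filter.2 ⟨Finset.mem_product.2 ⟨Finset.mem_univ _,
      Fintype.mem_piFinset.2 fun i => Fintype.mem_piFinset.1 h1 _⟩, ?_⟩, e⟩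
    simp only
    rw [e]; exact h3
  · intro q _; rfl

/-- The coefficient in `G_k` is `p!²` divided by the number of permutations within the four classes.
This is why every pair gets the same weight. -/
lemma contr_coeff (hl : l ≤ r) (hr : r ≤ p) :
    ((r ! * p.choose r ^ 2 * r.choose l : ℕ) : ℝ) *
      ((l ! * (r - l)! * (p - r)! * (p - r)! : ℕ) : ℝ) = (p ! : ℝ) ^ 2 := by
  have h1 := Nat.choose_mul_factorial_mul_factorial hr
  have h2 := Nat.choose_mul_factorial_mul_factorial hl
  rw [← Nat.cast_mul, ← Nat.cast_pow]
  congr 1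
  calc r ! * p.choose r ^ 2 * r.choose l * (l ! * (r - l)! * (p - r)! * (p - r)!)
      = (p.choose r * r ! * (p - r)!) * (p.choose r * (r.choose l * l ! * (r - l)!) * (p - r)!) := by
        ring
    _ = p ! ^ 2 := by rw [h2, h1]; ring

/-- The finite form of the product formula: summing one contraction over block indices and over
orderings of its free variables runs through the pairs `(B, C)` of one type, each with weight `p!²`.
-/
lemma sum_perm_eq_goodPairs (hl : l ≤ r) (hr : r ≤ p) (hk : r + l + k = 2 * p)
    {α : Fin k → ℕ} (hα : Function.Injective α) {A S : Finset ℕ}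
    (hA : Finset.univ.image α = A) (hAS : A ⊆ S) (T : Finset ℕ → Finset ℕ → ℝ) :
    ((r ! : ℝ) * (p.choose r : ℝ) ^ 2 * (r.choose l : ℝ)) *
      ∑ σ : Equiv.Perm (Fin k), ∑ ρ ∈ Fintype.piFinset fun _ : Fin l => S,
        (if Function.Injective (Sum.elim ρ (α ∘ σ)) then
          T (Finset.univ.image (Sum.elim ρ (α ∘ σ) ∘ sel₁ hl hr hk))
            (Finset.univ.image (Sum.elim ρ (α ∘ σ) ∘ sel₂ hl hr hk)) else 0)
      = (p ! : ℝ) ^ 2 * ∑ q ∈ goodPairs p S A r l, T q.1 q.2 := by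
  rw [sum_perm_sum_eq hα hA hAS (fun ε => T (Finset.univ.image (ε ∘ sel₁ hl hr hk))
    (Finset.univ.image (ε ∘ sel₂ hl hr hk)))]
  have h1 := sum_injective_cls (contrLabel p r : Fin l ⊕ Fin k → Fin 4) S
    (fun V => if V 1 ∪ V 2 ∪ V 3 = A then T (V 0 ∪ V 1 ∪ V 2) (V 0 ∪ V 1 ∪ V 3) else 0)
  simp_rw [image_sel₁, image_sel₂, image_inr (p := p) (r := r)]
  rw [h1, ← Finset.sum_filter, sum_disjointFamilies hl hr hk, ← mul_assoc]
  congr 1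
  obtain ⟨c0, c1, c2, c3⟩ := card_contrLabel (k := k) hl hr hk
  rw [← contr_coeff hl hr, Fin.prod_univ_four, c0, c1, c2, c3]
  push_cast
  ring

/-- For a contributing pair, `A` is the disjoint union of `B ∩ C ∩ A`, `B \ C` and `C \ B`.
Comparing sizes gives `k = (r - l) + 2 (p - r)`, so each such pair has exactly one admissible type
`(r, l)`. -/
lemma sum_pairs_eq_sum_goodPairs {A S : Finset ℕ} (hAk : A.card = k) {T : Finset ℕ → Finset ℕ → ℝ}
    (hT : ∀ B C, B.card = p → C.card = p → T B C ≠ 0 → B \ C ⊆ A ∧ C \ B ⊆ A ∧ A ⊆ B ∪ C) :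
    ∑ B ∈ Finset.powersetCard p S, ∑ C ∈ Finset.powersetCard p S, T B C
      = ∑ r ∈ Finset.range (p + 1), ∑ l ∈ Finset.range (r + 1),
        if r + l + k = 2 * p then ∑ q ∈ goodPairs p S A r l, T q.1 q.2 else 0 := by
  have e : ∀ r l, (if r + l + k = 2 * p then ∑ q ∈ goodPairs p S A r l, T q.1 q.2 else 0)
      = ∑ q ∈ Finset.powersetCard p S ×ˢ Finset.powersetCard p S,
        if r + l + k = 2 * p ∧ (q.1 \ q.2 ⊆ A ∧ q.2 \ q.1 ⊆ A ∧ A ⊆ q.1 ∪ q.2) ∧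
          (q.1 ∩ q.2).card = r ∧ ((q.1 ∩ q.2) \ A).card = l then T q.1 q.2 else 0 := by
    intro r l
    by_cases h : r + l + k = 2 * p
    · simp only [h, if_true, true_and, goodPairs, Finset.sum_filter]
    · simp [h]
  simp_rw [e]
  rw [← Finset.sum_product', Finset.sum_congr rfl fun r _ => Finset.sum_comm, Finset.sum_comm]
  refine Finset.sum_congr rfl fun q hq => ?_
  obtain ⟨B, C⟩ := q
  obtain ⟨hB, hC⟩ := Finset.mem_product.1 hq
  have hB' : B.card = p := (Finset.mem_powersetCard.1 hB).2
  have hC' : C.card = p := (Finset.mem_powersetCard.1 hC).2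
  by_cases hz : T B C = 0
  · simp [hz]
  obtain ⟨h1, h2, h3⟩ := hT B C hB' hC' hz
  have hr : (B ∩ C).card ≤ p := hB' ▸ Finset.card_le_card Finset.inter_subset_left
  have hl : ((B ∩ C) \ A).card ≤ (B ∩ C).card := Finset.card_le_card Finset.sdiff_subset
  have hk : (B ∩ C).card + ((B ∩ C) \ A).card + k = 2 * p := by
    have i1 := Finset.card_inter_add_card_sdiff (B ∩ C) A
    have i2 := Finset.card_inter_add_card_sdiff B C
    have i3 := Finset.card_inter_add_card_sdiff C B
    rw [Finset.inter_comm] at i3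
    have hA : A = (B ∩ C ∩ A) ∪ (B \ C) ∪ (C \ B) := by
      ext a
      have h1' := @h1 a
      have h2' := @h2 a
      have h3' := @h3 a
      simp at h1' h2' h3' ⊢
      tauto
    have d1 : Disjoint (B ∩ C ∩ A) (B \ C) := Finset.disjoint_left.2 fun a => by simp; tauto
    have d2 : Disjoint ((B ∩ C ∩ A) ∪ (B \ C)) (C \ B) :=
      Finset.disjoint_left.2 fun a => by simp; tauto
    have := congrArg Finset.card hA
    rw [Finset.card_union_of_disjoint d2, Finset.card_union_of_disjoint d1, hAk] at this
    omega
  rw [Finset.sum_eq_single (B ∩ C).card, Finset.sum_eq_single ((B ∩ C) \ A).card]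
  · rw [if_pos ⟨hk, ⟨h1, h2, h3⟩, rfl, rfl⟩]
  · intro l _ hne
    rw [if_neg]
    rintro ⟨-, -, -, h⟩
    exact hne h.symm
  · intro h; exact absurd (Finset.mem_range.2 (by omega)) h
  · intro r _ hne
    refine Finset.sum_eq_zero fun l _ => ?_
    rw [if_neg]
    rintro ⟨-, -, h, -⟩
    exact hne h.symm
  · intro h; exact absurd (Finset.mem_range.2 (by omega)) h

end UniformChaos

namespace UniformChaos

/-! ### Contractions as sums over blocks -/

variable {p k r l : ℕ}

/-- All coordinates used by `contraction` are in range under `hk`, so the default of `coordOr0`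
never occurs and the arguments are injective selections. -/
lemma contraction_eq (hl : l ≤ r) (hr : r ≤ p) (hk : r + l + k = 2 * p)
    (f : (Fin p → ℝ) → ℝ) (x : Fin k → ℝ) :
    contraction r l f f x = ∫ z, f (Sum.elim z x ∘ sel₁ hl hr hk) *
      f (Sum.elim z x ∘ sel₂ hl hr hk) ∂halfPow l := by
  unfold contraction
  congr 1
  funext z
  congr 2
  · funext a
    simp only [Function.comp_apply, sel₁, coordOr0]
    have := a.2
    split_ifs with h1 h2
    · rfl
    · rfl
    · omega
  · funext a
    simp only [Function.comp_apply, sel₂, coordOr0]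
    have := a.2
    split_ifs with h1 h2 h3
    · rfl
    · rfl
    · omega
    · rfl
    · omega

/-- By `hs'` the selection discards only coordinates of the configuration, which carry probability
measures. Its law is then `halfPow p` restricted to a product of blocks and full lines, so pulling
back a kernel preserves square integrability. -/
lemma exists_measurePreserving_pair {α : Fin k → ℕ} (hα : Function.Injective α)
    {s : Fin p → Fin l ⊕ Fin k} (hs : Function.Injective s) (hs' : ∀ i, ∃ a, s a = Sum.inl i) :
    ∃ m ≤ halfPow p, MeasurePreserving
      (fun q : (Fin l → ℝ) × (ℕ → ℝ) => (Sum.elim q.1 (q.2 ∘ α) : Fin l ⊕ Fin k → ℝ) ∘ s)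
      ((halfPow l).prod conf) m := by
  let M : Fin l ⊕ Fin k → Measure ℝ := Sum.elim (fun _ => halfLeb) (fun i => blockMeas (α i))
  have hM : ∀ c, SigmaFinite (M c) := by rintro (i | i) <;> simp only [M, Sum.elim] <;> infer_instance
  have h1 : MeasurePreserving (fun q : (Fin l → ℝ) × (ℕ → ℝ) => (q.1, q.2 ∘ α))
      ((halfPow l).prod conf) ((halfPow l).prod (Measure.pi fun i => blockMeas (α i))) :=
    (MeasurePreserving.id (halfPow l)).prod (measurePreserving_conf_comp hα)
  have h2 := measurePreserving_sumElim (fun _ : Fin l => halfLeb) (fun i => blockMeas (α i))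
  have h3 := measurePreserving_selection M hs (fun c hc => by
    rcases c with c | c
    · exact absurd (hs' c) hc
    · simp only [M, Sum.elim]; infer_instance)
  refine ⟨_, ?_, h3.comp (h2.comp h1)⟩
  have e : ∀ a, M (s a) = halfLeb.restrict (Sum.elim (fun _ => Set.univ) (fun i => block (α i)) (s a)) := by
    intro a
    rcases s a with c | c
    · simp [M]
    · rfl
  simp_rw [e]
  rw [← Measure.restrict_pi_pi]
  exact Measure.restrict_le_self

lemma exists_sel₁_inl (hl : l ≤ r) (hr : r ≤ p) (hk : r + l + k = 2 * p) (i : Fin l) :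
    ∃ a, sel₁ hl hr hk a = Sum.inl i :=
  (exists_sel₁_iff hl hr hk _).2 (by simp [contrLabel])

lemma exists_sel₂_inl (hl : l ≤ r) (hr : r ≤ p) (hk : r + l + k = 2 * p) (i : Fin l) :
    ∃ a, sel₂ hl hr hk a = Sum.inl i :=
  (exists_sel₂_iff hl hr hk _).2 (by simp [contrLabel])

lemma memLp_pair {g : (Fin p → ℝ) → ℝ} (hg : MemLp g 2 (halfPow p)) {α : Fin k → ℕ}
    (hα : Function.Injective α)
    {s : Fin p → Fin l ⊕ Fin k} (hs : Function.Injective s) (hs' : ∀ i, ∃ a, s a = Sum.inl i) :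
    MemLp (fun q : (Fin l → ℝ) × (ℕ → ℝ) => g ((Sum.elim q.1 (q.2 ∘ α) : Fin l ⊕ Fin k → ℝ) ∘ s)) 2
      ((halfPow l).prod conf) := by
  obtain ⟨m, hm, hmp⟩ := exists_measurePreserving_pair hα hs hs'
  exact (hg.mono_measure hm).comp_measurePreserving hmp

/-- The integrand of a contraction. -/
noncomputable def contrIntegrand (hl : l ≤ r) (hr : r ≤ p) (hk : r + l + k = 2 * p)
    (g : (Fin p → ℝ) → ℝ) (α : Fin k → ℕ) (q : (Fin l → ℝ) × (ℕ → ℝ)) : ℝ :=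
  g (Sum.elim q.1 (q.2 ∘ α) ∘ sel₁ hl hr hk) * g (Sum.elim q.1 (q.2 ∘ α) ∘ sel₂ hl hr hk)

lemma integrable_contrIntegrand (hl : l ≤ r) (hr : r ≤ p) (hk : r + l + k = 2 * p)
    {g : (Fin p → ℝ) → ℝ} (hg : MemLp g 2 (halfPow p)) {α : Fin k → ℕ}
    (hα : Function.Injective α) :
    Integrable (contrIntegrand hl hr hk g α) ((halfPow l).prod conf) :=
  MemLp.integrable_mul (memLp_pair hg hα (sel₁_injective hl hr hk) (exists_sel₁_inl hl hr hk))
    (memLp_pair hg hα (sel₂_injective hl hr hk) (exists_sel₂_inl hl hr hk))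

lemma integrable_mul_of_bdd {X : Type*} [MeasurableSpace X] {μ : Measure X} {u ψ : X → ℝ}
    (hu : Integrable u μ) (hψ : Measurable ψ) (hb : ∃ C, ∀ x, |ψ x| ≤ C) :
    Integrable (fun x => u x * ψ x) μ := by
  obtain ⟨C, hC⟩ := hb
  exact hu.mul_bdd (c := C) hψ.aestronglyMeasurable (ae_of_all _ hC)

lemma contraction_comp_eq (hl : l ≤ r) (hr : r ≤ p) (hk : r + l + k = 2 * p)
    (g : (Fin p → ℝ) → ℝ) (α : Fin k → ℕ) (x : ℕ → ℝ) :
    contraction r l g g (x ∘ α) = ∫ z, contrIntegrand hl hr hk g α (z, x) ∂halfPow l :=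
  contraction_eq hl hr hk g _

lemma integrable_contraction (hl : l ≤ r) (hr : r ≤ p) (hk : r + l + k = 2 * p)
    {g : (Fin p → ℝ) → ℝ} (hg : MemLp g 2 (halfPow p)) {α : Fin k → ℕ}
    (hα : Function.Injective α) :
    Integrable (fun x : ℕ → ℝ => contraction r l g g (x ∘ α)) conf := by
  simp_rw [contraction_comp_eq hl hr hk g α]
  exact (integrable_contrIntegrand hl hr hk hg hα).integral_prod_right

/-- The mixed moments of the terms of the multiple sum with a test function. -/
noncomputable def mixed (g : (Fin p → ℝ) → ℝ) (ψ : (ℕ → ℝ) → ℝ) (B C : Finset ℕ) : ℝ :=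
  ∫ x, setEval g B x * setEval g C x * ψ x ∂conf

/-- An integrated index occurs in both selections, so a clash with any other variable is visible in
at least one of them; clashes among the free indices are excluded by `hα`. -/
lemma elim_injective_of_sel (hl : l ≤ r) (hr : r ≤ p) (hk : r + l + k = 2 * p) {α : Fin k → ℕ}
    (hα : Function.Injective α) {ρ : Fin l → ℕ}
    (h1 : Function.Injective (Sum.elim ρ α ∘ sel₁ hl hr hk))
    (h2 : Function.Injective (Sum.elim ρ α ∘ sel₂ hl hr hk)) :
    Function.Injective (Sum.elim ρ α) := by
  have hinl : ∀ (i : Fin l) (c : Fin l ⊕ Fin k), Sum.elim ρ α (Sum.inl i) = Sum.elim ρ α c →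
      Sum.inl i = c := by
    intro i c h
    by_cases hc : contrLabel p r c = 3
    · obtain ⟨a, ha⟩ := exists_sel₂_inl hl hr hk i
      obtain ⟨b, hb⟩ := (exists_sel₂_iff hl hr hk c).2 (by rw [hc]; decide)
      rw [← ha, ← hb] at h ⊢
      rw [h2 h]
    · obtain ⟨a, ha⟩ := exists_sel₁_inl hl hr hk i
      obtain ⟨b, hb⟩ := (exists_sel₁_iff hl hr hk c).2 hc
      rw [← ha, ← hb] at h ⊢
      rw [h1 h]
  rintro (i | i) (j | j) h
  · exact hinl i _ h
  · exact hinl i _ h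
  · exact (hinl j _ h.symm).symm
  · rw [hα h]

/-- If all block indices are distinct, the integrated variables may be taken as resampled
coordinates at `ρ`, which `ψ` does not see. Otherwise one of the two factors has two variables in
one block and vanishes. -/
lemma integral_contrIntegrand_block (hl : l ≤ r) (hr : r ≤ p) (hk : r + l + k = 2 * p)
    {g : (Fin p → ℝ) → ℝ} (hg : Kern g) {α : Fin k → ℕ} (hα : Function.Injective α)
    {ψ : (ℕ → ℝ) → ℝ} (hψ : TestFun ∅ (Finset.univ.image α) ψ) (ρ : Fin l → ℕ) :
    ∫ q, contrIntegrand hl hr hk g α q * ψ q.2 ∂((Measure.pi fun i => blockMeas (ρ i)).prod conf)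
      = if Function.Injective (Sum.elim ρ α) then
          mixed g ψ (Finset.univ.image (Sum.elim ρ α ∘ sel₁ hl hr hk))
            (Finset.univ.image (Sum.elim ρ α ∘ sel₂ hl hr hk)) else 0 := by
  split_ifs with hinj
  · have hρ : Function.Injective ρ := hinj.comp Sum.inl_injective
    have hnr : ∀ j, ¬ ∃ i, ρ i = α j := fun j ⟨i, hi⟩ => by
      have := @hinj (Sum.inl i) (Sum.inr j) hi
      cases this
    have hmp := measurePreserving_extend hρ
    have e : ∀ q : (Fin l → ℝ) × (ℕ → ℝ), (Sum.elim q.1 (q.2 ∘ α) : Fin l ⊕ Fin k → ℝ)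
        = Function.extend ρ q.1 q.2 ∘ Sum.elim ρ α := fun q => by
      funext c
      rcases c with c | c
      · simp [hρ.extend_apply]
      · simp [Function.extend_apply' _ _ _ (hnr c)]
    have e2 : ∀ q : (Fin l → ℝ) × (ℕ → ℝ), ψ q.2 = ψ (Function.extend ρ q.1 q.2) := fun q => by
      refine hψ.dep _ _ fun i hi => ?_
      rw [Finset.empty_union] at hi
      obtain ⟨j, -, rfl⟩ := Finset.mem_image.1 hi
      rw [Function.extend_apply' _ _ _ (hnr j)]
    have hm : Measurable (fun x : ℕ → ℝ => g ((x ∘ Sum.elim ρ α) ∘ sel₁ hl hr hk) *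
        g ((x ∘ Sum.elim ρ α) ∘ sel₂ hl hr hk) * ψ x) := by
      refine Measurable.mul (Measurable.mul (hg.meas.comp ?_) (hg.meas.comp ?_)) hψ.meas <;>
      exact measurable_pi_iff.2 fun i => measurable_pi_apply _
    unfold mixed
    have e3 : ∀ x, setEval g (Finset.univ.image (Sum.elim ρ α ∘ sel₁ hl hr hk)) x *
        setEval g (Finset.univ.image (Sum.elim ρ α ∘ sel₂ hl hr hk)) x * ψ x
        = g ((x ∘ Sum.elim ρ α) ∘ sel₁ hl hr hk) * g ((x ∘ Sum.elim ρ α) ∘ sel₂ hl hr hk) * ψ x :=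
      fun x => by
        rw [setEval_eq hg.symm (hinj.comp (sel₁_injective hl hr hk)) rfl,
          setEval_eq hg.symm (hinj.comp (sel₂_injective hl hr hk)) rfl]
        rfl
    simp_rw [e3]
    conv_rhs => rw [← hmp.map_eq]
    rw [integral_map hmp.measurable.aemeasurable hm.aestronglyMeasurable]
    refine integral_congr_ae (ae_of_all _ fun q => ?_)
    simp only [contrIntegrand, e]
    rw [e2 q]
  · refine integral_eq_zero_of_ae ?_
    have hz : ∀ᵐ z ∂(Measure.pi fun i => blockMeas (ρ i)), ∀ i, z i ∈ block (ρ i) := by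
      rw [pi_blockMeas_eq]
      refine (ae_restrict_mem (MeasurableSet.univ_pi fun i => measurableSet_block _)).mono
        fun z hz i => hz i trivial
    have hz' := (Measure.quasiMeasurePreserving_fst
      (μ := Measure.pi fun i => blockMeas (ρ i)) (ν := conf)).ae hz
    have hx' := (Measure.quasiMeasurePreserving_snd
      (μ := Measure.pi fun i => blockMeas (ρ i)) (ν := conf)).ae conf_ae_mem
    filter_upwards [hz', hx'] with q h1 h2
    have hb : ∀ c, (Sum.elim q.1 (q.2 ∘ α) : Fin l ⊕ Fin k → ℝ) c ∈ block (Sum.elim ρ α c) := by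
      rintro (c | c)
      · exact h1 c
      · exact h2 (α c)
    simp only [contrIntegrand, Pi.zero_apply]
    by_cases h3 : Function.Injective (Sum.elim ρ α ∘ sel₁ hl hr hk)
    · have h4 : ¬ Function.Injective (Sum.elim ρ α ∘ sel₂ hl hr hk) := fun h4 =>
        hinj (elim_injective_of_sel hl hr hk hα h3 h4)
      rw [hg.vanish _ (Sum.elim q.1 (q.2 ∘ α) ∘ sel₂ hl hr hk) (fun i => hb _) h4]
      simp
    · rw [hg.vanish _ (Sum.elim q.1 (q.2 ∘ α) ∘ sel₁ hl hr hk) (fun i => hb _) h3]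
      simp

/-- Decompose the integration over `z` into blocks. Absolute convergence comes from the
integrability of the product of two square-integrable factors. -/
lemma hasSum_contraction (hl : l ≤ r) (hr : r ≤ p) (hk : r + l + k = 2 * p)
    {g : (Fin p → ℝ) → ℝ} (hg : Kern g) {α : Fin k → ℕ} (hα : Function.Injective α)
    {ψ : (ℕ → ℝ) → ℝ} (hψ : TestFun ∅ (Finset.univ.image α) ψ) :
    HasSum (fun ρ : Fin l → ℕ => if Function.Injective (Sum.elim ρ α) then
          mixed g ψ (Finset.univ.image (Sum.elim ρ α ∘ sel₁ hl hr hk))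
            (Finset.univ.image (Sum.elim ρ α ∘ sel₂ hl hr hk)) else 0)
      (∫ x, contraction r l g g (x ∘ α) * ψ x ∂conf) := by
  have hi : Integrable (fun q : (Fin l → ℝ) × (ℕ → ℝ) => contrIntegrand hl hr hk g α q * ψ q.2)
      ((halfPow l).prod conf) :=
    integrable_mul_of_bdd (integrable_contrIntegrand hl hr hk hg.memLp hα)
      (hψ.meas.comp measurable_snd) (by obtain ⟨C, hC⟩ := hψ.bdd; exact ⟨C, fun q => hC _⟩)
  have h1 : ∫ x, contraction r l g g (x ∘ α) * ψ x ∂conf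
      = ∫ q, contrIntegrand hl hr hk g α q * ψ q.2 ∂((halfPow l).prod conf) := by
    rw [integral_prod_symm _ hi]
    refine integral_congr_ae (ae_of_all _ fun x => ?_)
    simp only [contraction_comp_eq hl hr hk g α, integral_mul_const]
  have h2 : (halfPow l).prod conf = Measure.sum fun ρ : Fin l → ℕ =>
      (Measure.pi fun i => blockMeas (ρ i)).prod conf := by
    rw [halfPow, pi_halfLeb_eq_sum, Measure.prod_sum_left]
  rw [h2] at hi
  have h3 := hasSum_integral_measure hi
  rw [h1, h2]
  simpa only [integral_contrIntegrand_block hl hr hk hg hα hψ] using h3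

/-! ### The product formula tested against degenerate functions -/

/-- An index outside `A` that lies in only one of `B`, `C` is killed by the degeneracy of the
kernel, an index of `A` outside both by the degeneracy of `ψ`. -/
lemma mixed_ne_zero {g : (Fin p → ℝ) → ℝ} (hg : Kern g) {A : Finset ℕ}
    {ψ : (ℕ → ℝ) → ℝ} (hψ : TestFun ∅ A ψ) {B C : Finset ℕ} (h : mixed g ψ B C ≠ 0) :
    B \ C ⊆ A ∧ C \ B ⊆ A ∧ A ⊆ B ∪ C := by
  have hψu : ∀ b, b ∉ A → ∀ x s, ψ (Function.update x b s) = ψ x := fun b hb x s =>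
    hψ.dep _ _ fun i hi => Function.update_of_ne (by rintro rfl; simp at hi; exact hb hi) _ _
  refine ⟨fun b hb => ?_, fun b hb => ?_, fun b hb => ?_⟩ <;> by_contra hcon <;> apply h
  · obtain ⟨hB, hC⟩ := Finset.mem_sdiff.1 hb
    have := integral_mul_eq_zero_of_degen (u := fun x => setEval g C x * ψ x) (fun x s => by
      rw [setEval_update g hC, hψu b hcon]) (hg.degen B b hB)
    rw [← this]
    exact integral_congr_ae (ae_of_all _ fun x => by simp only; ring)
  · obtain ⟨hB, hC⟩ := Finset.mem_sdiff.1 hb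
    have := integral_mul_eq_zero_of_degen (u := fun x => setEval g B x * ψ x) (fun x s => by
      rw [setEval_update g hC, hψu b hcon]) (hg.degen C b hB)
    rw [← this]
    exact integral_congr_ae (ae_of_all _ fun x => by simp only; ring)
  · rw [Finset.mem_union, not_or] at hcon
    exact integral_mul_eq_zero_of_degen (u := fun x => setEval g B x * setEval g C x) (fun x s => by
      rw [setEval_update g hcon.1, setEval_update g hcon.2]) (hψ.degen b hb)

lemma integral_chaos_sq_mul {g : (Fin p → ℝ) → ℝ} (hg : Kern g) {ψ : (ℕ → ℝ) → ℝ}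
    (hψ : Measurable ψ) (hb : ∃ C, ∀ x, |ψ x| ≤ C) (N : ℕ) :
    ∫ x, chaos g N x ^ 2 * ψ x ∂conf = (p ! : ℝ) ^ 2 *
      ∑ B ∈ Finset.powersetCard p (Finset.range N), ∑ C ∈ Finset.powersetCard p (Finset.range N),
        mixed g ψ B C := by
  have e : ∀ x, chaos g N x ^ 2 * ψ x = (p ! : ℝ) ^ 2 *
      ∑ B ∈ Finset.powersetCard p (Finset.range N), ∑ C ∈ Finset.powersetCard p (Finset.range N),
        setEval g B x * setEval g C x * ψ x := fun x => by
    unfold chaos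
    rw [mul_pow, sq (∑ B ∈ _, _), Finset.sum_mul_sum]
    simp_rw [Finset.mul_sum, Finset.sum_mul]
    refine Finset.sum_congr rfl fun B _ => Finset.sum_congr rfl fun C _ => by ring
  have hi : ∀ B C, Integrable (fun x => setEval g B x * setEval g C x * ψ x) conf := fun B C =>
    integrable_mul_of_bdd (integrable_setEval_mul hg B C) hψ hb
  simp_rw [e]
  rw [integral_const_mul, integral_finsetSum _ fun B _ => integrable_finsetSum _ fun C _ => hi B C]
  congr 1
  refine Finset.sum_congr rfl fun B _ => ?_
  rw [integral_finsetSum _ fun C _ => hi B C]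
  rfl

lemma tendsto_piFinset_range (l : ℕ) :
    Tendsto (fun N : ℕ => Fintype.piFinset fun _ : Fin l => Finset.range N) atTop atTop := by
  refine tendsto_atTop_finset_of_monotone (fun M N h => ?_) fun ρ => ?_
  · exact Fintype.piFinset_subset _ _ fun _ => Finset.range_mono h
  · refine ⟨Finset.univ.sup ρ + 1, Fintype.mem_piFinset.2 fun i => Finset.mem_range.2 ?_⟩
    exact Nat.lt_succ_of_le (Finset.le_sup (f := ρ) (Finset.mem_univ i))

lemma mem_distinctBlocks {x : ℕ → ℝ} (hx : ∀ k, x k ∈ block k) {α : Fin k → ℕ}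
    (hα : Function.Injective α) : x ∘ α ∈ distinctBlocks k :=
  ⟨α, hα, fun i => Set.Ico_subset_Icc_self (hx (α i))⟩

/-- Almost every configuration lies in distinct blocks, so the indicator is one; the factor `k!`
cancels the normalisation of the symmetrisation. -/
lemma integral_kernelG_mul {g : (Fin p → ℝ) → ℝ} (hg : MemLp g 2 (halfPow p)) {α : Fin k → ℕ}
    (hα : Function.Injective α) {ψ : (ℕ → ℝ) → ℝ} (hψ : Measurable ψ)
    (hb : ∃ C, ∀ x, |ψ x| ≤ C) :
    (k ! : ℝ) * ∫ x, kernelG p k g (x ∘ α) * ψ x ∂conf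
      = ∑ r ∈ Finset.range (p + 1), ∑ l ∈ Finset.range (r + 1), if r + l + k = 2 * p then
        (r ! : ℝ) * (p.choose r : ℝ) ^ 2 * (r.choose l : ℝ) * ∑ σ : Equiv.Perm (Fin k),
          ∫ x, contraction r l g g (x ∘ (α ∘ σ)) * ψ x ∂conf else 0 := by
  have hi : ∀ r ∈ Finset.range (p + 1), ∀ l ∈ Finset.range (r + 1), r + l + k = 2 * p →
      ∀ σ : Equiv.Perm (Fin k), Integrable (fun x : ℕ → ℝ =>
        contraction r l g g (x ∘ (α ∘ σ)) * ψ x) conf := by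
    intro r hr l hl hk σ
    rw [Finset.mem_range] at hr hl
    exact integrable_mul_of_bdd (integrable_contraction (by omega) (by omega) hk hg
      (hα.comp σ.injective)) hψ hb
  have e : ∀ᵐ x ∂conf, (k ! : ℝ) * (kernelG p k g (x ∘ α) * ψ x)
      = ∑ r ∈ Finset.range (p + 1), ∑ l ∈ Finset.range (r + 1), if r + l + k = 2 * p then
        (r ! : ℝ) * (p.choose r : ℝ) ^ 2 * (r.choose l : ℝ) * ∑ σ : Equiv.Perm (Fin k),
          contraction r l g g (x ∘ (α ∘ σ)) * ψ x else 0 := by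
    filter_upwards [conf_ae_mem] with x hx
    rw [kernelG, Set.indicator_of_mem (mem_distinctBlocks hx hα)]
    simp_rw [Finset.sum_mul, Finset.mul_sum]
    refine Finset.sum_congr rfl fun r _ => Finset.sum_congr rfl fun l _ => ?_
    split_ifs
    · have hk : (k ! : ℝ) ≠ 0 := by exact_mod_cast (Nat.factorial_pos k).ne'
      rw [symmetrize, ← Finset.mul_sum, ← Finset.sum_mul]
      simp only [Function.comp_assoc]
      field_simp
    · simp
  rw [← integral_const_mul, integral_congr_ae e, integral_finsetSum]
  · refine Finset.sum_congr rfl fun r hr => ?_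
    rw [integral_finsetSum]
    · refine Finset.sum_congr rfl fun l hl => ?_
      split_ifs with hk
      · rw [integral_const_mul, integral_finsetSum _ fun σ _ => hi r hr l hl hk σ]
      · simp
    · intro l hl
      split_ifs with hk
      · exact (integrable_finsetSum _ fun σ _ => hi r hr l hl hk σ).const_mul _
      · exact integrable_zero _ _ _
  · intro r hr
    refine integrable_finsetSum _ fun l hl => ?_
    split_ifs with hk
    · exact (integrable_finsetSum _ fun σ _ => hi r hr l hl hk σ).const_mul _
    · exact integrable_zero _ _ _

lemma TestFun.comp_perm {α : Fin k → ℕ} {ψ : (ℕ → ℝ) → ℝ}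
    (hψ : TestFun ∅ (Finset.univ.image α) ψ) (σ : Equiv.Perm (Fin k)) :
    TestFun ∅ (Finset.univ.image (α ∘ σ)) ψ := by
  have : Finset.univ.image (α ∘ σ) = Finset.univ.image α := by
    rw [← Finset.image_image]
    congr 1
    ext i; simp only [Finset.mem_image, Finset.mem_univ, true_and, iff_true]
    exact σ.surjective i
  rw [this]; exact hψ

/-- The square of a multiple sum, tested against a degenerate function of the variables
`α₁, …, α_k`, is governed by the kernel `G_k`. -/
theorem tendsto_integral_chaos_sq_mul {g : (Fin p → ℝ) → ℝ} (hg : Kern g) {α : Fin k → ℕ}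
    (hα : Function.Injective α) {ψ : (ℕ → ℝ) → ℝ} (hψ : TestFun ∅ (Finset.univ.image α) ψ) :
    Tendsto (fun N => ∫ x, chaos g N x ^ 2 * ψ x ∂conf) atTop
      (𝓝 ((k ! : ℝ) * ∫ x, kernelG p k g (x ∘ α) * ψ x ∂conf)) := by
  have hcard : (Finset.univ.image α).card = k := by
    rw [Finset.card_image_of_injective _ hα, Finset.card_univ, Fintype.card_fin]
  rw [integral_kernelG_mul hg.memLp hα hψ.meas hψ.bdd]
  -- Expand the square and sort the pairs of index sets that survive by type.
  have e : ∀ N, ∫ x, chaos g N x ^ 2 * ψ x ∂conf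
      = ∑ r ∈ Finset.range (p + 1), ∑ l ∈ Finset.range (r + 1), if r + l + k = 2 * p then
        (p ! : ℝ) ^ 2 * ∑ q ∈ goodPairs p (Finset.range N) (Finset.univ.image α) r l,
          mixed g ψ q.1 q.2 else 0 := fun N => by
    rw [integral_chaos_sq_mul hg hψ.meas hψ.bdd, sum_pairs_eq_sum_goodPairs hcard
      fun B C _ _ h => mixed_ne_zero hg hψ h, Finset.mul_sum]
    refine Finset.sum_congr rfl fun r _ => ?_
    rw [Finset.mul_sum]
    refine Finset.sum_congr rfl fun l _ => ?_
    split_ifs <;> simp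
  simp_rw [e]
  refine tendsto_finsetSum _ fun r hr => tendsto_finsetSum _ fun l hl => ?_
  rw [Finset.mem_range] at hr hl
  split_ifs with hk
  · have hl' : l ≤ r := by omega
    have hr' : r ≤ p := by omega
    have h1 : Tendsto (fun N : ℕ => ((r ! : ℝ) * (p.choose r : ℝ) ^ 2 * (r.choose l : ℝ)) *
      ∑ σ : Equiv.Perm (Fin k), ∑ ρ ∈ Fintype.piFinset fun _ : Fin l => Finset.range N,
        (if Function.Injective (Sum.elim ρ (α ∘ σ)) then
          mixed g ψ (Finset.univ.image (Sum.elim ρ (α ∘ σ) ∘ sel₁ hl' hr' hk))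
            (Finset.univ.image (Sum.elim ρ (α ∘ σ) ∘ sel₂ hl' hr' hk)) else 0)) atTop
      (𝓝 ((r ! : ℝ) * (p.choose r : ℝ) ^ 2 * (r.choose l : ℝ) * ∑ σ : Equiv.Perm (Fin k),
          ∫ x, contraction r l g g (x ∘ (α ∘ σ)) * ψ x ∂conf)) := by
      refine Tendsto.const_mul _ (tendsto_finsetSum _ fun σ _ => ?_)
      exact (hasSum_contraction hl' hr' hk hg (hα.comp σ.injective)
        (hψ.comp_perm σ)).comp (tendsto_piFinset_range l)
    refine h1.congr' ?_
    -- Once all of `A` lies below `N`, the finite product formula is an exact identity; the limit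
    -- concerns only the integrated indices.
    filter_upwards [eventually_ge_atTop ((Finset.univ.image α).sup id + 1)] with N hN
    refine sum_perm_eq_goodPairs hl' hr' hk hα rfl (fun a ha => ?_) (mixed g ψ)
    have := Finset.le_sup (f := id) ha
    simp only [id_eq] at this
    exact Finset.mem_range.2 (by omega)
  · exact tendsto_const_nhds

end UniformChaos

namespace UniformChaos

/-! ### Measurability and symmetry of the kernels -/

variable {p k : ℕ}

lemma measurable_coordOr0 {T : Type*} [MeasurableSpace T] {N : ℕ} {u : T → Fin N → ℝ}
    (hu : Measurable u) (j : ℕ) : Measurable fun t => coordOr0 (u t) j := by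
  unfold coordOr0
  split_ifs with h
  · exact (measurable_pi_apply _).comp hu
  · exact measurable_const

lemma measurable_contraction {T : Type*} [MeasurableSpace T] {f : T → (Fin p → ℝ) → ℝ}
    (hf : Measurable (Function.uncurry f)) (r l : ℕ) :
    Measurable fun q : T × (Fin k → ℝ) => contraction r l (f q.1) (f q.1) q.2 := by
  unfold contraction
  have h : ∀ u : (T × (Fin k → ℝ)) × (Fin l → ℝ) → (Fin p → ℝ), Measurable u →
      Measurable fun w : (T × (Fin k → ℝ)) × (Fin l → ℝ) => f w.1.1 (u w) := fun u hu =>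
    hf.comp ((measurable_fst.comp measurable_fst).prodMk hu)
  have hz : ∀ j, Measurable fun w : (T × (Fin k → ℝ)) × (Fin l → ℝ) => coordOr0 w.2 j :=
    fun j => measurable_coordOr0 measurable_snd j
  have hx : ∀ j, Measurable fun w : (T × (Fin k → ℝ)) × (Fin l → ℝ) => coordOr0 w.1.2 j :=
    fun j => measurable_coordOr0 (measurable_snd.comp measurable_fst) j
  refine StronglyMeasurable.measurable (StronglyMeasurable.integral_prod_right (f := fun
    (q : T × (Fin k → ℝ)) (z : Fin l → ℝ) => _) (Measurable.stronglyMeasurable ?_))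
  refine Measurable.mul (h _ ?_) (h _ ?_)
  · refine measurable_pi_iff.2 fun a => ?_
    split_ifs
    · exact hz _
    · exact hx _
  · refine measurable_pi_iff.2 fun a => ?_
    split_ifs
    · exact hz _
    · exact hx _
    · exact hx _

lemma measurableSet_distinctBlocks (k : ℕ) : MeasurableSet (distinctBlocks k) := by
  have : distinctBlocks k = ⋃ e : Fin k → ℕ, ⋃ _ : Function.Injective e,
      Set.univ.pi fun i => Set.Icc (2 * (e i : ℝ)) (2 * (e i : ℝ) + 2) := by
    ext x
    simp only [distinctBlocks, Set.mem_ofPred_eq, Set.mem_iUnion, Set.mem_univ_pi, exists_prop]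
  rw [this]
  exact MeasurableSet.iUnion fun e => MeasurableSet.iUnion fun _ =>
    MeasurableSet.univ_pi fun i => measurableSet_Icc

lemma comp_perm_mem_distinctBlocks_iff {x : Fin k → ℝ} (σ : Equiv.Perm (Fin k)) :
    x ∘ σ ∈ distinctBlocks k ↔ x ∈ distinctBlocks k := by
  have h : ∀ (y : Fin k → ℝ) (τ : Equiv.Perm (Fin k)), y ∈ distinctBlocks k →
      y ∘ τ ∈ distinctBlocks k := fun y τ ⟨e, he, hy⟩ =>
    ⟨e ∘ τ, he.comp τ.injective, fun i => hy (τ i)⟩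
  refine ⟨fun hx => ?_, h x σ⟩
  have := h _ σ⁻¹ hx
  rwa [Function.comp_assoc, ← Equiv.Perm.coe_mul, mul_inv_cancel, Equiv.Perm.coe_one,
    Function.comp_id] at this

lemma symmFun_symmetrize (h : (Fin k → ℝ) → ℝ) : SymmFun (symmetrize h) := by
  intro σ x
  unfold symmetrize
  congr 1
  refine Fintype.sum_equiv (Equiv.mulLeft σ) _ _ fun τ => ?_
  simp [Function.comp_assoc]

lemma symmFun_kernelG (g : (Fin p → ℝ) → ℝ) : SymmFun (kernelG p k g) := by
  intro σ x
  unfold kernelG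
  by_cases hx : x ∈ distinctBlocks k
  · rw [Set.indicator_of_mem hx, Set.indicator_of_mem ((comp_perm_mem_distinctBlocks_iff σ).2 hx)]
    simp only [symmFun_symmetrize _ σ x]
  · rw [Set.indicator_of_notMem hx,
      Set.indicator_of_notMem (fun h => hx ((comp_perm_mem_distinctBlocks_iff σ).1 h))]

lemma measurable_kernelG_param {T : Type*} [MeasurableSpace T] {f : T → (Fin p → ℝ) → ℝ}
    (hf : Measurable (Function.uncurry f)) :
    Measurable fun q : T × (Fin k → ℝ) => kernelG p k (f q.1) q.2 := by
  have h1 : Measurable fun q : T × (Fin k → ℝ) =>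
      ∑ r ∈ Finset.range (p + 1), ∑ l ∈ Finset.range (r + 1), if r + l + k = 2 * p then
        (r ! : ℝ) * (p.choose r : ℝ) ^ 2 * (r.choose l : ℝ) *
          symmetrize (contraction r l (f q.1) (f q.1)) q.2 else 0 := by
    refine Finset.measurable_sum _ fun r _ => Finset.measurable_sum _ fun l _ => ?_
    split_ifs
    · refine Measurable.const_mul ?_ _
      unfold symmetrize
      refine Measurable.const_mul (Finset.measurable_sum _ fun σ _ => ?_) _
      have hσ : Measurable fun q : T × (Fin k → ℝ) => q.2 ∘ σ :=
        measurable_pi_iff.2 fun i => (measurable_pi_apply _).comp measurable_snd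
      exact (measurable_contraction hf r l).comp (measurable_fst.prodMk hσ)
    · exact measurable_const
  have h2 := h1.indicator (measurable_snd (measurableSet_distinctBlocks k))
  exact h2

lemma measurable_kernelG {g : (Fin p → ℝ) → ℝ} (hg : Measurable g) :
    Measurable (kernelG p k g) :=
  (measurable_kernelG_param (f := fun _ : Unit => g) (hg.comp measurable_snd)).comp
    (measurable_prodMk_left (x := ()))

lemma kernelG_eq_zero (h : 2 * p < k) (g : (Fin p → ℝ) → ℝ) : kernelG p k g = 0 := by
  unfold kernelG
  funext x
  have : ∀ r l, ¬ (r + l + k = 2 * p) := fun r l => by omega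
  simp [this, Set.indicator]

/-! ### The fourth moment of a multiple sum -/

lemma abs_integral_mul_le_sqrt {X : Type*} [MeasurableSpace X] {μ : Measure X} {u v : X → ℝ}
    (hu : MemLp u 2 μ) (hv : MemLp v 2 μ) :
    |∫ x, u x * v x ∂μ| ≤ √(∫ x, u x ^ 2 ∂μ) * √(∫ x, v x ^ 2 ∂μ) := by
  have h := integral_mul_norm_le_Lp_mul_Lq (μ := μ) (f := u) (g := v) Real.HolderConjugate.two_two
    (by simpa using hu) (by simpa using hv)
  refine (abs_integral_le_integral_abs).trans ?_
  simp only [abs_mul]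
  simpa [Real.sqrt_eq_rpow] using h

lemma memLp_of_bdd {X : Type*} [MeasurableSpace X] {μ : Measure X} [IsFiniteMeasure μ] {ψ : X → ℝ}
    (hψ : Measurable ψ) (hb : ∃ C, ∀ x, |ψ x| ≤ C) (q : ℝ≥0∞) : MemLp ψ q μ := by
  obtain ⟨C, hC⟩ := hb
  exact MemLp.of_bound hψ.aestronglyMeasurable C (ae_of_all _ hC)

/-- Shows that the squared constants of the duality bound sum to at most the total mass of the
kernels, whatever the finite set `S` of coordinates. -/
lemma sum_powerset_integral_sq_le {h : ∀ k, (Fin k → ℝ) → ℝ} (hm : ∀ k, Measurable (h k))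
    (hs : ∀ k, SymmFun (h k)) (hL : ∀ k, MemLp (h k) 2 (halfPow k)) {K : ℕ}
    (hz : ∀ k, K ≤ k → h k = 0) (S : Finset ℕ) :
    ∑ A ∈ S.powerset, (A.card ! : ℝ) ^ 2 * ∫ x, setEval (h A.card) A x ^ 2 ∂conf
      ≤ ∑ k ∈ Finset.range K, (k ! : ℝ) * normSq (h k) := by
  rw [Finset.sum_powerset]
  have h0 : ∀ k, 0 ≤ (k ! : ℝ) * normSq (h k) := fun k =>
    mul_nonneg (by positivity) (integral_nonneg fun _ => sq_nonneg _)
  have h1 : ∀ k, ∑ A ∈ S.powersetCard k,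
      (A.card ! : ℝ) ^ 2 * ∫ x, setEval (h A.card) A x ^ 2 ∂conf ≤ (k ! : ℝ) * normSq (h k) := by
    intro k
    have : ∑ A ∈ S.powersetCard k, (A.card ! : ℝ) ^ 2 * ∫ x, setEval (h A.card) A x ^ 2 ∂conf
        = (k ! : ℝ) * ((k ! : ℝ) * ∑ A ∈ S.powersetCard k, ∫ x, setEval (h k) A x ^ 2 ∂conf) := by
      rw [← mul_assoc, ← sq, Finset.mul_sum]
      refine Finset.sum_congr rfl fun A hA => ?_
      rw [(Finset.mem_powersetCard.1 hA).2]
    rw [this]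
    exact mul_le_mul_of_nonneg_left (sum_integral_setEval_sq_le (hm k) (hs k) (hL k) S)
      (by positivity)
  refine (Finset.sum_le_sum fun k _ => h1 k).trans ?_
  have h2 : ∀ k, K ≤ k → (k ! : ℝ) * normSq (h k) = 0 := fun k hk => by
    simp [hz k hk, normSq]
  calc ∑ k ∈ Finset.range (S.card + 1), (k ! : ℝ) * normSq (h k)
      = ∑ k ∈ (Finset.range (S.card + 1)).filter (· < K), (k ! : ℝ) * normSq (h k) := by
        refine (Finset.sum_filter_of_ne fun k _ hk => ?_).symm
        by_contra hc
        exact hk (h2 k (not_lt.1 hc))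
    _ ≤ _ := by
        refine Finset.sum_le_sum_of_subset_of_nonneg (fun k hk => ?_) fun k _ _ => h0 k
        simp only [Finset.mem_filter] at hk
        exact Finset.mem_range.2 hk.2

variable {g : (Fin p → ℝ) → ℝ}

lemma chaos_sub (g : (Fin p → ℝ) → ℝ) {M N : ℕ} (h : M ≤ N) (x : ℕ → ℝ) :
    chaos g N x - chaos g M x = (p ! : ℝ) * ∑ B ∈ Finset.powersetCard p (Finset.range N) \
      Finset.powersetCard p (Finset.range M), setEval g B x := by
  unfold chaos
  rw [← mul_sub, ← Finset.sum_sdiff (Finset.powersetCard_mono (n := p) (Finset.range_mono h)),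
    add_sub_cancel_right]

/-- The martingale property: each added term contains an index that is at least `M`, in which it is
degenerate and `u` is constant. -/
lemma integral_mul_chaos_sub (hg : Kern g) {u : (ℕ → ℝ) → ℝ} (hu : MemLp u 2 conf) {M N : ℕ}
    (h : M ≤ N) (hd : ∀ k, M ≤ k → ∀ x s, u (Function.update x k s) = u x) :
    ∫ x, u x * (chaos g N x - chaos g M x) ∂conf = 0 := by
  simp_rw [chaos_sub g h, Finset.mul_sum, mul_left_comm (u _)]
  rw [integral_finsetSum]
  · refine Finset.sum_eq_zero fun B hB => ?_
    rw [integral_const_mul]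
    obtain ⟨hB1, hB2⟩ := Finset.mem_sdiff.1 hB
    have : ∃ b ∈ B, M ≤ b := by
      by_contra hc
      push Not at hc
      exact hB2 (Finset.mem_powersetCard.2
        ⟨fun b hb => Finset.mem_range.2 (hc b hb), (Finset.mem_powersetCard.1 hB1).2⟩)
    obtain ⟨b, hb, hMb⟩ := this
    rw [integral_mul_eq_zero_of_degen (hd b hMb) (hg.degen B b hb), mul_zero]
  · exact fun B _ => (MemLp.integrable_mul hu (memLp_setEval hg B)).const_mul _

/-- The submartingale property of the square. In its expansion the cross term vanishes, since `chaos
g M x * ψ x` depends only on coordinates below `M`. -/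
lemma integral_chaos_sq_mul_mono (hg : Kern g) {ψ : (ℕ → ℝ) → ℝ} (hψ : Measurable ψ)
    (hb : ∃ C, ∀ x, |ψ x| ≤ C) (h0 : ∀ x, 0 ≤ ψ x) {M N : ℕ} (h : M ≤ N)
    (hd : ∀ k, M ≤ k → ∀ x s, ψ (Function.update x k s) = ψ x) :
    ∫ x, chaos g M x ^ 2 * ψ x ∂conf ≤ ∫ x, chaos g N x ^ 2 * ψ x ∂conf := by
  have hM := memLp_chaos hg M
  have hD : MemLp (fun x => chaos g N x - chaos g M x) 2 conf := (memLp_chaos hg N).sub hM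
  have hu : MemLp (fun x => chaos g M x * ψ x) 2 conf := by
    obtain ⟨C, hC⟩ := hb
    refine (hM.const_mul C).mono (hM.aestronglyMeasurable.mul hψ.aestronglyMeasurable)
      (ae_of_all _ fun x => ?_)
    have hC0 : 0 ≤ C := (abs_nonneg _).trans (hC x)
    rw [norm_mul, norm_mul, mul_comm, Real.norm_eq_abs, Real.norm_eq_abs C, abs_of_nonneg hC0]
    exact mul_le_mul_of_nonneg_right (hC x) (norm_nonneg _)
  have hz := integral_mul_chaos_sub hg hu h (fun k hk x s => by
    rw [chaos_update g hk, hd k hk])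
  have i1 : Integrable (fun x => chaos g M x ^ 2 * ψ x) conf :=
    integrable_mul_of_bdd hM.integrable_sq hψ hb
  have i2 : Integrable (fun x => (chaos g N x - chaos g M x) ^ 2 * ψ x) conf :=
    integrable_mul_of_bdd hD.integrable_sq hψ hb
  have i3 : Integrable (fun x => chaos g M x * ψ x * (chaos g N x - chaos g M x)) conf :=
    MemLp.integrable_mul hu hD
  have e : ∀ x, chaos g N x ^ 2 * ψ x = (chaos g M x ^ 2 * ψ x +
      (chaos g N x - chaos g M x) ^ 2 * ψ x) +
      2 * (chaos g M x * ψ x * (chaos g N x - chaos g M x)) := fun x => by ring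
  simp_rw [e]
  have i12 : Integrable (fun x => chaos g M x ^ 2 * ψ x +
      (chaos g N x - chaos g M x) ^ 2 * ψ x) conf := i1.add i2
  rw [integral_add i12 (i3.const_mul 2), integral_add i1 i2, integral_const_mul, hz]
  have : 0 ≤ ∫ x, (chaos g N x - chaos g M x) ^ 2 * ψ x ∂conf :=
    integral_nonneg fun x => mul_nonneg (sq_nonneg _) (h0 x)
  linarith

lemma integral_sq_setEval_eq {h : (Fin k → ℝ) → ℝ} (hs : SymmFun h) {α : Fin k → ℕ}
    (hα : Function.Injective α) :
    ∫ x, h (x ∘ α) ^ 2 ∂conf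
      = ∫ x, setEval h (Finset.univ.image α) x ^ 2 ∂conf := by
  simp_rw [setEval_eq hs hα rfl]

lemma memLp_comp_conf {h : (Fin k → ℝ) → ℝ} (hh : MemLp h 2 (halfPow k)) {α : Fin k → ℕ}
    (hα : Function.Injective α) : MemLp (fun x : ℕ → ℝ => h (x ∘ α)) 2 conf :=
  (hh.mono_measure (pi_blockMeas_le α)).comp_measurePreserving (measurePreserving_conf_comp hα)

lemma abs_integral_mul_setEval_le {h : (Fin k → ℝ) → ℝ} (hs : SymmFun h)
    (hh : MemLp h 2 (halfPow k)) {α : Fin k → ℕ} (hα : Function.Injective α)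
    {ψ : (ℕ → ℝ) → ℝ} (hψ : MemLp ψ 2 conf) :
    |∫ x, h (x ∘ α) * ψ x ∂conf| ≤
      √(∫ x, setEval h (Finset.univ.image α) x ^ 2 ∂conf) * √(∫ x, ψ x ^ 2 ∂conf) := by
  rw [← integral_sq_setEval_eq hs hα]
  exact abs_integral_mul_le_sqrt (memLp_comp_conf hh hα) hψ

/-- The duality principle for the functionals `ψ ↦ E[chaos² ψ]`. The constant does not involve `M`.
-/
lemma exists_limit_chaos_sq (hg : Kern g) (hG : ∀ k, MemLp (kernelG p k g) 2 (halfPow k))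
    {M : ℕ} {ψ : (ℕ → ℝ) → ℝ} (hψ : TestFun (Finset.range M) ∅ ψ) :
    ∃ ℓ, Tendsto (fun N => ∫ x, chaos g N x ^ 2 * ψ x ∂conf) atTop (𝓝 ℓ) ∧
      |ℓ| ≤ √(∑ k ∈ Finset.range (2 * p + 1), (k ! : ℝ) * normSq (kernelG p k g)) *
        √(∫ x, ψ x ^ 2 ∂conf) := by
  have hm : ∀ k, Measurable (kernelG p k g) := fun k => measurable_kernelG hg.meas
  obtain ⟨ℓ, h1, h2⟩ := exists_limit_of_degenerate
    (L := fun N ψ => ∫ x, chaos g N x ^ 2 * ψ x ∂conf)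
    (κ := fun A => (A.card ! : ℝ) * √(∫ x, setEval (kernelG p A.card g) A x ^ 2 ∂conf))
    (fun N u v hu hv hbu hbv => by
      have hi := (memLp_chaos hg N).integrable_sq
      simp only [mul_add]
      exact integral_add (integrable_mul_of_bdd hi hu hbu) (integrable_mul_of_bdd hi hv hbv))
    (fun A ψ hψ => by
      obtain ⟨α, hα, hA⟩ := exists_enum (B := A) rfl
      have hψ' : TestFun ∅ (Finset.univ.image α) ψ := hA.symm ▸ hψ
      refine ⟨_, tendsto_integral_chaos_sq_mul hg hα hψ', ?_⟩
      rw [abs_mul, Nat.abs_cast, mul_assoc]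
      refine mul_le_mul_of_nonneg_left ?_ (by positivity)
      have := abs_integral_mul_setEval_le (symmFun_kernelG g) (hG A.card) hα
        (memLp_of_bdd hψ.meas hψ.bdd 2)
      rwa [hA] at this)
    (fun A => by positivity) (Finset.range M) ∅ ψ (Finset.disjoint_empty_right _) hψ
  refine ⟨ℓ, h1, h2.trans (mul_le_mul_of_nonneg_right (Real.sqrt_le_sqrt ?_) (Real.sqrt_nonneg _))⟩
  refine le_trans (le_of_eq ?_) (sum_powerset_integral_sq_le hm (fun k => symmFun_kernelG g) hG
    (fun k hk => kernelG_eq_zero (by omega) g) (Finset.range M))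
  refine Finset.sum_congr rfl fun A _ => ?_
  rw [Finset.union_empty, mul_pow, Real.sq_sqrt (integral_nonneg fun _ => sq_nonneg _)]

/-- A self-bounding argument. For `ψ = min (chaos²) c` and `a = E[chaos² ψ]`, monotonicity in `N`
and duality give `a ≤ √K √(E ψ²)`, while `ψ ≤ chaos²` gives `E ψ² ≤ a`. Hence `a ≤ K`; the
truncation makes `a` finite beforehand. -/
lemma integral_chaos_sq_mul_min_le (hg : Kern g)
    (hG : ∀ k, MemLp (kernelG p k g) 2 (halfPow k)) (M : ℕ) {c : ℝ} (hc : 0 ≤ c) :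
    ∫ x, chaos g M x ^ 2 * min (chaos g M x ^ 2) c ∂conf ≤
      ∑ k ∈ Finset.range (2 * p + 1), (k ! : ℝ) * normSq (kernelG p k g) := by
  set K := ∑ k ∈ Finset.range (2 * p + 1), (k ! : ℝ) * normSq (kernelG p k g) with hK
  set ψ : (ℕ → ℝ) → ℝ := fun x => min (chaos g M x ^ 2) c with hψ
  have hK0 : 0 ≤ K := Finset.sum_nonneg fun k _ =>
    mul_nonneg (by positivity) (integral_nonneg fun _ => sq_nonneg _)
  have hm : Measurable ψ := ((measurable_chaos hg.meas M).pow_const 2).min measurable_const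
  have h0 : ∀ x, 0 ≤ ψ x := fun x => le_min (sq_nonneg _) hc
  have hb : ∃ C, ∀ x, |ψ x| ≤ C := ⟨c, fun x => by
    rw [abs_of_nonneg (h0 x)]; exact min_le_right _ _⟩
  have hd : ∀ k, M ≤ k → ∀ x s, ψ (Function.update x k s) = ψ x := fun k hk x s => by
    simp only [hψ, chaos_update g hk]
  have hT : TestFun (Finset.range M) ∅ ψ := by
    refine ⟨hm, hb, fun x y hxy => ?_, fun k hk => absurd hk (Finset.notMem_empty k)⟩
    have : chaos g M x = chaos g M y := by
      unfold chaos
      congr 1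
      refine Finset.sum_congr rfl fun B hB => setEval_congr g fun i hi => hxy i ?_
      rw [Finset.union_empty]
      exact (Finset.mem_powersetCard.1 hB).1 hi
    simp only [hψ, this]
  obtain ⟨ℓ, h1, h2⟩ := exists_limit_chaos_sq hg hG hT
  set a := ∫ x, chaos g M x ^ 2 * ψ x ∂conf with ha
  have ha0 : 0 ≤ a := integral_nonneg fun x => mul_nonneg (sq_nonneg _) (h0 x)
  have h3 : a ≤ ℓ := ge_of_tendsto h1 (eventually_ge_atTop M |>.mono fun N hN =>
    integral_chaos_sq_mul_mono hg hm hb h0 hN hd)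
  have h4 : ∫ x, ψ x ^ 2 ∂conf ≤ a := by
    refine integral_mono (memLp_of_bdd hm hb 2).integrable_sq
      (integrable_mul_of_bdd (memLp_chaos hg M).integrable_sq hm hb) fun x => ?_
    simp only [sq (ψ x)]
    exact mul_le_mul_of_nonneg_right (min_le_left _ _) (h0 x)
  have h5 : a ≤ √K * √a := (h3.trans (le_abs_self _)).trans
    (h2.trans (mul_le_mul_of_nonneg_left (Real.sqrt_le_sqrt h4) (Real.sqrt_nonneg _)))
  rcases ha0.eq_or_lt with h | h
  · rw [← h]; exact hK0
  · have h6 : √a * √a ≤ √K * √a := by rwa [Real.mul_self_sqrt ha0]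
    exact (Real.sqrt_le_sqrt_iff hK0).1 (le_of_mul_le_mul_right h6 (Real.sqrt_pos.2 h))

/-- The fourth moment of a multiple sum is controlled by the kernels `G_k`. -/
theorem integral_chaos_pow_four_le (hg : Kern g)
    (hG : ∀ k, MemLp (kernelG p k g) 2 (halfPow k)) (M : ℕ) :
    Integrable (fun x => chaos g M x ^ 4) conf ∧ ∫ x, chaos g M x ^ 4 ∂conf ≤
      ∑ k ∈ Finset.range (2 * p + 1), (k ! : ℝ) * normSq (kernelG p k g) := by
  set K := ∑ k ∈ Finset.range (2 * p + 1), (k ! : ℝ) * normSq (kernelG p k g) with hK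
  have hK0 : 0 ≤ K := Finset.sum_nonneg fun k _ =>
    mul_nonneg (by positivity) (integral_nonneg fun _ => sq_nonneg _)
  have hmc := measurable_chaos hg.meas M
  -- Fatou's lemma as the truncation level tends to infinity.
  have h1 : ∫⁻ x, ENNReal.ofReal (chaos g M x ^ 4) ∂conf ≤ ENNReal.ofReal K := by
    have hlim : ∀ x, Tendsto (fun n : ℕ => ENNReal.ofReal
        (chaos g M x ^ 2 * min (chaos g M x ^ 2) n)) atTop
        (𝓝 (ENNReal.ofReal (chaos g M x ^ 4))) := fun x => by
      refine tendsto_const_nhds.congr' ?_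
      obtain ⟨n, hn⟩ := exists_nat_ge (chaos g M x ^ 2)
      filter_upwards [eventually_ge_atTop n] with m hm
      rw [min_eq_left (hn.trans (by exact_mod_cast hm))]
      congr 1; ring
    calc ∫⁻ x, ENNReal.ofReal (chaos g M x ^ 4) ∂conf
        = ∫⁻ x, liminf (fun n : ℕ => ENNReal.ofReal
          (chaos g M x ^ 2 * min (chaos g M x ^ 2) n)) atTop ∂conf :=
          lintegral_congr fun x => (hlim x).liminf_eq.symm
      _ ≤ liminf (fun n : ℕ => ∫⁻ x, ENNReal.ofReal
          (chaos g M x ^ 2 * min (chaos g M x ^ 2) n) ∂conf) atTop :=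
          lintegral_liminf_le fun n => by fun_prop
      _ ≤ ENNReal.ofReal K := by
          refine liminf_le_of_le (by isBoundedDefault) fun b hb => ?_
          obtain ⟨n, hn⟩ := hb.exists
          refine hn.trans ?_
          rw [← ofReal_integral_eq_lintegral_ofReal]
          · exact ENNReal.ofReal_le_ofReal
              (integral_chaos_sq_mul_min_le hg hG M (Nat.cast_nonneg n))
          · refine integrable_mul_of_bdd (memLp_chaos hg M).integrable_sq
              (by fun_prop) ⟨n, fun x => ?_⟩
            rw [abs_of_nonneg (le_min (sq_nonneg _) (Nat.cast_nonneg n))]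
            exact min_le_right _ _
          · exact ae_of_all _ fun x =>
              mul_nonneg (sq_nonneg _) (le_min (sq_nonneg _) (Nat.cast_nonneg n))
  have h2 : ∀ᵐ x ∂conf, 0 ≤ chaos g M x ^ 4 := ae_of_all _ fun x => by positivity
  have hi : Integrable (fun x => chaos g M x ^ 4) conf := by
    refine ⟨(hmc.pow_const 4).aestronglyMeasurable, ?_⟩
    rw [hasFiniteIntegral_iff_ofReal h2]
    exact h1.trans_lt ENNReal.ofReal_lt_top
  refine ⟨hi, ?_⟩
  rw [← ofReal_integral_eq_lintegral_ofReal hi h2] at h1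
  exact (ENNReal.ofReal_le_ofReal_iff hK0).1 h1

end UniformChaos

namespace UniformChaos

/-! ### Stein's method for multiple sums -/

/-- Cauchy's mean value theorem compares the remainder with `(v - a)²`; the ratio of derivatives is
at most one because `g1` is Lipschitz with constant `2`. -/
lemma abs_taylor_remainder_le {g g1 g2 : ℝ → ℝ} (h1 : ∀ x, HasDerivAt g (g1 x) x)
    (h2 : ∀ x, HasDerivAt g1 (g2 x) x) (hb : ∀ x, |g2 x| ≤ 2) (a u : ℝ) :
    |g u - g a - (u - a) * g1 a| ≤ (u - a) ^ 2 := by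
  have hlip : ∀ c, |g1 c - g1 a| ≤ 2 * |c - a| := fun c => by
    have := Convex.norm_image_sub_le_of_norm_hasDerivWithin_le (f := g1) (f' := g2) (C := 2)
      (s := Set.univ) (fun x _ => (h2 x).hasDerivWithinAt) (fun x _ => hb x) convex_univ
      (Set.mem_univ a) (Set.mem_univ c)
    exact this
  have hD : ∀ x, HasDerivAt (fun v => g v - g a - (v - a) * g1 a) (g1 x - g1 a) x := fun x => by
    refine (((h1 x).sub_const (g a)).sub
      (((hasDerivAt_id x).sub_const a).mul_const (g1 a))).congr_deriv (by simp)
  have hq : ∀ x, HasDerivAt (fun v => (v - a) ^ 2) (2 * (x - a)) x := fun x => by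
    exact (((hasDerivAt_id x).sub_const a).pow 2).congr_deriv (by simp)
  have key : ∀ c, c ≠ a → (u - a) ^ 2 * (g1 c - g1 a) = (g u - g a - (u - a) * g1 a) * (2 * (c - a)) →
      |g u - g a - (u - a) * g1 a| ≤ (u - a) ^ 2 := fun c hc h => by
    have hpos : 0 < 2 * |c - a| := by have := abs_pos.2 (sub_ne_zero.2 hc); positivity
    have h' := congrArg abs h
    rw [abs_mul, abs_mul, abs_mul, abs_two, abs_of_nonneg (sq_nonneg (u - a))] at h'
    refine le_of_mul_le_mul_right ?_ hpos
    rw [← h']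
    exact mul_le_mul_of_nonneg_left (hlip c) (sq_nonneg _)
  rcases lt_trichotomy a u with h | h | h
  · obtain ⟨c, hc, he⟩ := exists_ratio_hasDerivAt_eq_ratio_slope (fun v => g v - g a - (v - a) * g1 a)
      (fun x => g1 x - g1 a) h (fun x _ => (hD x).continuousAt.continuousWithinAt)
      (fun x _ => hD x) (fun v => (v - a) ^ 2) (fun x => 2 * (x - a))
      (fun x _ => (hq x).continuousAt.continuousWithinAt) (fun x _ => hq x)
    exact key c hc.1.ne' (by simpa using he)
  · subst h; simp
  · obtain ⟨c, hc, he⟩ := exists_ratio_hasDerivAt_eq_ratio_slope (fun v => g v - g a - (v - a) * g1 a)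
      (fun x => g1 x - g1 a) h (fun x _ => (hD x).continuousAt.continuousWithinAt)
      (fun x _ => hD x) (fun v => (v - a) ^ 2) (fun x => 2 * (x - a))
      (fun x _ => (hq x).continuousAt.continuousWithinAt) (fun x _ => hq x)
    refine key c hc.2.ne ?_
    simp only [sub_self] at he
    linarith

/-- The conditional variance in the `k`-th coordinate of a degenerate function. -/
noncomputable def coordVar (k : ℕ) (Y : (ℕ → ℝ) → ℝ) (x : ℕ → ℝ) : ℝ :=
  ∫ s, Y (Function.update x k s) ^ 2 ∂blockMeas k

lemma integrable_coordVar {Y : (ℕ → ℝ) → ℝ} (hY : MemLp Y 2 conf) (k : ℕ) :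
    Integrable (coordVar k Y) conf :=
  (integrable_resample hY.integrable_sq k).integral_prod_left

/-- The difference of the two sides is `(a + 2b)(a - b)² / 3`. -/
lemma abs_cube_young {a b : ℝ} (ha : 0 ≤ a) (hb : 0 ≤ b) :
    a * b ^ 2 ≤ (a ^ 3 + 2 * b ^ 3) / 3 := by
  nlinarith [mul_nonneg (add_nonneg ha (mul_nonneg zero_le_two hb)) (sq_nonneg (a - b))]

/-- One-coordinate Taylor expansion of the exchange of `Y` and its resampled copy. -/
lemma abs_integral_mul_sub_coordVar_le {W Y : (ℕ → ℝ) → ℝ} {k : ℕ} (hW : Measurable W)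
    (hWu : ∀ x s, W (Function.update x k s) = W x) (hY : Measurable Y) (hY3 : MemLp Y 3 conf)
    (hd : Degen Y k) {g g1 g2 : ℝ → ℝ} (h1 : ∀ x, HasDerivAt g (g1 x) x)
    (h2 : ∀ x, HasDerivAt g1 (g2 x) x) (b0 : ∀ x, |g x| ≤ 1) (b1 : ∀ x, |g1 x| ≤ 1)
    (b2 : ∀ x, |g2 x| ≤ 2) :
    |∫ x, Y x * g (W x + Y x) ∂conf - ∫ x, coordVar k Y x * g1 (W x + Y x) ∂conf|
      ≤ 2 * ∫ x, |Y x| ^ 3 ∂conf := by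
  have hg : Measurable g := (continuous_iff_continuousAt.2 fun x => (h1 x).continuousAt).measurable
  have hg1 : Measurable g1 := (continuous_iff_continuousAt.2 fun x => (h2 x).continuousAt).measurable
  have hup := measurePreserving_update k
  have hupm := hup.measurable
  set ν := conf.prod (blockMeas k)
  -- `A` is `Y` with its `k`-th coordinate resampled and `B` is `Y` itself; `W` is common to both,
  -- so the pair is exchangeable given the other coordinates.
  let A : (ℕ → ℝ) × ℝ → ℝ := fun q => Y (Function.update q.1 k q.2)
  let B : (ℕ → ℝ) × ℝ → ℝ := fun q => Y q.1
  have hA3 : MemLp A 3 ν := hY3.comp_measurePreserving hup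
  have hB3 : MemLp B 3 ν := hY3.comp_measurePreserving measurePreserving_fst
  have hA2 : MemLp A 2 ν := hA3.mono_exponent (by norm_num)
  have hB2 : MemLp B 2 ν := hB3.mono_exponent (by norm_num)
  have hAi : Integrable A ν := hA2.integrable (by norm_num)
  have hBi : Integrable B ν := hB2.integrable (by norm_num)
  have hAm : Measurable A := hY.comp hupm
  have hBm : Measurable B := hY.comp measurable_fst
  have cube : ∀ {u : (ℕ → ℝ) × ℝ → ℝ}, MemLp u 3 ν → Integrable (fun q => |u q| ^ 3) ν := by
    intro u hu
    have := hu.integrable_norm_rpow (by norm_num) (by norm_num)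
    refine this.congr (ae_of_all _ fun q => ?_)
    simp only [ENNReal.toReal_ofNat, Real.norm_eq_abs]
    exact_mod_cast Real.rpow_natCast |u q| 3
  have iA3 := cube hA3
  have iB3 := cube hB3
  have hWm : Measurable fun q : (ℕ → ℝ) × ℝ => W q.1 := hW.comp measurable_fst
  have hgA : Measurable fun q => g (W q.1 + A q) := hg.comp (hWm.add hAm)
  have hgB : Measurable fun q => g (W q.1 + B q) := hg.comp (hWm.add hBm)
  have hg1B : Measurable fun q => g1 (W q.1 + B q) := hg1.comp (hWm.add hBm)
  have i1 : Integrable (fun q => A q * g (W q.1 + A q)) ν :=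
    integrable_mul_of_bdd hAi hgA ⟨1, fun q => b0 _⟩
  have i2 : Integrable (fun q => A q * g (W q.1 + B q)) ν :=
    integrable_mul_of_bdd hAi hgB ⟨1, fun q => b0 _⟩
  have i3 : Integrable (fun q => A q ^ 2 * g1 (W q.1 + B q)) ν :=
    integrable_mul_of_bdd hA2.integrable_sq hg1B ⟨1, fun q => b1 _⟩
  have hAB : Integrable (fun q => A q * B q) ν := MemLp.integrable_mul hA2 hB2
  have i4 : Integrable (fun q => A q * B q * g1 (W q.1 + B q)) ν :=
    integrable_mul_of_bdd hAB hg1B ⟨1, fun q => b1 _⟩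
  have e1 : ∫ x, Y x * g (W x + Y x) ∂conf = ∫ q, A q * g (W q.1 + A q) ∂ν := by
    have hm : Measurable fun x => Y x * g (W x + Y x) := hY.mul (hg.comp (hW.add hY))
    conv_lhs => rw [← hup.map_eq]
    rw [integral_map hupm.aemeasurable hm.aestronglyMeasurable]
    simp only [hWu, A, ν]
  -- Given `x`, the argument of `g` is fixed and the resampled copy is centred. The same reason
  -- removes the mixed term `e4`, so the first order of the Taylor expansion leaves just the
  -- conditional variance.
  have e2 : ∫ q, A q * g (W q.1 + B q) ∂ν = 0 := by
    rw [integral_prod _ i2]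
    refine integral_eq_zero_of_ae ?_
    filter_upwards [hd] with x hx
    simp only [A, B, integral_mul_const, hx, zero_mul, Pi.zero_apply]
  have e3 : ∫ q, A q ^ 2 * g1 (W q.1 + B q) ∂ν = ∫ x, coordVar k Y x * g1 (W x + Y x) ∂conf := by
    rw [integral_prod _ i3]
    simp only [A, B, integral_mul_const, coordVar]
  have e4 : ∫ q, A q * B q * g1 (W q.1 + B q) ∂ν = 0 := by
    rw [integral_prod _ i4]
    refine integral_eq_zero_of_ae ?_
    filter_upwards [hd] with x hx
    simp only [A, B, integral_mul_const, hx, zero_mul, Pi.zero_apply]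
  have hsq : ∀ q, |A q| ^ 3 = |A q| * A q ^ 2 := fun q => by rw [pow_succ' _ 2, sq_abs]
  have hyoung : ∀ q, |A q| * B q ^ 2 ≤ (|A q| ^ 3 + 2 * |B q| ^ 3) / 3 := fun q => by
    have := abs_cube_young (abs_nonneg (A q)) (abs_nonneg (B q))
    rwa [sq_abs] at this
  have i5 : Integrable (fun q => |A q| * B q ^ 2) ν := by
    refine ((iA3.add (iB3.const_mul 2)).div_const 3).mono'
      (hAm.abs.mul (hBm.pow_const 2)).aestronglyMeasurable (ae_of_all _ fun q => ?_)
    rw [Real.norm_of_nonneg (mul_nonneg (abs_nonneg _) (sq_nonneg _))]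
    exact hyoung q
  have i6 : Integrable (fun q => |A q| * A q * B q) ν := by
    refine ((iB3.add (iA3.const_mul 2)).div_const 3).mono'
      ((hAm.abs.mul hAm).mul hBm).aestronglyMeasurable (ae_of_all _ fun q => ?_)
    have := abs_cube_young (abs_nonneg (B q)) (abs_nonneg (A q))
    rw [Real.norm_eq_abs, abs_mul, abs_mul, abs_abs]
    refine le_trans (le_of_eq ?_) this
    ring
  -- In the bound `|A| (A - B)²` for the remainder the mixed term vanishes, as `B` is degenerate in
  -- coordinate `k` and `|A| A` averaged over the resampling does not involve it. Two terms of size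
  -- at most `E|Y|³` remain, whence the constant `2`.
  have e6 : ∫ q, |A q| * A q * B q ∂ν = 0 := by
    rw [integral_prod _ i6]
    have := integral_mul_eq_zero_of_degen (v := Y) (k := k)
      (u := fun x => ∫ s, |Y (Function.update x k s)| * Y (Function.update x k s) ∂blockMeas k)
      (fun x s => by simp) hd
    rw [← this]
    refine integral_congr_ae (ae_of_all _ fun x => ?_)
    simp only [A, B, integral_mul_const]
  have eA : ∫ q, |A q| ^ 3 ∂ν = ∫ x, |Y x| ^ 3 ∂conf := by
    conv_rhs => rw [← hup.map_eq]
    rw [integral_map hupm.aemeasurable (hY.abs.pow_const 3).aestronglyMeasurable]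
  have eB : ∫ q, |B q| ^ 3 ∂ν = ∫ x, |Y x| ^ 3 ∂conf := by
    rw [integral_prod _ iB3]
    simp [B]
  have e5 : ∫ q, |A q| * B q ^ 2 ∂ν ≤ ∫ x, |Y x| ^ 3 ∂conf := by
    refine (integral_mono i5 ((iA3.add (iB3.const_mul 2)).div_const 3) hyoung).trans (le_of_eq ?_)
    simp only [Pi.add_apply]
    rw [integral_div, integral_add iA3 (iB3.const_mul 2), integral_const_mul, eA, eB]
    ring
  have e7 : ∫ x, Y x * g (W x + Y x) ∂conf - ∫ x, coordVar k Y x * g1 (W x + Y x) ∂conf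
      = ∫ q, (A q * g (W q.1 + A q) - A q * g (W q.1 + B q) -
        (A q ^ 2 * g1 (W q.1 + B q) - A q * B q * g1 (W q.1 + B q))) ∂ν := by
    have i12 : Integrable (fun q => A q * g (W q.1 + A q) - A q * g (W q.1 + B q)) ν := i1.sub i2
    have i34 : Integrable (fun q => A q ^ 2 * g1 (W q.1 + B q) - A q * B q * g1 (W q.1 + B q)) ν :=
      i3.sub i4
    rw [integral_sub i12 i34, integral_sub i1 i2, integral_sub i3 i4, e1, e2, e3, e4]
    ring
  rw [e7]
  refine (abs_integral_le_integral_abs).trans ?_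
  have i7 : Integrable (fun q => |A q| ^ 3 - 2 * (|A q| * A q * B q) + |A q| * B q ^ 2) ν :=
    (iA3.sub (i6.const_mul 2)).add i5
  have hle : ∀ q, |A q * g (W q.1 + A q) - A q * g (W q.1 + B q) -
        (A q ^ 2 * g1 (W q.1 + B q) - A q * B q * g1 (W q.1 + B q))|
      ≤ |A q| ^ 3 - 2 * (|A q| * A q * B q) + |A q| * B q ^ 2 := fun q => by
    have := abs_taylor_remainder_le h1 h2 b2 (W q.1 + B q) (W q.1 + A q)
    have e : A q * g (W q.1 + A q) - A q * g (W q.1 + B q) -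
        (A q ^ 2 * g1 (W q.1 + B q) - A q * B q * g1 (W q.1 + B q))
        = A q * (g (W q.1 + A q) - g (W q.1 + B q) -
          (W q.1 + A q - (W q.1 + B q)) * g1 (W q.1 + B q)) := by ring
    rw [e, abs_mul, hsq]
    refine (mul_le_mul_of_nonneg_left this (abs_nonneg _)).trans (le_of_eq (by ring))
  have i8 := ((i1.sub i2).sub (i3.sub i4)).abs
  refine (integral_mono i8 i7 hle).trans ?_
  have i9 : Integrable (fun q => |A q| ^ 3 - 2 * (|A q| * A q * B q)) ν := iA3.sub (i6.const_mul 2)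
  rw [integral_add i9 i5, integral_sub iA3 (i6.const_mul 2), integral_const_mul, e6, eA]
  linarith

/-! ### The parts of a multiple sum containing a given index -/

variable {p : ℕ} {g : (Fin p → ℝ) → ℝ}

/-- The terms of a multiple sum that contain the index `k`. -/
noncomputable def part (g : (Fin p → ℝ) → ℝ) (N k : ℕ) (x : ℕ → ℝ) : ℝ :=
  (p ! : ℝ) * ∑ B ∈ (Finset.powersetCard p (Finset.range N)).filter (k ∈ ·), setEval g B x

lemma measurable_part (hg : Measurable g) (N k : ℕ) : Measurable (part g N k) :=
  (Finset.measurable_sum _ fun B _ => measurable_setEval hg B).const_mul _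

lemma memLp_part (hg : Kern g) (N k : ℕ) : MemLp (part g N k) 2 conf :=
  (memLp_finsetSum _ fun B _ => memLp_setEval hg B).const_mul _

lemma chaos_sub_part (g : (Fin p → ℝ) → ℝ) (N k : ℕ) (x : ℕ → ℝ) :
    chaos g N x - part g N k x = (p ! : ℝ) *
      ∑ B ∈ (Finset.powersetCard p (Finset.range N)).filter (k ∉ ·), setEval g B x := by
  unfold chaos part
  rw [← Finset.sum_filter_add_sum_filter_not (Finset.powersetCard p (Finset.range N)) (k ∈ ·)]
  ring

lemma chaos_sub_part_update (g : (Fin p → ℝ) → ℝ) (N k : ℕ) (x : ℕ → ℝ) (s : ℝ) :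
    chaos g N (Function.update x k s) - part g N k (Function.update x k s)
      = chaos g N x - part g N k x := by
  rw [chaos_sub_part, chaos_sub_part]
  congr 1
  exact Finset.sum_congr rfl fun B hB => setEval_update g (Finset.mem_filter.1 hB).2 x s

/-- Each index set is counted once for each of its `p` elements. -/
lemma sum_part (g : (Fin p → ℝ) → ℝ) (N : ℕ) (x : ℕ → ℝ) :
    ∑ k ∈ Finset.range N, part g N k x = p * chaos g N x := by
  unfold part chaos
  rw [← Finset.mul_sum, mul_left_comm]
  congr 1
  simp_rw [Finset.sum_filter]
  rw [Finset.sum_comm, Finset.mul_sum]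
  refine Finset.sum_congr rfl fun B hB => ?_
  obtain ⟨h1, h2⟩ := Finset.mem_powersetCard.1 hB
  rw [← Finset.sum_filter, Finset.sum_const, nsmul_eq_mul]
  congr 2
  rw [← h2]
  congr 1
  ext i
  simp only [Finset.mem_filter]
  exact ⟨fun h => h.2, fun h => ⟨h1 h, h⟩⟩

lemma degen_part (hg : Kern g) (N k : ℕ) : Degen (part g N k) k := by
  have h1 : ∀ᵐ x ∂conf, ∀ B : Finset ℕ,
      Integrable (fun s => setEval g B (Function.update x k s)) (blockMeas k) :=
    ae_all_iff.2 fun B => (integrable_resample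
      ((memLp_setEval hg B).integrable (by norm_num)) k).prod_right_ae
  have h2 : ∀ᵐ x ∂conf, ∀ B : Finset ℕ, k ∈ B →
      ∫ s, setEval g B (Function.update x k s) ∂blockMeas k = 0 :=
    ae_all_iff.2 fun B => by
      by_cases hB : k ∈ B
      · filter_upwards [hg.degen B k hB] with x hx _ using hx
      · exact ae_of_all _ fun x h => absurd h hB
  filter_upwards [h1, h2] with x hx1 hx2
  simp only [part]
  rw [integral_const_mul, integral_finsetSum _ fun B _ => hx1 B, Finset.sum_eq_zero, mul_zero]
  exact fun B hB => hx2 B (Finset.mem_filter.1 hB).2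

/-- The normalised sum of the conditional variances of a multiple sum. -/
noncomputable def gam (g : (Fin p → ℝ) → ℝ) (N : ℕ) (x : ℕ → ℝ) : ℝ :=
  (p : ℝ)⁻¹ * ∑ k ∈ Finset.range N, coordVar k (part g N k) x

lemma integrable_gam (hg : Kern g) (N : ℕ) : Integrable (gam g N) conf :=
  (integrable_finsetSum _ fun k _ => integrable_coordVar (memLp_part hg N k) k).const_mul _

/-- Stein's bound for a multiple sum. -/
theorem abs_integral_chaos_sub_gaussian_le (hp : p ≠ 0) (hg : Kern g) (N : ℕ)
    (h3 : ∀ k < N, MemLp (part g N k) 3 conf) {h : ℝ → ℝ} (hh : LipschitzWith 1 h) :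
    |∫ x, h (chaos g N x) ∂conf - ∫ x, h x ∂gaussianReal 0 1| ≤
      ∫ x, |1 - gam g N x| ∂conf +
        2 * (p : ℝ)⁻¹ * ∑ k ∈ Finset.range N, ∫ x, |part g N k x| ^ 3 ∂conf := by
  have hp' : (p : ℝ) ≠ 0 := by exact_mod_cast hp
  have hF := measurable_chaos hg.meas N
  have hFi : Integrable (chaos g N) conf := (memLp_chaos hg N).integrable (by norm_num)
  have : IsProbabilityMeasure (conf.map (chaos g N)) :=
    Measure.isProbabilityMeasure_map hF.aemeasurable
  have hid : Integrable id (conf.map (chaos g N)) :=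
    (integrable_map_measure measurable_id.aestronglyMeasurable hF.aemeasurable).2 hFi
  rw [← integral_map hF.aemeasurable hh.continuous.measurable.aestronglyMeasurable]
  refine abs_integral_sub_gaussian_le_of_stein hid (fun g0 g1 g2 h1 h2 b0 b1 b2 => ?_) hh
  have hm0 : Measurable g0 := (continuous_iff_continuousAt.2 fun x => (h1 x).continuousAt).measurable
  have hm1 : Measurable g1 := (continuous_iff_continuousAt.2 fun x => (h2 x).continuousAt).measurable
  have hm : Measurable fun x => g1 x - x * g0 x := hm1.sub (measurable_id.mul hm0)
  rw [integral_map hF.aemeasurable hm.aestronglyMeasurable]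
  have hmF0 : Measurable fun x => g0 (chaos g N x) := hm0.comp hF
  have hmF1 : Measurable fun x => g1 (chaos g N x) := hm1.comp hF
  have iF : Integrable (fun x => chaos g N x * g0 (chaos g N x)) conf :=
    integrable_mul_of_bdd hFi hmF0 ⟨1, fun x => b0 _⟩
  have iG : Integrable (fun x => gam g N x * g1 (chaos g N x)) conf :=
    integrable_mul_of_bdd (integrable_gam hg N) hmF1 ⟨1, fun x => b1 _⟩
  have i1 : Integrable (fun x => g1 (chaos g N x)) conf :=
    integrable_of_bdd hmF1 (C := 1) fun x => b1 _
  have ek : ∀ k ∈ Finset.range N, |∫ x, part g N k x * g0 (chaos g N x) ∂conf -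
      ∫ x, coordVar k (part g N k) x * g1 (chaos g N x) ∂conf|
      ≤ 2 * ∫ x, |part g N k x| ^ 3 ∂conf := fun k hk => by
    have := abs_integral_mul_sub_coordVar_le (k := k) (W := fun x => chaos g N x - part g N k x)
      (hF.sub (measurable_part hg.meas N k)) (chaos_sub_part_update g N k)
      (measurable_part hg.meas N k) (h3 k (Finset.mem_range.1 hk)) (degen_part hg N k)
      h1 h2 b0 b1 b2
    simpa only [sub_add_cancel] using this
  have e1 : ∫ x, chaos g N x * g0 (chaos g N x) ∂conf
      = (p : ℝ)⁻¹ * ∑ k ∈ Finset.range N, ∫ x, part g N k x * g0 (chaos g N x) ∂conf := by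
    rw [← integral_finsetSum, ← integral_const_mul]
    · refine integral_congr_ae (ae_of_all _ fun x => ?_)
      simp only
      rw [← Finset.sum_mul, sum_part]
      field_simp
    · exact fun k _ => integrable_mul_of_bdd ((memLp_part hg N k).integrable (by norm_num)) hmF0
        ⟨1, fun x => b0 _⟩
  have e2 : ∫ x, gam g N x * g1 (chaos g N x) ∂conf
      = (p : ℝ)⁻¹ * ∑ k ∈ Finset.range N, ∫ x, coordVar k (part g N k) x * g1 (chaos g N x) ∂conf := by
    rw [← integral_finsetSum, ← integral_const_mul]
    · refine integral_congr_ae (ae_of_all _ fun x => ?_)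
      simp only [gam]
      rw [← Finset.sum_mul, mul_assoc]
    · exact fun k _ => integrable_mul_of_bdd (integrable_coordVar (memLp_part hg N k) k) hmF1
        ⟨1, fun x => b1 _⟩
  -- Write `chaos` as `1/p` times the sum of its parts and replace each part by its conditional
  -- variance; the error is the sum estimated in `ek`.
  have e3 : ∫ x, (g1 (chaos g N x) - chaos g N x * g0 (chaos g N x)) ∂conf
      = ∫ x, (1 - gam g N x) * g1 (chaos g N x) ∂conf -
        (p : ℝ)⁻¹ * ∑ k ∈ Finset.range N, (∫ x, part g N k x * g0 (chaos g N x) ∂conf -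
          ∫ x, coordVar k (part g N k) x * g1 (chaos g N x) ∂conf) := by
    rw [Finset.sum_sub_distrib, mul_sub, ← e1, ← e2, integral_sub i1 iF]
    simp_rw [sub_mul, one_mul]
    rw [integral_sub i1 iG]
    ring
  rw [e3]
  refine (abs_sub _ _).trans (add_le_add ?_ ?_)
  · refine (abs_integral_le_integral_abs).trans (integral_mono_of_nonneg
      (ae_of_all _ fun x => abs_nonneg _) ((integrable_const 1).sub (integrable_gam hg N)).abs
      (ae_of_all _ fun x => ?_))
    simp only [abs_mul]
    exact mul_le_of_le_one_right (abs_nonneg _) (b1 _)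
  · rw [abs_mul, abs_of_nonneg (by positivity : (0 : ℝ) ≤ (p : ℝ)⁻¹), mul_comm 2, mul_assoc,
      Finset.mul_sum (a := (2 : ℝ))]
    refine mul_le_mul_of_nonneg_left ?_ (by positivity)
    exact (Finset.abs_sum_le_sum_abs _ _).trans (Finset.sum_le_sum ek)

end UniformChaos

namespace UniformChaos

/-! ### Slices of a kernel -/

variable {m : ℕ} {f : (Fin (m + 1) → ℝ) → ℝ}

lemma measurable_fin_cons : Measurable fun q : ℝ × (Fin m → ℝ) =>
    (Fin.cons q.1 q.2 : Fin (m + 1) → ℝ) := by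
  refine measurable_pi_iff.2 fun i => ?_
  refine Fin.cases ?_ (fun j => ?_) i
  · simpa using measurable_fst
  · simp only [Fin.cons_succ]
    exact (measurable_pi_apply j).comp measurable_snd

lemma measurePreserving_fin_cons (m : ℕ) :
    MeasurePreserving (fun q : ℝ × (Fin m → ℝ) => (Fin.cons q.1 q.2 : Fin (m + 1) → ℝ))
      (halfLeb.prod (halfPow m)) (halfPow (m + 1)) := by
  have h := (measurePreserving_piFinSuccAbove (fun _ : Fin (m + 1) => halfLeb) 0).symm
  have e : (fun q : ℝ × (Fin m → ℝ) => (Fin.cons q.1 q.2 : Fin (m + 1) → ℝ))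
      = (MeasurableEquiv.piFinSuccAbove (fun _ : Fin (m + 1) => ℝ) 0).symm := by
    funext q
    simp [MeasurableEquiv.piFinSuccAbove]
    rfl
  rw [e]
  exact h

lemma measurable_uncurry_sliceAt (hf : Measurable f) :
    Measurable (Function.uncurry (sliceAt f)) := hf.comp measurable_fin_cons

lemma measurable_sliceAt (hf : Measurable f) (t : ℝ) : Measurable (sliceAt f t) :=
  (measurable_uncurry_sliceAt hf).comp measurable_prodMk_left

lemma symmFun_sliceAt (hf : SymmFun f) (t : ℝ) : SymmFun (sliceAt f t) := by
  intro σ y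
  unfold sliceAt
  rw [← hf (Equiv.Perm.decomposeFin.symm (0, σ)) (Fin.cons t y)]
  congr 1
  funext i
  refine Fin.cases ?_ (fun j => ?_) i
  · simp
  · simp

lemma image_fin_cons {k : ℕ} {B : Finset ℕ} {e : Fin m → ℕ} (h : Finset.univ.image e = B) :
    Finset.univ.image (Fin.cons k e : Fin (m + 1) → ℕ) = insert k B := by
  ext i
  simp only [Finset.mem_image, Finset.mem_univ, true_and, Fin.exists_fin_succ, Fin.cons_zero,
    Fin.cons_succ, Finset.mem_insert, ← h, eq_comm]

/-- The slices of a symmetric function evaluated at a set of coordinates. -/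
lemma setEval_sliceAt (hf : SymmFun f) {k : ℕ} {B : Finset ℕ} (hk : k ∉ B) (s : ℝ) (x : ℕ → ℝ) :
    setEval (sliceAt f s) B x = setEval f (insert k B) (Function.update x k s) := by
  by_cases hB : B.card = m
  · obtain ⟨e, he, him⟩ := exists_enum hB
    have hke : k ∉ Set.range e := fun ⟨i, hi⟩ => hk (by
      rw [← him, ← hi]; exact Finset.mem_image_of_mem _ (Finset.mem_univ i))
    rw [setEval_eq (symmFun_sliceAt hf s) he him,
      setEval_eq hf (Fin.cons_injective_iff.2 ⟨hke, he⟩) (image_fin_cons him)]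
    unfold sliceAt
    congr 1
    funext i
    refine Fin.cases ?_ (fun j => ?_) i
    · simp
    · simp only [Fin.cons_succ, Function.comp_apply]
      rw [Function.update_of_ne]
      rintro rfl
      exact hke ⟨j, rfl⟩
  · rw [setEval_of_card_ne hB, setEval_of_card_ne]
    rw [Finset.card_insert_of_notMem hk]
    omega

/-- The vanishing property of kernels. -/
def VanishOnRepeated {p : ℕ} (g : (Fin p → ℝ) → ℝ) : Prop :=
  ∀ (e : Fin p → ℕ) (x : Fin p → ℝ), (∀ i, x i ∈ block (e i)) → ¬ Function.Injective e → g x = 0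

lemma setEval_sliceAt_eq_zero (hs : SymmFun f) (hf : VanishOnRepeated f) {k : ℕ} {B : Finset ℕ}
    (hk : k ∈ B) {s : ℝ} (hsk : s ∈ block k) {x : ℕ → ℝ} (hx : ∀ i, x i ∈ block i) :
    setEval (sliceAt f s) B x = 0 := by
  by_cases hB : B.card = m
  · obtain ⟨e, he, him⟩ := exists_enum hB
    rw [setEval_eq (symmFun_sliceAt hs s) he him]
    have hke : k ∈ Set.range e := by
      rw [← him] at hk
      obtain ⟨i, -, hi⟩ := Finset.mem_image.1 hk
      exact ⟨i, hi⟩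
    refine hf (Fin.cons k e) _ (fun i => ?_) fun hi => (Fin.cons_injective_iff.1 hi).1 hke
    refine Fin.cases ?_ (fun j => ?_) i
    · simpa using hsk
    · simpa using hx (e j)
  · exact setEval_of_card_ne hB x

/-- Index sets containing `k` are the sets `insert k B` with `k ∉ B`. In the sum of the slice, sets
`B` that contain `k` contribute nothing, since the slice variable already occupies block `k`. The
factor is `(m + 1)! / m!`. -/
lemma part_update_eq (hs : SymmFun f) (hf : VanishOnRepeated f) {N k : ℕ} (hk : k < N) {s : ℝ}
    (hsk : s ∈ block k) {x : ℕ → ℝ} (hx : ∀ i, x i ∈ block i) :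
    part f N k (Function.update x k s) = ((m + 1 : ℕ) : ℝ) * chaos (sliceAt f s) N x := by
  unfold part chaos
  rw [Nat.factorial_succ, Nat.cast_mul, mul_assoc]
  congr 2
  rw [← Finset.sum_filter_add_sum_filter_not (Finset.powersetCard m (Finset.range N)) (k ∉ ·)]
  have h0 : ∑ B ∈ (Finset.powersetCard m (Finset.range N)).filter (¬ k ∉ ·),
      setEval (sliceAt f s) B x = 0 := Finset.sum_eq_zero fun B hB =>
    setEval_sliceAt_eq_zero hs hf (not_not.1 (Finset.mem_filter.1 hB).2) hsk hx
  rw [h0, add_zero]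
  symm
  refine Finset.sum_bij (fun B _ => insert k B) (fun B hB => ?_) (fun B hB C hC h => ?_)
    (fun C hC => ?_) fun B hB => setEval_sliceAt hs (Finset.mem_filter.1 hB).2 s x
  · obtain ⟨h1, h2⟩ := Finset.mem_filter.1 hB
    obtain ⟨h3, h4⟩ := Finset.mem_powersetCard.1 h1
    refine Finset.mem_filter.2 ⟨Finset.mem_powersetCard.2 ⟨?_, ?_⟩, Finset.mem_insert_self _ _⟩
    · exact Finset.insert_subset (Finset.mem_range.2 hk) h3
    · rw [Finset.card_insert_of_notMem h2, h4]
  · rw [← Finset.erase_insert (Finset.mem_filter.1 hB).2, h,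
      Finset.erase_insert (Finset.mem_filter.1 hC).2]
  · obtain ⟨h1, h2⟩ := Finset.mem_filter.1 hC
    obtain ⟨h3, h4⟩ := Finset.mem_powersetCard.1 h1
    refine ⟨C.erase k, Finset.mem_filter.2 ⟨Finset.mem_powersetCard.2
      ⟨(Finset.erase_subset _ _).trans h3, ?_⟩, Finset.notMem_erase _ _⟩, Finset.insert_erase h2⟩
    rw [Finset.card_erase_of_mem h2, h4]
    rfl

lemma halfLeb_ae_mem_block : ∀ᵐ t ∂halfLeb, ∃ k, t ∈ block k := by
  rw [halfLeb_eq_sum, Measure.ae_sum_iff]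
  exact fun k => (blockMeas_ae_mem k).mono fun t ht => ⟨k, ht⟩

/-- If `k ∈ B` the slice vanishes because block `k` is used twice. If not, it is a term of `f`
itself with coordinate `k` set to `t`, and Fubini passes the degeneracy to almost every `t`. -/
lemma degen_setEval_sliceAt (hf : Kern f) (k : ℕ) {B : Finset ℕ} {b : ℕ} (hb : b ∈ B) :
    ∀ᵐ t ∂blockMeas k, Degen (setEval (sliceAt f t) B) b := by
  by_cases hk : k ∈ B
  · filter_upwards [blockMeas_ae_mem k] with t ht
    filter_upwards [conf_ae_mem] with x hx
    refine integral_eq_zero_of_ae ?_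
    filter_upwards [blockMeas_ae_mem b] with s hs
    refine setEval_sliceAt_eq_zero hf.symm hf.vanish hk ht fun i => ?_
    by_cases hi : i = b
    · subst hi; simpa using hs
    · rw [Function.update_of_ne hi]; exact hx i
  · have hbk : b ≠ k := fun h => hk (h ▸ hb)
    have h1 := (measurePreserving_update k).quasiMeasurePreserving.ae
      (hf.degen (insert k B) b (Finset.mem_insert_of_mem hb))
    have h2 := (Measure.measurePreserving_swap (μ := blockMeas k)
      (ν := conf)).quasiMeasurePreserving.ae h1
    filter_upwards [Measure.ae_ae_of_ae_prod h2] with t ht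
    filter_upwards [ht] with x hx
    simp only [Prod.swap_prod_mk] at hx
    rw [← hx]
    congr 1
    funext s
    rw [setEval_sliceAt hf.symm hk, Function.update_comm hbk]

lemma memLp_uncurry_sliceAt (hf : Kern f) :
    MemLp (fun q : ℝ × (Fin m → ℝ) => sliceAt f q.1 q.2) 2 (halfLeb.prod (halfPow m)) :=
  hf.memLp.comp_measurePreserving (measurePreserving_fin_cons m)

/-- Almost all slices of a degenerate kernel are degenerate kernels. -/
theorem ae_kern_sliceAt (hf : Kern f) : ∀ᵐ t ∂halfLeb, Kern (sliceAt f t) := by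
  have h1 : ∀ᵐ t ∂halfLeb, Integrable (fun y => sliceAt f t y ^ 2) (halfPow m) :=
    (memLp_uncurry_sliceAt hf).integrable_sq.prod_right_ae
  have h2 : ∀ᵐ t ∂halfLeb, ∀ B : Finset ℕ, ∀ b : ℕ, b ∈ B → Degen (setEval (sliceAt f t) B) b := by
    refine ae_all_iff.2 fun B => ae_all_iff.2 fun b => ?_
    by_cases hb : b ∈ B
    · rw [halfLeb_eq_sum, Measure.ae_sum_iff]
      exact fun k => (degen_setEval_sliceAt hf k hb).mono fun t ht _ => ht
    · exact ae_of_all _ fun t h => absurd h hb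
  filter_upwards [h1, h2, halfLeb_ae_mem_block] with t ht1 ht2 ⟨k, hk⟩
  refine ⟨measurable_sliceAt hf.meas t, symmFun_sliceAt hf.symm t, fun e x hx he => ?_,
    (memLp_two_iff_integrable_sq (measurable_sliceAt hf.meas t).aestronglyMeasurable).2 ht1, ht2⟩
  refine hf.vanish (Fin.cons k e) _ (fun i => ?_) fun hi => he (Fin.cons_injective_iff.1 hi).2
  refine Fin.cases ?_ (fun j => ?_) i
  · simpa using hk
  · simpa using hx j

lemma measurable_setEval_sliceAt (hf : Measurable f) (B : Finset ℕ) :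
    Measurable fun q : ℝ × (ℕ → ℝ) => setEval (sliceAt f q.1) B q.2 := by
  unfold setEval
  split_ifs with h
  · have : Measurable fun q : ℝ × (ℕ → ℝ) => (q.1, q.2 ∘ B.orderEmbOfFin h) :=
      measurable_fst.prodMk (measurable_pi_iff.2 fun i =>
        (measurable_pi_apply _).comp measurable_snd)
    exact (measurable_uncurry_sliceAt hf).comp this
  · exact measurable_const

lemma measurable_chaos_sliceAt (hf : Measurable f) (N : ℕ) :
    Measurable fun q : ℝ × (ℕ → ℝ) => chaos (sliceAt f q.1) N q.2 :=
  (Finset.measurable_sum _ fun B _ => measurable_setEval_sliceAt hf B).const_mul _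

/-! ### Third moments -/

lemma lintegral_enorm_sq_eq {X : Type*} [MeasurableSpace X] {μ : Measure X} {u : X → ℝ}
    (hu : MemLp u 2 μ) : ∫⁻ x, ‖u x‖ₑ ^ 2 ∂μ = ENNReal.ofReal (∫ x, u x ^ 2 ∂μ) := by
  rw [ofReal_integral_eq_lintegral_ofReal hu.integrable_sq (ae_of_all _ fun _ => sq_nonneg _)]
  refine lintegral_congr fun x => ?_
  rw [← sq_abs, ENNReal.ofReal_pow (abs_nonneg _), ← Real.norm_eq_abs, ofReal_norm]

lemma eLpNorm_two_sq {X : Type*} [MeasurableSpace X] {μ : Measure X} (u : X → ℝ) :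
    eLpNorm u 2 μ ^ 2 = ∫⁻ x, ‖u x‖ₑ ^ 2 ∂μ := by
  rw [eLpNorm_eq_lintegral_rpow_enorm_toReal (by norm_num) (by norm_num), ← ENNReal.rpow_natCast,
    ← ENNReal.rpow_mul]
  simp

lemma memLp_two_of_lintegral {X : Type*} [MeasurableSpace X] {μ : Measure X} {u : X → ℝ}
    (hu : AEStronglyMeasurable u μ) (h : ∫⁻ x, ‖u x‖ₑ ^ 2 ∂μ ≠ ∞) : MemLp u 2 μ := by
  refine ⟨hu, lt_of_le_of_ne le_top fun htop => h ?_⟩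
  rw [← eLpNorm_two_sq, htop]
  simp

lemma lintegral_mul_le_sqrt {X : Type*} [MeasurableSpace X] {μ : Measure X} {u v : X → ℝ≥0∞}
    (hu : AEMeasurable u μ) (hv : AEMeasurable v μ) :
    ∫⁻ x, u x * v x ∂μ ≤ (∫⁻ x, u x ^ 2 ∂μ) ^ (1 / 2 : ℝ) * (∫⁻ x, v x ^ 2 ∂μ) ^ (1 / 2 : ℝ) := by
  have := ENNReal.lintegral_mul_le_Lp_mul_Lq μ Real.HolderConjugate.two_two hu hv
  simpa using this

/-- The sum of the squared norms of the kernels `G_k`. -/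
noncomputable def kernelMass (p : ℕ) (g : (Fin p → ℝ) → ℝ) : ℝ≥0∞ :=
  ∑ k ∈ Finset.range (2 * p + 1), (k ! : ℝ≥0∞) * ∫⁻ y, ‖kernelG p k g y‖ₑ ^ 2 ∂halfPow k

lemma memLp_kernelG_of_kernelMass {p : ℕ} {g : (Fin p → ℝ) → ℝ} (hg : Measurable g)
    (h : kernelMass p g ≠ ∞) (k : ℕ) : MemLp (kernelG p k g) 2 (halfPow k) := by
  by_cases hk : 2 * p < k
  · rw [kernelG_eq_zero hk]; exact MemLp.zero
  · refine memLp_two_of_lintegral (measurable_kernelG hg).aestronglyMeasurable fun htop => ?_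
    have h1 := ENNReal.sum_ne_top.1 h k (Finset.mem_range.2 (by omega))
    rw [htop, ENNReal.mul_top (by exact_mod_cast (Nat.factorial_pos k).ne')] at h1
    exact h1 rfl

/-- Cauchy–Schwarz between the first and the second power, with the second moment bounded by the
norm of the kernel and the fourth by the kernels `G_k`. -/
lemma lintegral_chaos_cube_le {p : ℕ} {g : (Fin p → ℝ) → ℝ} (hg : Kern g)
    (h : kernelMass p g ≠ ∞) (N : ℕ) :
    ∫⁻ x, ‖chaos g N x‖ₑ ^ 3 ∂conf ≤
      ((p ! : ℝ≥0∞) * ∫⁻ y, ‖g y‖ₑ ^ 2 ∂halfPow p) ^ (1 / 2 : ℝ) * kernelMass p g ^ (1 / 2 : ℝ) := by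
  have hG := memLp_kernelG_of_kernelMass hg.meas h
  have hm := measurable_chaos hg.meas N
  have e : ∀ x, ‖chaos g N x‖ₑ ^ 3 = ‖chaos g N x‖ₑ * ‖chaos g N x‖ₑ ^ 2 := fun x => pow_succ' _ 2
  simp_rw [e]
  refine (lintegral_mul_le_sqrt hm.enorm.aemeasurable (hm.enorm.pow_const 2).aemeasurable).trans ?_
  refine mul_le_mul' (ENNReal.rpow_le_rpow ?_ (by norm_num)) (ENNReal.rpow_le_rpow ?_ (by norm_num))
  · rw [lintegral_enorm_sq_eq (memLp_chaos hg N), lintegral_enorm_sq_eq hg.memLp,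
      ← ENNReal.ofReal_natCast, ← ENNReal.ofReal_mul (by positivity)]
    exact ENNReal.ofReal_le_ofReal (integral_chaos_sq_le hg N)
  · obtain ⟨h1, h2⟩ := integral_chaos_pow_four_le hg hG N
    have e2 : ∫⁻ x, (‖chaos g N x‖ₑ ^ 2) ^ 2 ∂conf = ENNReal.ofReal (∫ x, chaos g N x ^ 4 ∂conf) := by
      rw [ofReal_integral_eq_lintegral_ofReal h1 (ae_of_all _ fun _ => by positivity)]
      refine lintegral_congr fun x => ?_
      rw [← pow_mul, ← Even.pow_abs (by decide : Even 4), ENNReal.ofReal_pow (abs_nonneg _),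
        ← Real.norm_eq_abs, ofReal_norm]
    rw [e2]
    refine (ENNReal.ofReal_le_ofReal h2).trans (le_of_eq ?_)
    rw [ENNReal.ofReal_sum_of_nonneg (f := fun k => (k ! : ℝ) * normSq (kernelG p k g)) fun k _ =>
      mul_nonneg (Nat.cast_nonneg _) (integral_nonneg fun _ => sq_nonneg _)]
    refine Finset.sum_congr rfl fun k _ => ?_
    rw [ENNReal.ofReal_mul (by positivity), ENNReal.ofReal_natCast, lintegral_enorm_sq_eq (hG k)]
    rfl

lemma measurable_kernelMass (hf : Measurable f) :
    Measurable fun t => kernelMass m (sliceAt f t) := by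
  unfold kernelMass
  refine Finset.measurable_sum _ fun k _ => Measurable.const_mul ?_ _
  exact Measurable.lintegral_prod_right' (f := fun q : ℝ × (Fin k → ℝ) =>
    ‖kernelG m k (sliceAt f q.1) q.2‖ₑ ^ 2)
    ((measurable_kernelG_param (measurable_uncurry_sliceAt hf)).enorm.pow_const 2)

lemma lintegral_sliceAt_sq (hf : Measurable f) :
    ∫⁻ t, ∫⁻ y, ‖sliceAt f t y‖ₑ ^ 2 ∂halfPow m ∂halfLeb = ∫⁻ x, ‖f x‖ₑ ^ 2 ∂halfPow (m + 1) := by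
  rw [← (measurePreserving_fin_cons m).lintegral_comp (hf.enorm.pow_const 2), lintegral_prod]
  · rfl
  · exact ((hf.comp measurable_fin_cons).enorm.pow_const 2).aemeasurable

/-- Resample the `k`-th coordinate: conditionally on its value `t`, the part is `m + 1` times the
multiple sum of the slice at `t`. -/
lemma lintegral_part_cube_eq (hf : Kern f) {N k : ℕ} (hk : k < N) :
    ∫⁻ x, ‖part f N k x‖ₑ ^ 3 ∂conf = ((m + 1 : ℕ) : ℝ≥0∞) ^ 3 *
      ∫⁻ t in block k, ∫⁻ x, ‖chaos (sliceAt f t) N x‖ₑ ^ 3 ∂conf ∂halfLeb := by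
  rw [← lintegral_resample ((measurable_part hf.meas N k).enorm.pow_const 3) k]
  have e : ∀ᵐ x ∂conf, ∫⁻ s, ‖part f N k (Function.update x k s)‖ₑ ^ 3 ∂blockMeas k
      = ∫⁻ s, ((m + 1 : ℕ) : ℝ≥0∞) ^ 3 * ‖chaos (sliceAt f s) N x‖ₑ ^ 3 ∂blockMeas k := by
    filter_upwards [conf_ae_mem] with x hx
    refine lintegral_congr_ae ?_
    filter_upwards [blockMeas_ae_mem k] with s hs
    rw [part_update_eq hf.symm hf.vanish hk hs hx, enorm_mul, mul_pow, Real.enorm_natCast]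
  have hm : Measurable fun q : (ℕ → ℝ) × ℝ => ‖chaos (sliceAt f q.2) N q.1‖ₑ ^ 3 :=
    ((measurable_chaos_sliceAt hf.meas N).comp measurable_swap).enorm.pow_const 3
  rw [lintegral_congr_ae e, lintegral_lintegral_swap (hm.const_mul _).aemeasurable, blockMeas,
    ← lintegral_const_mul' _ _ (by finiteness)]
  refine lintegral_congr fun t => ?_
  rw [lintegral_const_mul' _ _ (by finiteness)]

lemma iUnion_block_range_measurable (N : ℕ) : MeasurableSet (⋃ k ∈ Finset.range N, block k) :=
  Finset.measurableSet_biUnion _ fun k _ => measurableSet_block k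

lemma pairwiseDisjoint_block (s : Set ℕ) : s.PairwiseDisjoint block := fun _ _ _ _ hne =>
  Set.disjoint_left.2 fun _ hx hx' => hne (block_eq_of_mem hx hx')

/-- The third moments of the parts of a multiple sum. -/
theorem sum_lintegral_part_cube_le (hf : Kern f)
    (hK : ∫⁻ t, kernelMass m (sliceAt f t) ∂halfLeb ≠ ∞) (N : ℕ) :
    ∑ k ∈ Finset.range N, ∫⁻ x, ‖part f N k x‖ₑ ^ 3 ∂conf ≤ ((m + 1 : ℕ) : ℝ≥0∞) ^ 3 *
      (((m ! : ℝ≥0∞) * ∫⁻ x, ‖f x‖ₑ ^ 2 ∂halfPow (m + 1)) ^ (1 / 2 : ℝ) *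
        (∫⁻ t, kernelMass m (sliceAt f t) ∂halfLeb) ^ (1 / 2 : ℝ)) := by
  rw [Finset.sum_congr rfl fun k hk => lintegral_part_cube_eq hf (Finset.mem_range.1 hk),
    ← Finset.mul_sum, ← lintegral_biUnion_finset (pairwiseDisjoint_block _)
      fun k _ => measurableSet_block k]
  refine mul_le_mul_right ?_ _
  refine (setLIntegral_le_lintegral _ _).trans ?_
  have h1 : ∀ᵐ t ∂halfLeb, ∫⁻ x, ‖chaos (sliceAt f t) N x‖ₑ ^ 3 ∂conf ≤
      ((m ! : ℝ≥0∞) * ∫⁻ y, ‖sliceAt f t y‖ₑ ^ 2 ∂halfPow m) ^ (1 / 2 : ℝ) *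
        kernelMass m (sliceAt f t) ^ (1 / 2 : ℝ) := by
    filter_upwards [ae_kern_sliceAt hf, ae_lt_top (measurable_kernelMass hf.meas) hK] with t h1 h2
    exact lintegral_chaos_cube_le h1 h2.ne N
  have hm : Measurable fun t => (m ! : ℝ≥0∞) * ∫⁻ y, ‖sliceAt f t y‖ₑ ^ 2 ∂halfPow m :=
    (Measurable.lintegral_prod_right' (f := fun q : ℝ × (Fin m → ℝ) => ‖sliceAt f q.1 q.2‖ₑ ^ 2)
      ((measurable_uncurry_sliceAt hf.meas).enorm.pow_const 2)).const_mul _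
  -- A second Cauchy–Schwarz inequality, now in the slice variable `t`.
  refine (lintegral_mono_ae h1).trans ((lintegral_mul_le_sqrt (hm.pow_const _).aemeasurable
    ((measurable_kernelMass hf.meas).pow_const _).aemeasurable).trans (le_of_eq ?_))
  have e : ∀ a : ℝ≥0∞, (a ^ (1 / 2 : ℝ)) ^ 2 = a := fun a => by
    rw [← ENNReal.rpow_natCast, ← ENNReal.rpow_mul]; simp
  simp_rw [e]
  rw [lintegral_const_mul' _ _ (by finiteness), lintegral_sliceAt_sq hf.meas]

end UniformChaos

namespace UniformChaos

/-! ### Integrability of the kernels of the slices -/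

variable {p k : ℕ}

lemma lintegral_pair_sq_le {l : ℕ} {g : (Fin p → ℝ) → ℝ} (hg : Measurable g) {α : Fin k → ℕ}
    (hα : Function.Injective α) {s : Fin p → Fin l ⊕ Fin k} (hs : Function.Injective s)
    (hs' : ∀ i, ∃ a, s a = Sum.inl i) :
    Measurable (fun q : (Fin l → ℝ) × (ℕ → ℝ) =>
      g ((Sum.elim q.1 (q.2 ∘ α) : Fin l ⊕ Fin k → ℝ) ∘ s)) ∧
    ∫⁻ q : (Fin l → ℝ) × (ℕ → ℝ), ‖g ((Sum.elim q.1 (q.2 ∘ α) : Fin l ⊕ Fin k → ℝ) ∘ s)‖ₑ ^ 2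
      ∂(halfPow l).prod conf ≤ ∫⁻ y, ‖g y‖ₑ ^ 2 ∂halfPow p := by
  obtain ⟨M, hM, hmp⟩ := exists_measurePreserving_pair hα hs hs'
  refine ⟨hg.comp hmp.measurable, ?_⟩
  have := hmp.lintegral_comp (hg.enorm.pow_const 2)
  rw [this]
  exact lintegral_mono' hM le_rfl

lemma lintegral_contraction_le {r l : ℕ} (hl : l ≤ r) (hr : r ≤ p) (hk : r + l + k = 2 * p)
    {g : (Fin p → ℝ) → ℝ} (hg : Measurable g) {α : Fin k → ℕ} (hα : Function.Injective α) :
    ∫⁻ x : ℕ → ℝ, ‖contraction r l g g (x ∘ α)‖ₑ ∂conf ≤ ∫⁻ y, ‖g y‖ₑ ^ 2 ∂halfPow p := by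
  obtain ⟨m1, h1⟩ := lintegral_pair_sq_le hg hα (sel₁_injective hl hr hk) (exists_sel₁_inl hl hr hk)
  obtain ⟨m2, h2⟩ := lintegral_pair_sq_le hg hα (sel₂_injective hl hr hk) (exists_sel₂_inl hl hr hk)
  calc ∫⁻ x : ℕ → ℝ, ‖contraction r l g g (x ∘ α)‖ₑ ∂conf
      ≤ ∫⁻ x, ∫⁻ z, ‖contrIntegrand hl hr hk g α (z, x)‖ₑ ∂halfPow l ∂conf := by
        refine lintegral_mono fun x => ?_
        rw [contraction_comp_eq hl hr hk g α]
        exact enorm_integral_le_lintegral_enorm _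
    _ = ∫⁻ q, ‖contrIntegrand hl hr hk g α q‖ₑ ∂(halfPow l).prod conf :=
        (lintegral_prod_symm _ (m1.mul m2).enorm.aemeasurable).symm
    _ ≤ _ := by
        simp only [contrIntegrand, enorm_mul]
        refine (lintegral_mul_le_sqrt m1.enorm.aemeasurable m2.enorm.aemeasurable).trans ?_
        refine (mul_le_mul' (ENNReal.rpow_le_rpow h1 (by norm_num))
          (ENNReal.rpow_le_rpow h2 (by norm_num))).trans (le_of_eq ?_)
        rw [← ENNReal.rpow_add_of_nonneg _ _ (by norm_num) (by norm_num)]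
        norm_num

/-- An `L¹` bound by the squared norm of `g`, with a constant depending only on `p` and `k`. It
justifies Fubini for the averaged kernels without any assumption on the `L²` norms of the `G_k`. -/
lemma exists_lintegral_kernelG_le (p k : ℕ) : ∃ C : ℝ≥0∞, C ≠ ∞ ∧
    ∀ (g : (Fin p → ℝ) → ℝ), Measurable g → ∀ α : Fin k → ℕ, Function.Injective α →
      ∫⁻ x : ℕ → ℝ, ‖kernelG p k g (x ∘ α)‖ₑ ∂conf ≤ C * ∫⁻ y, ‖g y‖ₑ ^ 2 ∂halfPow p := by
  let c : ℕ → ℕ → ℝ := fun r l => (r ! : ℝ) * (p.choose r : ℝ) ^ 2 * (r.choose l : ℝ)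
  refine ⟨∑ r ∈ Finset.range (p + 1), ∑ l ∈ Finset.range (r + 1),
    ‖c r l‖ₑ * (‖1 / (k ! : ℝ)‖ₑ * ((Finset.univ : Finset (Equiv.Perm (Fin k))).card : ℝ≥0∞)),
    ?_, fun g hg α hα => ?_⟩
  · refine ENNReal.sum_ne_top.2 fun r _ => ENNReal.sum_ne_top.2 fun l _ => ?_
    exact ENNReal.mul_ne_top enorm_ne_top (ENNReal.mul_ne_top enorm_ne_top (ENNReal.natCast_ne_top _))
  have hmc : ∀ r l (σ : Equiv.Perm (Fin k)),
      Measurable fun x : ℕ → ℝ => contraction r l g g ((x ∘ α) ∘ σ) := fun r l σ => by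
    have h1 : Measurable fun x : ℕ → ℝ => (((), (x ∘ α) ∘ σ) : Unit × (Fin k → ℝ)) :=
      measurable_const.prodMk (measurable_pi_iff.2 fun i => measurable_pi_apply _)
    exact (measurable_contraction (f := fun _ : Unit => g) (hg.comp measurable_snd) r l).comp h1
  have hle : ∀ x : ℕ → ℝ, ‖kernelG p k g (x ∘ α)‖ₑ ≤
      ∑ r ∈ Finset.range (p + 1), ∑ l ∈ Finset.range (r + 1), if r + l + k = 2 * p then
        ‖c r l‖ₑ * (‖1 / (k ! : ℝ)‖ₑ * ∑ σ : Equiv.Perm (Fin k),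
          ‖contraction r l g g ((x ∘ α) ∘ σ)‖ₑ) else 0 := fun x => by
    unfold kernelG
    refine (enorm_indicator_le_enorm_self _ _).trans ((enorm_sum_le _ _).trans
      (Finset.sum_le_sum fun r _ => (enorm_sum_le _ _).trans (Finset.sum_le_sum fun l _ => ?_)))
    split_ifs
    · rw [enorm_mul]
      refine mul_le_mul_right ?_ _
      unfold symmetrize
      rw [enorm_mul]
      exact mul_le_mul_right (enorm_sum_le _ _) _
    · simp
  refine (lintegral_mono hle).trans ?_
  rw [lintegral_finsetSum, Finset.sum_mul]
  · refine Finset.sum_le_sum fun r hr => ?_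
    rw [lintegral_finsetSum, Finset.sum_mul]
    · refine Finset.sum_le_sum fun l hl => ?_
      rw [Finset.mem_range] at hr hl
      split_ifs with hk
      · rw [lintegral_const_mul' _ _ enorm_ne_top, lintegral_const_mul' _ _ enorm_ne_top,
          lintegral_finsetSum _ fun σ _ => (hmc r l σ).enorm, mul_assoc, mul_assoc]
        refine mul_le_mul_right (mul_le_mul_right ?_ _) _
        rw [← nsmul_eq_mul]
        refine Finset.sum_le_card_nsmul _ _ _ fun σ _ => ?_
        exact lintegral_contraction_le (by omega) (by omega) hk hg (hα.comp σ.injective)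
      · simp
    · intro l _
      split_ifs
      · exact ((Finset.measurable_sum _ fun σ _ => (hmc r l σ).enorm).const_mul _).const_mul _
      · exact measurable_const
  · intro r _
    refine Finset.measurable_sum _ fun l _ => ?_
    split_ifs
    · exact ((Finset.measurable_sum _ fun σ _ => (hmc r l σ).enorm).const_mul _).const_mul _
    · exact measurable_const

variable {m : ℕ} {f : (Fin (m + 1) → ℝ) → ℝ}

lemma lintegral_enorm_sq_ne_top {X : Type*} [MeasurableSpace X] {μ : Measure X} {u : X → ℝ}
    (hu : MemLp u 2 μ) : ∫⁻ x, ‖u x‖ₑ ^ 2 ∂μ ≠ ∞ := by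
  rw [lintegral_enorm_sq_eq hu]; exact ENNReal.ofReal_ne_top

lemma measurable_kernelG_sliceAt_comp (hf : Measurable f) (α : Fin k → ℕ) :
    Measurable fun q : ℝ × (ℕ → ℝ) => kernelG m k (sliceAt f q.1) (q.2 ∘ α) := by
  have h1 : Measurable fun q : ℝ × (ℕ → ℝ) => q.2 ∘ α :=
    measurable_pi_iff.2 fun i => (measurable_pi_apply (α i)).comp measurable_snd
  have h2 := measurable_kernelG_param (k := k) (f := sliceAt f) (measurable_uncurry_sliceAt hf)
  have h3 : Measurable fun q : ℝ × (ℕ → ℝ) => (q.1, q.2 ∘ α) := measurable_fst.prodMk h1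
  change Measurable ((fun w : ℝ × (Fin k → ℝ) => kernelG m k (sliceAt f w.1) w.2) ∘
    fun q : ℝ × (ℕ → ℝ) => (q.1, q.2 ∘ α))
  exact h2.comp h3

lemma integrable_kernelG_sliceAt (hf : Kern f) {α : Fin k → ℕ} (hα : Function.Injective α) :
    Integrable (fun q : ℝ × (ℕ → ℝ) => kernelG m k (sliceAt f q.1) (q.2 ∘ α))
      (halfLeb.prod conf) := by
  have hm := measurable_kernelG_sliceAt_comp hf.meas α
  refine ⟨hm.aestronglyMeasurable, ?_⟩
  obtain ⟨C, hC, h⟩ := exists_lintegral_kernelG_le m k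
  rw [HasFiniteIntegral, lintegral_prod _ hm.enorm.aemeasurable]
  refine (lintegral_mono fun t => h _ (measurable_sliceAt hf.meas t) α hα).trans_lt ?_
  rw [lintegral_const_mul' _ _ hC, lintegral_sliceAt_sq hf.meas]
  exact ENNReal.mul_lt_top hC.lt_top (lintegral_enorm_sq_ne_top hf.memLp).lt_top

lemma integrable_chaos_sliceAt_sq (hf : Kern f) (N : ℕ) :
    Integrable (fun q : ℝ × (ℕ → ℝ) => chaos (sliceAt f q.1) N q.2 ^ 2) (halfLeb.prod conf) := by
  have hm := measurable_chaos_sliceAt hf.meas N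
  refine (memLp_two_of_lintegral hm.aestronglyMeasurable (ne_of_lt ?_)).integrable_sq
  rw [lintegral_prod _ (hm.enorm.pow_const 2).aemeasurable]
  have : ∀ᵐ t ∂halfLeb, ∫⁻ x, ‖chaos (sliceAt f t) N x‖ₑ ^ 2 ∂conf ≤
      (m ! : ℝ≥0∞) * ∫⁻ y, ‖sliceAt f t y‖ₑ ^ 2 ∂halfPow m := by
    filter_upwards [ae_kern_sliceAt hf] with t ht
    rw [lintegral_enorm_sq_eq (memLp_chaos ht N), lintegral_enorm_sq_eq ht.memLp,
      ← ENNReal.ofReal_natCast, ← ENNReal.ofReal_mul (by positivity)]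
    exact ENNReal.ofReal_le_ofReal (integral_chaos_sq_le ht N)
  refine (lintegral_mono_ae this).trans_lt ?_
  rw [lintegral_const_mul' _ _ (by finiteness), lintegral_sliceAt_sq hf.meas]
  exact ENNReal.mul_lt_top (by finiteness) (lintegral_enorm_sq_ne_top hf.memLp).lt_top

/-! ### The conditional variances in terms of slices -/

/-- The factor `(m + 1)²` from the slices meets the normalisation `(m + 1)⁻¹` of `gam`. -/
lemma gam_ae_eq (hf : Kern f) (N : ℕ) : ∀ᵐ x ∂conf, gam f N x = ((m + 1 : ℕ) : ℝ) *
    ∑ k ∈ Finset.range N, ∫ t in block k, chaos (sliceAt f t) N x ^ 2 ∂halfLeb := by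
  filter_upwards [conf_ae_mem] with x hx
  have hn : ((m + 1 : ℕ) : ℝ) ≠ 0 := by positivity
  unfold gam
  rw [Finset.mul_sum, Finset.mul_sum]
  refine Finset.sum_congr rfl fun k hk => ?_
  unfold coordVar
  have : ∫ s, part f N k (Function.update x k s) ^ 2 ∂blockMeas k
      = ∫ s, ((m + 1 : ℕ) : ℝ) ^ 2 * chaos (sliceAt f s) N x ^ 2 ∂blockMeas k := by
    refine integral_congr_ae ?_
    filter_upwards [blockMeas_ae_mem k] with s hs
    rw [part_update_eq hf.symm hf.vanish (Finset.mem_range.1 hk) hs hx, mul_pow]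
  rw [this, integral_const_mul, blockMeas]
  field_simp

lemma integral_gam_mul (hf : Kern f) (N : ℕ) {ψ : (ℕ → ℝ) → ℝ} (hψ : Measurable ψ)
    (hb : ∃ C, ∀ x, |ψ x| ≤ C) :
    ∫ x, gam f N x * ψ x ∂conf = ((m + 1 : ℕ) : ℝ) *
      ∫ t in ⋃ k ∈ Finset.range N, block k, ∫ x, chaos (sliceAt f t) N x ^ 2 * ψ x ∂conf ∂halfLeb := by
  have hi : Integrable (fun q : ℝ × (ℕ → ℝ) => chaos (sliceAt f q.1) N q.2 ^ 2 * ψ q.2)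
      (halfLeb.prod conf) := integrable_mul_of_bdd (integrable_chaos_sliceAt_sq hf N)
        (hψ.comp measurable_snd) (by obtain ⟨C, hC⟩ := hb; exact ⟨C, fun q => hC _⟩)
  have hik : ∀ k, Integrable (fun q : ℝ × (ℕ → ℝ) => chaos (sliceAt f q.1) N q.2 ^ 2 * ψ q.2)
      ((halfLeb.restrict (block k)).prod conf) := fun k => by
    have : (halfLeb.restrict (block k)).prod conf
        = (halfLeb.prod conf).restrict (block k ×ˢ Set.univ) := by
      rw [← Measure.prod_restrict, Measure.restrict_univ]
    rw [this]
    exact hi.restrict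
  have e : ∀ᵐ x ∂conf, gam f N x * ψ x = ((m + 1 : ℕ) : ℝ) * ∑ k ∈ Finset.range N,
      ∫ t in block k, chaos (sliceAt f t) N x ^ 2 * ψ x ∂halfLeb := by
    filter_upwards [gam_ae_eq hf N] with x hx
    rw [hx, mul_assoc, Finset.sum_mul]
    simp_rw [integral_mul_const]
  rw [integral_congr_ae e, integral_const_mul,
    integral_finsetSum _ fun k _ => (hik k).integral_prod_right,
    integral_biUnion_finset _ (fun k _ => measurableSet_block k) (pairwiseDisjoint_block _)
      fun k _ => (hi.integral_prod_left).integrableOn]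
  congr 1
  refine Finset.sum_congr rfl fun k _ => ?_
  rw [integral_integral_swap]
  exact (hik k).swap

lemma integrable_normSq_sliceAt (hf : Kern f) :
    Integrable (fun t => normSq (sliceAt f t)) halfLeb :=
  (memLp_uncurry_sliceAt hf).integrable_sq.integral_prod_left

lemma integral_normSq_sliceAt (hf : Kern f) :
    ∫ t, normSq (sliceAt f t) ∂halfLeb = normSq f := by
  have hm := measurePreserving_fin_cons m
  unfold normSq
  rw [← integral_prod (fun q : ℝ × (Fin m → ℝ) => sliceAt f q.1 q.2 ^ 2)
    (memLp_uncurry_sliceAt hf).integrable_sq]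
  conv_rhs => rw [← hm.map_eq]
  rw [integral_map hm.measurable.aemeasurable (hf.meas.pow_const 2).aestronglyMeasurable]
  rfl

lemma tendsto_indicator_blocks {t : ℝ} (ht : ∃ k, t ∈ block k) :
    ∀ᶠ N : ℕ in atTop, t ∈ ⋃ k ∈ Finset.range N, block k := by
  obtain ⟨k, hk⟩ := ht
  filter_upwards [eventually_gt_atTop k] with N hN
  exact Set.mem_biUnion (Finset.mem_coe.2 (Finset.mem_range.2 hN)) hk

/-- The conditional variances, tested against degenerate functions, are governed by the averaged
kernels. -/
theorem tendsto_integral_gam_mul (hf : Kern f) {α : Fin k → ℕ} (hα : Function.Injective α)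
    {ψ : (ℕ → ℝ) → ℝ} (hψ : TestFun ∅ (Finset.univ.image α) ψ) :
    Tendsto (fun N => ∫ x, gam f N x * ψ x ∂conf) atTop (𝓝 (((m + 1 : ℕ) : ℝ) *
      ((k ! : ℝ) * ∫ x, kernelGhat m k f (x ∘ α) * ψ x ∂conf))) := by
  have hi := integrable_mul_of_bdd (integrable_kernelG_sliceAt hf hα) (hψ.meas.comp measurable_snd)
    (by obtain ⟨C, hC⟩ := hψ.bdd; exact ⟨C, fun q => hC _⟩)
  simp only [Function.comp_apply] at hi
  have e : ∫ x, kernelGhat m k f (x ∘ α) * ψ x ∂conf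
      = ∫ t, ∫ x, kernelG m k (sliceAt f t) (x ∘ α) * ψ x ∂conf ∂halfLeb := by
    rw [integral_integral_swap hi]
    simp only [kernelGhat, integral_mul_const]
  simp_rw [integral_gam_mul hf _ hψ.meas hψ.bdd]
  refine Tendsto.const_mul _ ?_
  rw [e, ← integral_const_mul]
  simp_rw [← integral_indicator (iUnion_block_range_measurable _)]
  obtain ⟨C, hC⟩ := hψ.bdd
  have hC0 : 0 ≤ C := (abs_nonneg _).trans (hC 0)
  -- Pointwise in `t` this is the product formula for the slice, valid once the block of `t` lies
  -- below `2N`. The second moment bound for the slice dominates uniformly in `N`.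
  refine tendsto_integral_of_dominated_convergence
    (fun t => C * ((m ! : ℝ) * normSq (sliceAt f t))) (fun N => ?_)
    (((integrable_normSq_sliceAt hf).const_mul _).const_mul _) (fun N => ?_) ?_
  · refine AEStronglyMeasurable.indicator ?_ (iUnion_block_range_measurable _)
    exact (integrable_mul_of_bdd (integrable_chaos_sliceAt_sq hf N)
        (hψ.meas.comp measurable_snd)
        ⟨C, fun q => hC _⟩).integral_prod_left.aestronglyMeasurable
  · filter_upwards [ae_kern_sliceAt hf] with t ht
    refine (norm_indicator_le_norm_self _ _).trans ?_
    rw [Real.norm_eq_abs]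
    refine abs_integral_le_integral_abs.trans ?_
    have h1 : ∀ x, |chaos (sliceAt f t) N x ^ 2 * ψ x| ≤ C * chaos (sliceAt f t) N x ^ 2 := fun x => by
      rw [abs_mul, abs_of_nonneg (sq_nonneg (chaos _ _ _)), mul_comm]
      exact mul_le_mul_of_nonneg_right (hC x) (sq_nonneg _)
    have h2 := (memLp_chaos ht N).integrable_sq
    refine (integral_mono (integrable_mul_of_bdd h2 hψ.meas ⟨C, hC⟩).abs (h2.const_mul C) h1).trans ?_
    rw [integral_const_mul]
    exact mul_le_mul_of_nonneg_left (integral_chaos_sq_le ht N) hC0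
  · filter_upwards [ae_kern_sliceAt hf, halfLeb_ae_mem_block] with t ht hk
    refine (tendsto_integral_chaos_sq_mul ht hα hψ).congr' ?_
    filter_upwards [tendsto_indicator_blocks hk] with N hN
    rw [Set.indicator_of_mem hN]

end UniformChaos

namespace UniformChaos

/-! ### The averaged kernels -/

variable {m k : ℕ} {f : (Fin (m + 1) → ℝ) → ℝ}

/-- For `k = 0` only the full contraction `r = l = p` satisfies the size condition. -/
lemma kernelG_zero_eq {p : ℕ} (g : (Fin p → ℝ) → ℝ) (x : Fin 0 → ℝ) :
    kernelG p 0 g x = (p ! : ℝ) * normSq g := by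
  have hx : x ∈ distinctBlocks 0 :=
    ⟨Fin.elim0, fun i => i.elim0, fun i => i.elim0⟩
  unfold kernelG
  rw [Set.indicator_of_mem hx, Finset.sum_eq_single p, Finset.sum_eq_single p]
  · rw [if_pos (by omega), Nat.choose_self]
    have : symmetrize (contraction p p g g) x = normSq g := by
      unfold symmetrize contraction normSq
      simp only [Nat.factorial_zero, Finset.univ_unique, Finset.sum_singleton, Nat.cast_one,
        div_one, one_mul]
      refine integral_congr_ae (ae_of_all _ fun z => ?_)
      simp [coordOr0, sq]
    rw [this]
    simp
  · intro l hl hne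
    rw [Finset.mem_range] at hl
    rw [if_neg (by omega)]
  · intro h; exact absurd (Finset.mem_range.2 (by omega)) h
  · intro r hr hne
    rw [Finset.mem_range] at hr
    refine Finset.sum_eq_zero fun l hl => ?_
    rw [Finset.mem_range] at hl
    rw [if_neg (by omega)]
  · intro h; exact absurd (Finset.mem_range.2 (by omega)) h

lemma kernelGhat_zero_eq (hf : Kern f) (x : Fin 0 → ℝ) :
    kernelGhat m 0 f x = (m ! : ℝ) * normSq f := by
  unfold kernelGhat
  simp_rw [kernelG_zero_eq]
  rw [integral_const_mul, integral_normSq_sliceAt hf]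

lemma measurable_kernelGhat (hf : Measurable f) : Measurable (kernelGhat m k f) := by
  have h := (measurable_kernelG_param (k := k) (measurable_uncurry_sliceAt hf)).comp
    (measurable_swap (α := Fin k → ℝ) (β := ℝ))
  exact (h.stronglyMeasurable.integral_prod_right (ν := halfLeb)
    (f := fun (x : Fin k → ℝ) t => kernelG m k (sliceAt f t) x)).measurable

lemma symmFun_kernelGhat (f : (Fin (m + 1) → ℝ) → ℝ) : SymmFun (kernelGhat m k f) := fun σ x => by
  unfold kernelGhat
  simp only [symmFun_kernelG _ σ x]

lemma kernelGhat_eq_zero (h : 2 * m < k) (f : (Fin (m + 1) → ℝ) → ℝ) : kernelGhat m k f = 0 := by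
  funext x
  simp [kernelGhat, kernelG_eq_zero h]

/-- The limiting variance defect. -/
noncomputable def varDefect (m : ℕ) (f : (Fin (m + 1) → ℝ) → ℝ) : ℝ :=
  (1 - ((m + 1)! : ℝ) * normSq f) ^ 2 + ((m + 1 : ℕ) : ℝ) ^ 2 *
    ∑ k ∈ Finset.Icc 1 (2 * m), (k ! : ℝ) * normSq (kernelGhat m k f)

/-- Duality for the functionals `ψ ↦ E[(1 - Γ_N) ψ]`. The empty set carries the defect `1 - (m+1)!
‖f‖²`; for nonempty `A` the degenerate `ψ` is centred, so the constant `1` drops out and only the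
averaged kernel of level `|A|` remains. -/
lemma exists_limit_gam (hf : Kern f)
    (hG : ∀ k ∈ Finset.Icc 1 (2 * m), MemLp (kernelGhat m k f) 2 (halfPow k))
    {M : ℕ} {ψ : (ℕ → ℝ) → ℝ} (hψ : TestFun (Finset.range M) ∅ ψ) :
    ∃ ℓ, Tendsto (fun N => ∫ x, (1 - gam f N x) * ψ x ∂conf) atTop (𝓝 ℓ) ∧
      |ℓ| ≤ √(varDefect m f) * √(∫ x, ψ x ^ 2 ∂conf) := by
  classical
  -- The level `0` is removed from the family of kernels because it enters through the defect `a`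
  -- instead.
  let h : ∀ k, (Fin k → ℝ) → ℝ := fun k => if k = 0 then 0 else kernelGhat m k f
  have hpos : ∀ k, k ≠ 0 → h k = kernelGhat m k f := fun k hk => if_neg hk
  have hm : ∀ k, Measurable (h k) := fun k => by
    by_cases hk : k = 0
    · simp only [h, if_pos hk]; exact measurable_const
    · rw [hpos k hk]; exact measurable_kernelGhat hf.meas
  have hs : ∀ k, SymmFun (h k) := fun k => by
    by_cases hk : k = 0
    · simp only [h, if_pos hk]; exact fun _ _ => rfl
    · rw [hpos k hk]; exact symmFun_kernelGhat f
  have hL : ∀ k, MemLp (h k) 2 (halfPow k) := fun k => by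
    by_cases hk : k = 0
    · simp only [h, if_pos hk]; exact MemLp.zero
    · rw [hpos k hk]
      by_cases hk2 : k ≤ 2 * m
      · exact hG k (Finset.mem_Icc.2 ⟨by omega, hk2⟩)
      · rw [kernelGhat_eq_zero (by omega)]; exact MemLp.zero
  have hz : ∀ k, 2 * m + 1 ≤ k → h k = 0 := fun k hk => by
    rw [hpos k (by omega), kernelGhat_eq_zero (by omega)]
  set a : ℝ := |1 - ((m + 1)! : ℝ) * normSq f| with ha
  set n : ℝ := ((m + 1 : ℕ) : ℝ) with hn
  have hn0 : 0 ≤ n := Nat.cast_nonneg _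
  have hsplit : ∀ N (ψ : (ℕ → ℝ) → ℝ), Measurable ψ → (∃ C, ∀ x, |ψ x| ≤ C) →
      ∫ x, (1 - gam f N x) * ψ x ∂conf = ∫ x, ψ x ∂conf - ∫ x, gam f N x * ψ x ∂conf :=
    fun N ψ hψ hb => by
      simp_rw [sub_mul, one_mul]
      exact integral_sub ((memLp_of_bdd hψ hb 2).integrable (by norm_num))
        (integrable_mul_of_bdd (integrable_gam hf N) hψ hb)
  obtain ⟨ℓ, h1, h2⟩ := exists_limit_of_degenerate
    (L := fun N ψ => ∫ x, (1 - gam f N x) * ψ x ∂conf)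
    (κ := fun A => if A = ∅ then a else
      n * ((A.card ! : ℝ) * √(∫ x, setEval (h A.card) A x ^ 2 ∂conf)))
    (fun N u v hu hv hbu hbv => by
      have hi : Integrable (fun x => 1 - gam f N x) conf :=
        (integrable_const 1).sub (integrable_gam hf N)
      simp only [mul_add]
      exact integral_add (integrable_mul_of_bdd hi hu hbu) (integrable_mul_of_bdd hi hv hbv))
    (fun A ψ hψ => by
      obtain ⟨α, hα, hA⟩ := exists_enum (B := A) rfl
      have hψ' : TestFun ∅ (Finset.univ.image α) ψ := hA.symm ▸ hψ
      have hlim := tendsto_integral_gam_mul hf hα hψ'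
      have h2 := memLp_of_bdd (μ := conf) hψ.meas hψ.bdd 2
      refine ⟨_, (hlim.const_sub (∫ x, ψ x ∂conf)).congr fun N =>
        (hsplit N ψ hψ.meas hψ.bdd).symm, ?_⟩
      split_ifs with hAe
      · have hψ1 : |∫ x, ψ x ∂conf| ≤ √(∫ x, ψ x ^ 2 ∂conf) := by
          have := abs_integral_mul_le_sqrt (memLp_const (μ := conf) (p := 2) (1 : ℝ)) h2
          simpa using this
        have hc : A.card = 0 := by rw [hAe]; rfl
        have key : ∀ (k : ℕ) (α : Fin k → ℕ), k = 0 →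
            ∫ x, kernelGhat m k f (x ∘ α) * ψ x ∂conf
              = (m ! : ℝ) * normSq f * ∫ x, ψ x ∂conf := fun k α hk => by
          subst hk
          simp_rw [kernelGhat_zero_eq hf]
          rw [integral_const_mul]
        rw [key _ α hc, hc]
        have e : ∫ x, ψ x ∂conf - n * (((0 ! : ℕ) : ℝ) * ((m ! : ℝ) * normSq f * ∫ x, ψ x ∂conf))
            = (1 - ((m + 1)! : ℝ) * normSq f) * ∫ x, ψ x ∂conf := by
          rw [Nat.factorial_succ, Nat.factorial_zero, Nat.cast_mul]
          push_cast [hn]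
          ring
        rw [e, abs_mul]
        exact mul_le_mul_of_nonneg_left hψ1 (abs_nonneg _)
      · have hc : A.card ≠ 0 := fun h0 => hAe (Finset.card_eq_zero.1 h0)
        obtain ⟨b, hb⟩ := Finset.nonempty_iff_ne_empty.2 hAe
        have hψ0 : ∫ x, ψ x ∂conf = 0 := by
          have := integral_mul_eq_zero_of_degen (u := fun _ => 1) (fun _ _ => rfl) (hψ.degen b hb)
          simpa using this
        have := abs_integral_mul_setEval_le (hs A.card) (hL A.card) hα h2
        rw [hA, hpos _ hc] at this
        rw [hψ0, zero_sub, abs_neg, abs_mul, abs_mul, Nat.abs_cast, Nat.abs_cast,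
          hpos _ hc, mul_assoc, mul_assoc]
        exact mul_le_mul_of_nonneg_left (mul_le_mul_of_nonneg_left this (by positivity)) hn0)
    (fun A => by
      split_ifs
      · exact abs_nonneg _
      · positivity) (Finset.range M) ∅ ψ (Finset.disjoint_empty_right _) hψ
  refine ⟨ℓ, h1, h2.trans (mul_le_mul_of_nonneg_right (Real.sqrt_le_sqrt ?_) (Real.sqrt_nonneg _))⟩
  have hbound := sum_powerset_integral_sq_le hm hs hL hz (Finset.range M)
  have hsum : ∑ k ∈ Finset.range (2 * m + 1), (k ! : ℝ) * normSq (h k)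
      = ∑ k ∈ Finset.Icc 1 (2 * m), (k ! : ℝ) * normSq (kernelGhat m k f) := by
    rw [Finset.range_eq_Ico, Finset.sum_eq_sum_Ico_succ_bot (by omega)]
    have h00 : normSq (h 0) = 0 := by simp [h, normSq]
    rw [h00, mul_zero, zero_add]
    refine Finset.sum_congr rfl fun k hk => ?_
    rw [Finset.mem_Icc] at hk
    rw [hpos k (by omega)]
  rw [hsum] at hbound
  unfold varDefect
  calc ∑ A ∈ (Finset.range M).powerset, (if A ∪ ∅ = ∅ then a else
          n * (((A ∪ ∅).card ! : ℝ) * √(∫ x, setEval (h (A ∪ ∅).card) (A ∪ ∅) x ^ 2 ∂conf))) ^ 2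
      ≤ ∑ A ∈ (Finset.range M).powerset, ((if A = ∅ then a ^ 2 else 0) +
          n ^ 2 * ((A.card ! : ℝ) ^ 2 * ∫ x, setEval (h A.card) A x ^ 2 ∂conf)) := by
        refine Finset.sum_le_sum fun A _ => ?_
        rw [Finset.union_empty]
        have h0 : 0 ≤ ∫ x, setEval (h A.card) A x ^ 2 ∂conf := integral_nonneg fun _ => sq_nonneg _
        split_ifs
        · have : 0 ≤ n ^ 2 * ((A.card ! : ℝ) ^ 2 * ∫ x, setEval (h A.card) A x ^ 2 ∂conf) := by
            positivity
          linarith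
        · rw [mul_pow, mul_pow, Real.sq_sqrt h0, zero_add]
    _ ≤ _ := by
        rw [Finset.sum_add_distrib, ← Finset.mul_sum]
        refine add_le_add (le_of_eq ?_) (mul_le_mul_of_nonneg_left hbound (by positivity))
        rw [Finset.sum_ite_eq' (Finset.range M).powerset ∅ fun _ => a ^ 2,
          if_pos (Finset.empty_mem_powerset _), ha, sq_abs]

/-! ### Convergence of the conditional variances -/

variable {p : ℕ} {g : (Fin p → ℝ) → ℝ}

lemma integral_chaos_sub_sq (hg : Kern g) {M N : ℕ} (h : M ≤ N) :
    ∫ x, (chaos g N x - chaos g M x) ^ 2 ∂conf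
      = ∫ x, chaos g N x ^ 2 ∂conf - ∫ x, chaos g M x ^ 2 ∂conf := by
  have hM := memLp_chaos hg M
  have hD : MemLp (fun x => chaos g N x - chaos g M x) 2 conf := (memLp_chaos hg N).sub hM
  have hz := integral_mul_chaos_sub hg hM h fun k hk x s => chaos_update g hk x s
  have e : ∀ x, chaos g N x ^ 2 = (chaos g M x ^ 2 + (chaos g N x - chaos g M x) ^ 2) +
      2 * (chaos g M x * (chaos g N x - chaos g M x)) := fun x => by ring
  have i1 : Integrable (fun x => chaos g M x ^ 2 + (chaos g N x - chaos g M x) ^ 2) conf :=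
    hM.integrable_sq.add hD.integrable_sq
  have i2 : Integrable (fun x => chaos g M x * (chaos g N x - chaos g M x)) conf :=
    MemLp.integrable_mul hM hD
  rw [integral_congr_ae (ae_of_all _ e), integral_add i1 (i2.const_mul 2),
    integral_add hM.integrable_sq hD.integrable_sq, integral_const_mul, hz]
  ring

/-- Orthogonality reduces both sides to sums over the sets `B`, each counted `p` times on the left.
Stated for a general family so as to cover increments as well. -/
lemma sum_integral_filter_sq (hg : Kern g) (N : ℕ) {𝓑 : Finset (Finset ℕ)}
    (hB : ∀ B ∈ 𝓑, B ∈ Finset.powersetCard p (Finset.range N)) :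
    ∑ k ∈ Finset.range N, ∫ x, ((p ! : ℝ) * ∑ B ∈ 𝓑.filter (k ∈ ·), setEval g B x) ^ 2 ∂conf
      = p * ∫ x, ((p ! : ℝ) * ∑ B ∈ 𝓑, setEval g B x) ^ 2 ∂conf := by
  simp_rw [mul_pow, integral_const_mul, integral_sum_setEval_sq hg]
  rw [← Finset.mul_sum, mul_left_comm]
  congr 1
  simp_rw [Finset.sum_filter]
  rw [Finset.sum_comm, Finset.mul_sum]
  refine Finset.sum_congr rfl fun B hB' => ?_
  obtain ⟨h1, h2⟩ := Finset.mem_powersetCard.1 (hB B hB')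
  rw [← Finset.sum_filter, Finset.sum_const, nsmul_eq_mul]
  congr 2
  rw [← h2]
  congr 1
  ext i
  simp only [Finset.mem_filter]
  exact ⟨fun h => h.2, fun h => ⟨h1 h, h⟩⟩

lemma sum_integral_part_sq (hg : Kern g) (N : ℕ) :
    ∑ k ∈ Finset.range N, ∫ x, part g N k x ^ 2 ∂conf = p * ∫ x, chaos g N x ^ 2 ∂conf :=
  sum_integral_filter_sq hg N fun _ h => h

lemma part_sub (g : (Fin p → ℝ) → ℝ) {M N : ℕ} (h : M ≤ N) (k : ℕ) (x : ℕ → ℝ) :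
    part g N k x - part g M k x = (p ! : ℝ) * ∑ B ∈ (Finset.powersetCard p (Finset.range N) \
      Finset.powersetCard p (Finset.range M)).filter (k ∈ ·), setEval g B x := by
  unfold part
  rw [← mul_sub, ← Finset.sum_sdiff (Finset.filter_subset_filter (k ∈ ·)
    (Finset.powersetCard_mono (n := p) (Finset.range_mono h))), add_sub_cancel_right]
  congr 2
  ext B
  simp only [Finset.mem_sdiff, Finset.mem_filter]
  tauto

lemma sum_integral_part_sub_sq (hg : Kern g) {M N : ℕ} (h : M ≤ N) :
    ∑ k ∈ Finset.range N, ∫ x, (part g N k x - part g M k x) ^ 2 ∂conf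
      = p * ∫ x, (chaos g N x - chaos g M x) ^ 2 ∂conf := by
  simp_rw [part_sub g h, chaos_sub g h]
  exact sum_integral_filter_sq hg N fun B hB => (Finset.mem_sdiff.1 hB).1

lemma part_eq_zero (g : (Fin p → ℝ) → ℝ) {M k : ℕ} (h : M ≤ k) : part g M k = 0 := by
  funext x
  unfold part
  rw [Finset.filter_false_of_mem, Finset.sum_empty, mul_zero]
  · rfl
  · intro B hB hk
    have := Finset.mem_range.1 ((Finset.mem_powersetCard.1 hB).1 hk)
    omega

lemma gam_eq_sum_range (g : (Fin p → ℝ) → ℝ) {M N : ℕ} (h : M ≤ N) (x : ℕ → ℝ) :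
    gam g M x = (p : ℝ)⁻¹ * ∑ k ∈ Finset.range N, coordVar k (part g M k) x := by
  unfold gam
  congr 1
  refine Finset.sum_subset (Finset.range_mono h) fun k _ hk => ?_
  rw [part_eq_zero g (by simpa using hk)]
  simp [coordVar]

/-- Young's inequality applied to `a² - b² = (a - b)² + 2 (a - b) b`, with the weight `ε` on `b²`.
-/
lemma abs_sq_sub_sq_le {ε : ℝ} (hε : 0 < ε) (a b : ℝ) :
    |a ^ 2 - b ^ 2| ≤ (1 + ε⁻¹) * (a - b) ^ 2 + ε * b ^ 2 := by
  have h1 : a ^ 2 - b ^ 2 = (a - b) ^ 2 + 2 * ((a - b) * b) := by ring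
  have h2 : 2 * (|a - b| * |b|) ≤ ε⁻¹ * (a - b) ^ 2 + ε * b ^ 2 := by
    have h3 : 0 ≤ (|a - b| - ε * |b|) ^ 2 := sq_nonneg _
    have h4 : ε * (2 * (|a - b| * |b|)) ≤ ε * (ε⁻¹ * (a - b) ^ 2 + ε * b ^ 2) := by
      rw [mul_add, mul_inv_cancel_left₀ hε.ne', ← sq_abs (a - b), ← sq_abs b]
      nlinarith
    exact le_of_mul_le_mul_left h4 hε
  rw [h1]
  refine (abs_add_le _ _).trans ?_
  rw [abs_of_nonneg (sq_nonneg (a - b)), abs_mul, abs_mul, abs_two]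
  linarith

lemma abs_coordVar_sub_le {Y Z : (ℕ → ℝ) → ℝ} (hY : MemLp Y 2 conf) (hZ : MemLp Z 2 conf) (k : ℕ)
    {ε : ℝ} (hε : 0 < ε) : ∫ x, |coordVar k Y x - coordVar k Z x| ∂conf ≤
      (1 + ε⁻¹) * ∫ x, (Y x - Z x) ^ 2 ∂conf + ε * ∫ x, Z x ^ 2 ∂conf := by
  have hYZ : MemLp (fun x => Y x - Z x) 2 conf := hY.sub hZ
  have h1 : ∀ᵐ x ∂conf, |coordVar k Y x - coordVar k Z x| ≤
      (1 + ε⁻¹) * coordVar k (fun x => Y x - Z x) x + ε * coordVar k Z x := by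
    filter_upwards [(integrable_resample hY.integrable_sq k).prod_right_ae,
      (integrable_resample hZ.integrable_sq k).prod_right_ae,
      (integrable_resample hYZ.integrable_sq k).prod_right_ae] with x iY iZ iYZ
    unfold coordVar
    rw [← integral_sub iY iZ, ← integral_const_mul, ← integral_const_mul,
      ← integral_add (iYZ.const_mul _) (iZ.const_mul _)]
    refine abs_integral_le_integral_abs.trans (integral_mono (iY.sub iZ).abs
      ((iYZ.const_mul _).add (iZ.const_mul _)) fun s => abs_sq_sub_sq_le hε _ _)
  have i1 := (integrable_coordVar hYZ k).const_mul (1 + ε⁻¹)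
  have i2 := (integrable_coordVar hZ k).const_mul ε
  refine (integral_mono_ae ((integrable_coordVar hY k).sub (integrable_coordVar hZ k)).abs
    (i1.add i2) h1).trans (le_of_eq ?_)
  simp only [Pi.add_apply]
  rw [integral_add i1 i2, integral_const_mul, integral_const_mul]
  unfold coordVar
  rw [integral_resample hYZ.integrable_sq, integral_resample hZ.integrable_sq]

/-- Shows that `Γ_N` is Cauchy in `L¹`: the first term is small by convergence of the multiple sums,
the second by the choice of `ε`. The counting factor `p` cancels the normalisation of `gam`. -/
lemma integral_abs_gam_sub_le (hp : p ≠ 0) (hg : Kern g) {M N : ℕ} (h : M ≤ N) {ε : ℝ}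
    (hε : 0 < ε) : ∫ x, |gam g N x - gam g M x| ∂conf ≤
      (1 + ε⁻¹) * ∫ x, (chaos g N x - chaos g M x) ^ 2 ∂conf + ε * ∫ x, chaos g M x ^ 2 ∂conf := by
  have hp0 : (0 : ℝ) < p := by exact_mod_cast Nat.pos_of_ne_zero hp
  have hi : ∀ k, Integrable (fun x => |coordVar k (part g N k) x - coordVar k (part g M k) x|) conf :=
    fun k => ((integrable_coordVar (memLp_part hg N k) k).sub
      (integrable_coordVar (memLp_part hg M k) k)).abs
  have h1 : ∀ x, |gam g N x - gam g M x| ≤ (p : ℝ)⁻¹ * ∑ k ∈ Finset.range N,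
      |coordVar k (part g N k) x - coordVar k (part g M k) x| := fun x => by
    rw [gam_eq_sum_range g h, gam, ← mul_sub, ← Finset.sum_sub_distrib, abs_mul,
      abs_of_pos (inv_pos.2 hp0)]
    exact mul_le_mul_of_nonneg_left (Finset.abs_sum_le_sum_abs _ _) (inv_pos.2 hp0).le
  refine (integral_mono ((integrable_gam hg N).sub (integrable_gam hg M)).abs
    ((integrable_finsetSum _ fun k _ => hi k).const_mul _) h1).trans ?_
  rw [integral_const_mul, integral_finsetSum _ fun k _ => hi k]
  refine (mul_le_mul_of_nonneg_left (Finset.sum_le_sum fun k _ => abs_coordVar_sub_le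
    (memLp_part hg N k) (memLp_part hg M k) k hε) (inv_pos.2 hp0).le).trans (le_of_eq ?_)
  have h2 : ∑ k ∈ Finset.range N, ∫ x, part g M k x ^ 2 ∂conf = p * ∫ x, chaos g M x ^ 2 ∂conf := by
    rw [← sum_integral_part_sq hg M]
    symm
    refine Finset.sum_subset (Finset.range_mono h) fun k _ hk => ?_
    rw [part_eq_zero g (by simpa using hk)]
    simp
  rw [Finset.sum_add_distrib, ← Finset.mul_sum, ← Finset.mul_sum, h2,
    sum_integral_part_sub_sq hg h]
  field_simp

lemma exists_tendsto_integral_chaos_sq (hg : Kern g) :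
    ∃ a, Tendsto (fun N => ∫ x, chaos g N x ^ 2 ∂conf) atTop (𝓝 a) ∧
      ∀ N, ∫ x, chaos g N x ^ 2 ∂conf ≤ a := by
  have hmono : Monotone fun N => ∫ x, chaos g N x ^ 2 ∂conf := fun M N h => by
    have h1 := integral_chaos_sub_sq hg h
    have h2 : 0 ≤ ∫ x, (chaos g N x - chaos g M x) ^ 2 ∂conf := integral_nonneg fun _ => sq_nonneg _
    simp only
    linarith
  have hb : BddAbove (Set.range fun N => ∫ x, chaos g N x ^ 2 ∂conf) :=
    ⟨_, by rintro _ ⟨N, rfl⟩; exact integral_chaos_sq_le hg N⟩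
  exact ⟨_, tendsto_atTop_ciSup hmono hb, fun N => le_ciSup hb N⟩

lemma part_congr (g : (Fin p → ℝ) → ℝ) {M k : ℕ} {x y : ℕ → ℝ} (h : ∀ i < M, x i = y i) :
    part g M k x = part g M k y := by
  unfold part
  congr 1
  refine Finset.sum_congr rfl fun B hB => setEval_congr g fun i hi => h i ?_
  exact Finset.mem_range.1 ((Finset.mem_powersetCard.1 (Finset.mem_filter.1 hB).1).1 hi)

lemma gam_congr (g : (Fin p → ℝ) → ℝ) {M : ℕ} {x y : ℕ → ℝ} (h : ∀ i < M, x i = y i) :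
    gam g M x = gam g M y := by
  unfold gam coordVar
  congr 1
  refine Finset.sum_congr rfl fun k _ => ?_
  congr 1
  funext s
  rw [part_congr g (y := Function.update y k s)]
  intro i hi
  by_cases hik : i = k
  · subst hik; simp
  · rw [Function.update_of_ne hik, Function.update_of_ne hik, h i hi]

lemma measurable_coordVar {Y : (ℕ → ℝ) → ℝ} (hY : Measurable Y) (k : ℕ) :
    Measurable (coordVar k Y) :=
  measurable_avg (hY.pow_const 2) k

lemma measurable_gam (hg : Measurable g) (N : ℕ) : Measurable (gam g N) :=
  (Finset.measurable_sum _ fun k _ => measurable_coordVar (measurable_part hg N k) k).const_mul _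

/-- The conditional variances are asymptotically within the limiting defect of one. -/
theorem eventually_integral_abs_one_sub_gam_le (hf : Kern f)
    (hG : ∀ k ∈ Finset.Icc 1 (2 * m), MemLp (kernelGhat m k f) 2 (halfPow k)) {δ : ℝ}
    (hδ : 0 < δ) :
    ∀ᶠ M in atTop, ∫ x, |1 - gam f M x| ∂conf ≤ √(varDefect m f) + δ := by
  obtain ⟨a, hlim, hle⟩ := exists_tendsto_integral_chaos_sq hf
  have ha0 : 0 ≤ a := (integral_nonneg fun _ => sq_nonneg _).trans (hle 0)
  -- Makes `ε a` at most `δ / 2`; the other half of `δ` absorbs the increment of the second moments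
  -- after `M`. The summand `1` covers `a = 0`.
  set ε : ℝ := δ / (2 * (a + 1)) with hεd
  have hε : 0 < ε := by positivity
  have hlim2 : Tendsto (fun M => (1 + ε⁻¹) * (a - ∫ x, chaos f M x ^ 2 ∂conf)) atTop (𝓝 0) := by
    have := (hlim.const_sub a).const_mul (1 + ε⁻¹)
    simpa using this
  filter_upwards [hlim2.eventually_lt_const (half_pos hδ)] with M hM
  -- The sign of `1 - Γ_M` depends only on the first `M` coordinates, hence is an admissible test
  -- function of norm one. It is kept fixed while `N` tends to infinity.
  let ψ : (ℕ → ℝ) → ℝ := fun x => if 0 ≤ 1 - gam f M x then 1 else -1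
  have hgm := measurable_gam hf.meas M
  have hψm : Measurable ψ := Measurable.ite (measurableSet_le measurable_const
    (measurable_const.sub hgm)) measurable_const measurable_const
  have hψ1 : ∀ x, |ψ x| = 1 := fun x => by
    simp only [ψ]; split_ifs <;> simp
  have hψb : ∃ C, ∀ x, |ψ x| ≤ C := ⟨1, fun x => (hψ1 x).le⟩
  have hT : TestFun (Finset.range M) ∅ ψ := by
    refine ⟨hψm, hψb, fun x y hxy => ?_, fun k hk => absurd hk (Finset.notMem_empty k)⟩
    have : gam f M x = gam f M y := gam_congr f fun i hi =>
      hxy i (by simpa using hi)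
    simp only [ψ, this]
  obtain ⟨ℓ, h1, h2⟩ := exists_limit_gam hf hG hT
  have hψ2 : ∫ x, ψ x ^ 2 ∂conf = 1 := by
    have : ∀ x, ψ x ^ 2 = 1 := fun x => by rw [← sq_abs, hψ1, one_pow]
    simp [this]
  rw [hψ2, Real.sqrt_one, mul_one] at h2
  have hsign : ∀ x, |1 - gam f M x| = (1 - gam f M x) * ψ x := fun x => by
    simp only [ψ]
    split_ifs with h
    · rw [abs_of_nonneg h, mul_one]
    · rw [abs_of_neg (not_le.1 h)]; ring
  have hkey : ∀ N, M ≤ N → ∫ x, |1 - gam f M x| ∂conf - δ ≤ ∫ x, (1 - gam f N x) * ψ x ∂conf := by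
    intro N hN
    have i1 : Integrable (fun x => (1 - gam f N x) * ψ x) conf :=
      integrable_mul_of_bdd ((integrable_const 1).sub (integrable_gam hf N)) hψm hψb
    have i2 : Integrable (fun x => |gam f N x - gam f M x|) conf :=
      ((integrable_gam hf N).sub (integrable_gam hf M)).abs
    have h3 : ∫ x, |1 - gam f M x| ∂conf ≤ ∫ x, (1 - gam f N x) * ψ x ∂conf +
        ∫ x, |gam f N x - gam f M x| ∂conf := by
      rw [← integral_add i1 i2]
      refine integral_mono ((integrable_const 1).sub (integrable_gam hf M)).abs (i1.add i2)
        fun x => ?_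
      simp only
      rw [hsign]
      have : (gam f N x - gam f M x) * ψ x ≤ |gam f N x - gam f M x| := by
        refine (le_abs_self _).trans (le_of_eq ?_)
        rw [abs_mul, hψ1, mul_one]
      linarith
    have h4 := integral_abs_gam_sub_le (Nat.succ_ne_zero m) hf hN hε
    rw [integral_chaos_sub_sq hf hN] at h4
    have h5 : (1 + ε⁻¹) * (∫ x, chaos f N x ^ 2 ∂conf - ∫ x, chaos f M x ^ 2 ∂conf) ≤
        (1 + ε⁻¹) * (a - ∫ x, chaos f M x ^ 2 ∂conf) :=
      mul_le_mul_of_nonneg_left (by linarith [hle N]) (by positivity)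
    have h6 : ε * ∫ x, chaos f M x ^ 2 ∂conf ≤ δ / 2 := by
      refine (mul_le_mul_of_nonneg_left ((hle M).trans (by linarith : a ≤ a + 1)) hε.le).trans
        (le_of_eq ?_)
      rw [hεd]; field_simp
    linarith
  have := ge_of_tendsto h1 ((eventually_ge_atTop M).mono hkey)
  linarith [(le_abs_self ℓ).trans h2]

end UniformChaos

namespace UniformChaos

variable {m k : ℕ} {f : (Fin (m + 1) → ℝ) → ℝ}

/-! ### The normal approximation of multiple sums -/

lemma memLp_three_of_lintegral {X : Type*} [MeasurableSpace X] {μ : Measure X} {u : X → ℝ}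
    (hu : Measurable u) (h : ∫⁻ x, ‖u x‖ₑ ^ 3 ∂μ ≠ ∞) :
    MemLp u 3 μ ∧ ENNReal.ofReal (∫ x, |u x| ^ 3 ∂μ) = ∫⁻ x, ‖u x‖ₑ ^ 3 ∂μ := by
  have e : ∀ x, ENNReal.ofReal (|u x| ^ 3) = ‖u x‖ₑ ^ 3 := fun x => by
    rw [ENNReal.ofReal_pow (abs_nonneg _), ← Real.norm_eq_abs, ofReal_norm]
  have h0 : ∀ᵐ x ∂μ, 0 ≤ |u x| ^ 3 := ae_of_all _ fun x => by positivity
  constructor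
  · refine ⟨hu.aestronglyMeasurable, ?_⟩
    rw [eLpNorm_lt_top_iff_lintegral_rpow_enorm_lt_top (by norm_num) (by norm_num)]
    have : ∀ x, ‖u x‖ₑ ^ (ENNReal.toReal 3) = ‖u x‖ₑ ^ 3 := fun x => by
      rw [← ENNReal.rpow_natCast]; norm_num
    simp_rw [this]
    exact h.lt_top
  · rw [ofReal_integral_eq_lintegral_ofReal _ h0]
    · exact lintegral_congr e
    · refine ⟨(hu.abs.pow_const 3).aestronglyMeasurable, ?_⟩
      rw [hasFiniteIntegral_iff_ofReal h0, lintegral_congr e]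
      exact h.lt_top

lemma ofReal_rpow_half {x : ℝ} (hx : 0 ≤ x) :
    ENNReal.ofReal x ^ (1 / 2 : ℝ) = ENNReal.ofReal (√x) := by
  rw [ENNReal.ofReal_rpow_of_nonneg hx (by norm_num), Real.sqrt_eq_rpow]

lemma normSq_nonneg {p : ℕ} (g : (Fin p → ℝ) → ℝ) : 0 ≤ normSq g :=
  integral_nonneg fun _ => sq_nonneg _

/-- The normal approximation of the multiple sums of a degenerate kernel. -/
theorem eventually_abs_integral_chaos_sub_gaussian_le (hf : Kern f)
    (hG : ∀ k ∈ Finset.Icc 1 (2 * m), MemLp (kernelGhat m k f) 2 (halfPow k))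
    (hK : ∫⁻ t, kernelMass m (sliceAt f t) ∂halfLeb ≠ ∞) {δ : ℝ} (hδ : 0 < δ) :
    ∀ᶠ M in atTop, ∀ h : ℝ → ℝ, LipschitzWith 1 h →
      |∫ x, h (chaos f M x) ∂conf - ∫ x, h x ∂gaussianReal 0 1| ≤
        √(varDefect m f) + δ + 2 * ((m + 1 : ℕ) : ℝ) ^ 2 * (√((m ! : ℝ) * normSq f) *
          √(∫⁻ t, kernelMass m (sliceAt f t) ∂halfLeb).toReal) := by
  filter_upwards [eventually_integral_abs_one_sub_gam_le hf hG hδ] with M hM h hh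
  set K := ∫⁻ t, kernelMass m (sliceAt f t) ∂halfLeb with hKd
  have hA : (m ! : ℝ≥0∞) * ∫⁻ x, ‖f x‖ₑ ^ 2 ∂halfPow (m + 1) = ENNReal.ofReal ((m ! : ℝ) * normSq f) := by
    rw [lintegral_enorm_sq_eq hf.memLp, ENNReal.ofReal_mul (by positivity), ENNReal.ofReal_natCast]
    rfl
  have hA0 : 0 ≤ (m ! : ℝ) * normSq f := mul_nonneg (by positivity) (normSq_nonneg f)
  have h1 := sum_lintegral_part_cube_le hf hK M
  rw [hA, ← hKd, ← ENNReal.ofReal_toReal hK, ofReal_rpow_half hA0,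
    ofReal_rpow_half ENNReal.toReal_nonneg, ← ENNReal.ofReal_mul (Real.sqrt_nonneg _),
    ← ENNReal.ofReal_natCast (m + 1), ← ENNReal.ofReal_pow (by positivity),
    ← ENNReal.ofReal_mul (by positivity)] at h1
  have h2 : ∀ k ∈ Finset.range M, ∫⁻ x, ‖part f M k x‖ₑ ^ 3 ∂conf ≠ ∞ :=
    ENNReal.sum_ne_top.1 (h1.trans_lt ENNReal.ofReal_lt_top).ne
  have h3 := fun k hk => memLp_three_of_lintegral (measurable_part hf.meas M k) (h2 k hk)
  have h4 : ∑ k ∈ Finset.range M, ∫ x, |part f M k x| ^ 3 ∂conf ≤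
      ((m + 1 : ℕ) : ℝ) ^ 3 * (√((m ! : ℝ) * normSq f) * √K.toReal) := by
    refine (ENNReal.ofReal_le_ofReal_iff (by positivity)).1 (le_trans (le_of_eq ?_) h1)
    rw [ENNReal.ofReal_sum_of_nonneg fun k _ => integral_nonneg fun x => by positivity]
    exact Finset.sum_congr rfl fun k hk => (h3 k hk).2
  have h5 := abs_integral_chaos_sub_gaussian_le (Nat.succ_ne_zero m) hf M
    (fun k hk => (h3 k (Finset.mem_range.2 hk)).1) hh
  refine h5.trans (add_le_add hM ?_)
  -- The factor `2 (m+1)⁻¹` of Stein's bound times the `(m+1)³` of the third moments gives `2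
  -- (m+1)²`.
  refine (mul_le_mul_of_nonneg_left h4 (by positivity)).trans (le_of_eq ?_)
  have : ((m + 1 : ℕ) : ℝ) ≠ 0 := by positivity
  field_simp

/-! ### Canonical functions have degenerate versions -/

/-- The configurations with all coordinates in pairwise distinct half-open blocks. -/
def separated (n : ℕ) : Set (Fin n → ℝ) :=
  {x | ∃ e : Fin n → ℕ, Function.Injective e ∧ ∀ i, x i ∈ block (e i)}

lemma measurableSet_separated (n : ℕ) : MeasurableSet (separated n) := by
  have : separated n = ⋃ e : Fin n → ℕ, ⋃ _ : Function.Injective e,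
      Set.univ.pi fun i => block (e i) := by
    ext x
    simp only [separated, Set.mem_ofPred_eq, Set.mem_iUnion, Set.mem_univ_pi, exists_prop]
  rw [this]
  exact MeasurableSet.iUnion fun e => MeasurableSet.iUnion fun _ =>
    MeasurableSet.univ_pi fun i => measurableSet_block _

lemma comp_perm_mem_separated {n : ℕ} {x : Fin n → ℝ} (σ : Equiv.Perm (Fin n)) :
    x ∘ σ ∈ separated n ↔ x ∈ separated n := by
  have h : ∀ (y : Fin n → ℝ) (τ : Equiv.Perm (Fin n)), y ∈ separated n →
      y ∘ τ ∈ separated n := fun y τ ⟨e, he, hy⟩ =>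
    ⟨e ∘ τ, he.comp τ.injective, fun i => hy (τ i)⟩
  refine ⟨fun hx => ?_, h x σ⟩
  have := h _ σ⁻¹ hx
  rwa [Function.comp_assoc, ← Equiv.Perm.coe_mul, mul_inv_cancel, Equiv.Perm.coe_one,
    Function.comp_id] at this

lemma ae_halfPow_eval {n : ℕ} {P : ℝ → Prop} (h : ∀ᵐ t ∂halfLeb, P t) :
    ∀ᵐ x ∂halfPow n, ∀ i, P (x i) :=
  ae_all_iff.2 fun i => (Measure.quasiMeasurePreserving_eval
    (μ := fun _ : Fin n => halfLeb) i).ae h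

lemma halfLeb_ae_ne (c : ℝ) : ∀ᵐ t ∂halfLeb, t ≠ c := by
  have : halfLeb ≪ volume := by
    unfold halfLeb
    exact (Measure.smul_absolutelyContinuous).trans Measure.restrict_le_self.absolutelyContinuous
  exact this (by simp)

/-- Closed and half-open blocks differ only by right end points, a null set. -/
lemma ae_mem_separated_of_mem_distinctBlocks (n : ℕ) :
    ∀ᵐ x ∂halfPow n, x ∈ distinctBlocks n → x ∈ separated n := by
  have h : ∀ᵐ t ∂halfLeb, ∀ j : ℕ, t ≠ 2 * (j : ℝ) + 2 :=
    ae_all_iff.2 fun j => halfLeb_ae_ne _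
  filter_upwards [ae_halfPow_eval h] with x hx
  rintro ⟨e, he, hxe⟩
  exact ⟨e, he, fun i => ⟨(hxe i).1, lt_of_le_of_ne (hxe i).2 (hx i (e i))⟩⟩

lemma quasiMeasurePreserving_perm {n : ℕ} (σ : Equiv.Perm (Fin n)) :
    Measure.QuasiMeasurePreserving (fun x : Fin n → ℝ => x ∘ σ) (halfPow n) (halfPow n) :=
  quasiMeasurePreserving_selection (fun _ => halfLeb) σ.injective

lemma integral_block_eq (u : ℝ → ℝ) (k : ℕ) :
    ∫ t in block k, u t ∂halfLeb
      = 2⁻¹ * ∫ t in (2 * (k : ℝ))..(2 * (k : ℝ) + 2), u t := by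
  change ∫ t, u t ∂blockMeas k = _
  rw [blockMeas_eq, integral_smul_measure, intervalIntegral.integral_of_le (by linarith),
    integral_Ioc_eq_integral_Ioo, block, integral_Ico_eq_integral_Ioo]
  simp

lemma ae_slice_eq {f' : (Fin (m + 1) → ℝ) → ℝ} (h : f =ᵐ[halfPow (m + 1)] f') :
    ∀ᵐ y ∂halfPow m, ∀ᵐ t ∂halfLeb, sliceAt f t y = sliceAt f' t y := by
  have h1 := (measurePreserving_fin_cons m).quasiMeasurePreserving.ae h
  have h2 := (Measure.measurePreserving_swap (μ := halfPow m)
    (ν := halfLeb)).quasiMeasurePreserving.ae h1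
  exact Measure.ae_ae_of_ae_prod h2

lemma ae_integral_block_eq_zero {f' : (Fin (m + 1) → ℝ) → ℝ} (hcan : IsCanonical f)
    (h : f =ᵐ[halfPow (m + 1)] f') :
    ∀ᵐ y ∂halfPow m, ∀ k : ℕ, ∫ t in block k, sliceAt f' t y ∂halfLeb = 0 := by
  filter_upwards [ae_slice_eq h, ae_all_iff.2 hcan] with y h1 h2 k
  have h3 : (fun t => sliceAt f t y) =ᵐ[halfLeb.restrict (block k)] fun t => sliceAt f' t y :=
    ae_restrict_of_ae h1
  rw [← integral_congr_ae h3, integral_block_eq, h2 k, mul_zero]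

/-- A canonical function agrees almost everywhere with a degenerate kernel. -/
theorem exists_kern (hf : MemHatL2 f) (hcan : IsCanonical f) :
    ∃ f', Kern f' ∧ f =ᵐ[halfPow (m + 1)] f' := by
  obtain ⟨f₀, hm₀, he₀⟩ := hf.memLp.aestronglyMeasurable
  have hm₀ := hm₀.measurable
  -- Averaging a measurable version over permutations and cutting it off outside `separated` make
  -- symmetry and vanishing hold everywhere, at the cost of a null set only.
  set f₁ : (Fin (m + 1) → ℝ) → ℝ := symmetrize f₀ with hf₁
  set f' := (separated (m + 1)).indicator f₁ with hf'
  have hm₁ : Measurable f₁ := (Finset.measurable_sum _ fun σ _ =>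
    hm₀.comp (measurable_pi_iff.2 fun i => measurable_pi_apply _)).const_mul _
  have he₁ : f =ᵐ[halfPow (m + 1)] f₁ := by
    have h1 : ∀ᵐ x ∂halfPow (m + 1), ∀ σ : Equiv.Perm (Fin (m + 1)), f₀ (x ∘ σ) = f x := by
      refine ae_all_iff.2 fun σ => ?_
      filter_upwards [(quasiMeasurePreserving_perm σ).ae he₀, hf.symm σ] with x h1 h2
      rw [← h1, h2]
    filter_upwards [h1] with x hx
    rw [hf₁, symmetrize, Finset.sum_congr rfl fun σ _ => hx σ, Finset.sum_const, Finset.card_univ,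
      Fintype.card_perm, Fintype.card_fin, nsmul_eq_mul]
    have : (((m + 1)! : ℕ) : ℝ) ≠ 0 := by exact_mod_cast (Nat.factorial_pos _).ne'
    field_simp
  have he' : f =ᵐ[halfPow (m + 1)] f' := by
    filter_upwards [he₁, hf.vanish, ae_mem_separated_of_mem_distinctBlocks (m + 1)] with x h1 h2 h3
    by_cases hx : x ∈ separated (m + 1)
    · rw [hf', Set.indicator_of_mem hx, h1]
    · rw [hf', Set.indicator_of_notMem hx, h2 fun h => hx (h3 h)]
  have hs' : SymmFun f' := fun σ x => by
    rw [hf']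
    by_cases hx : x ∈ separated (m + 1)
    · rw [Set.indicator_of_mem hx, Set.indicator_of_mem ((comp_perm_mem_separated σ).2 hx)]
      exact symmFun_symmetrize f₀ σ x
    · rw [Set.indicator_of_notMem hx,
        Set.indicator_of_notMem (fun h => hx ((comp_perm_mem_separated σ).1 h))]
  refine ⟨f', ⟨hm₁.indicator (measurableSet_separated _), hs', fun e x hx he => ?_,
    (memLp_congr_ae he').1 hf.memLp, fun B b hb => ?_⟩, he'⟩
  · refine Set.indicator_of_notMem ?_ _
    rintro ⟨e', he'i, hxe'⟩
    have : e = e' := funext fun i => block_eq_of_mem (hx i) (hxe' i)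
    exact he (this ▸ he'i)
  · by_cases hB : B.card = m + 1
    swap
    · exact ae_of_all _ fun x => by simp [setEval_of_card_ne hB]
    have hB' : (B.erase b).card = m := by rw [Finset.card_erase_of_mem hb, hB]; rfl
    obtain ⟨e, he, him⟩ := exists_enum hB'
    have hbe : b ∉ B.erase b := Finset.notMem_erase b B
    -- The canonical property holds for almost every value of the other variables; pulled back along
    -- the coordinates in `B.erase b` it becomes an almost sure statement on the configuration.
    filter_upwards [(quasiMeasurePreserving_conf_comp he).ae
      (ae_integral_block_eq_zero hcan he')] with x hx
    rw [← hx b]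
    refine integral_congr_ae (ae_of_all _ fun s => ?_)
    simp only
    rw [← Finset.insert_erase hb, ← setEval_sliceAt hs' hbe s x,
      setEval_eq (symmFun_sliceAt hs' s) he him]

end UniformChaos

namespace UniformChaos

variable {m k : ℕ} {f f' : (Fin (m + 1) → ℝ) → ℝ}

/-! ### Kernels of functions that agree almost everywhere -/

/-- The selection may discard variables of infinite measure, so only null sets are respected; this
suffices to exchange versions inside contractions. -/
lemma quasiMeasurePreserving_cons_elim {l : ℕ} {s : Fin m → Fin l ⊕ Fin k}
    (hs : Function.Injective s) :
    Measure.QuasiMeasurePreserving (fun q : (ℝ × (Fin k → ℝ)) × (Fin l → ℝ) =>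
      (Fin.cons q.1.1 ((Sum.elim q.2 q.1.2 : Fin l ⊕ Fin k → ℝ) ∘ s) : Fin (m + 1) → ℝ))
      ((halfLeb.prod (halfPow k)).prod (halfPow l)) (halfPow (m + 1)) := by
  have h1 := (measurePreserving_prodAssoc halfLeb (halfPow k) (halfPow l)).quasiMeasurePreserving
  have h2 := (measurePreserving_sumElim (fun _ : Fin l => halfLeb)
    (fun _ : Fin k => halfLeb)).quasiMeasurePreserving
  have e : Sum.elim (fun _ : Fin l => halfLeb) (fun _ : Fin k => halfLeb) = fun _ => halfLeb := by
    funext c; rcases c with c | c <;> rfl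
  rw [e] at h2
  have h3 := quasiMeasurePreserving_selection (fun _ : Fin l ⊕ Fin k => halfLeb) hs
  have h4 : Measure.QuasiMeasurePreserving (Prod.swap (α := Fin k → ℝ) (β := Fin l → ℝ))
      ((halfPow k).prod (halfPow l)) ((halfPow l).prod (halfPow k)) :=
    (Measure.measurePreserving_swap).quasiMeasurePreserving
  have h5 := QuasiMeasurePreserving.prodMap (Measure.QuasiMeasurePreserving.id halfLeb) ((h3.comp h2).comp h4)
  exact (measurePreserving_fin_cons m).quasiMeasurePreserving.comp (h5.comp h1)

lemma ae_contraction_sliceAt_eq (h : f =ᵐ[halfPow (m + 1)] f') {r l : ℕ} (hl : l ≤ r) (hr : r ≤ m)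
    (hk : r + l + k = 2 * m) :
    ∀ᵐ q ∂halfLeb.prod (halfPow k), contraction r l (sliceAt f q.1) (sliceAt f q.1) q.2
      = contraction r l (sliceAt f' q.1) (sliceAt f' q.1) q.2 := by
  have h1 := (quasiMeasurePreserving_cons_elim (sel₁_injective hl hr hk)).ae h
  have h2 := (quasiMeasurePreserving_cons_elim (sel₂_injective hl hr hk)).ae h
  filter_upwards [Measure.ae_ae_of_ae_prod h1, Measure.ae_ae_of_ae_prod h2] with q hq1 hq2
  rw [contraction_eq hl hr hk, contraction_eq hl hr hk]
  refine integral_congr_ae ?_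
  filter_upwards [hq1, hq2] with z hz1 hz2
  unfold sliceAt
  rw [hz1, hz2]

theorem ae_kernelG_sliceAt_eq (h : f =ᵐ[halfPow (m + 1)] f') (k : ℕ) :
    ∀ᵐ q ∂halfLeb.prod (halfPow k), kernelG m k (sliceAt f q.1) q.2
      = kernelG m k (sliceAt f' q.1) q.2 := by
  have h1 : ∀ᵐ q ∂halfLeb.prod (halfPow k), ∀ r l : ℕ, l ≤ r → r ≤ m → r + l + k = 2 * m →
      ∀ σ : Equiv.Perm (Fin k), contraction r l (sliceAt f q.1) (sliceAt f q.1) (q.2 ∘ σ)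
      = contraction r l (sliceAt f' q.1) (sliceAt f' q.1) (q.2 ∘ σ) := by
    refine ae_all_iff.2 fun r => ae_all_iff.2 fun l => ?_
    by_cases hc : l ≤ r ∧ r ≤ m ∧ r + l + k = 2 * m
    · obtain ⟨hl, hr, hk⟩ := hc
      have : ∀ᵐ q ∂halfLeb.prod (halfPow k), ∀ σ : Equiv.Perm (Fin k),
          contraction r l (sliceAt f q.1) (sliceAt f q.1) (q.2 ∘ σ)
          = contraction r l (sliceAt f' q.1) (sliceAt f' q.1) (q.2 ∘ σ) :=
        ae_all_iff.2 fun σ => (QuasiMeasurePreserving.prodMap (Measure.QuasiMeasurePreserving.id halfLeb)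
          (quasiMeasurePreserving_perm σ)).ae (ae_contraction_sliceAt_eq h hl hr hk)
      filter_upwards [this] with q hq _ _ _ σ using hq σ
    · exact ae_of_all _ fun q hl hr hk => absurd ⟨hl, hr, hk⟩ hc
  filter_upwards [h1] with q hq
  unfold kernelG
  by_cases hx : q.2 ∈ distinctBlocks k
  · rw [Set.indicator_of_mem hx, Set.indicator_of_mem hx]
    refine Finset.sum_congr rfl fun r hr => Finset.sum_congr rfl fun l hl => ?_
    rw [Finset.mem_range] at hr hl
    split_ifs with hk
    · unfold symmetrize
      congr 2
      exact Finset.sum_congr rfl fun σ _ => hq r l (by omega) (by omega) hk σ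
    · rfl
  · rw [Set.indicator_of_notMem hx, Set.indicator_of_notMem hx]

lemma ae_kernelG_sliceAt_ae_eq (h : f =ᵐ[halfPow (m + 1)] f') (k : ℕ) :
    ∀ᵐ t ∂halfLeb, kernelG m k (sliceAt f t) =ᵐ[halfPow k] kernelG m k (sliceAt f' t) :=
  Measure.ae_ae_of_ae_prod (ae_kernelG_sliceAt_eq h k)

lemma kernelGhat_ae_eq (h : f =ᵐ[halfPow (m + 1)] f') (k : ℕ) :
    kernelGhat m k f =ᵐ[halfPow k] kernelGhat m k f' := by
  have h1 := (Measure.measurePreserving_swap (μ := halfPow k)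
    (ν := halfLeb)).quasiMeasurePreserving.ae (ae_kernelG_sliceAt_eq h k)
  filter_upwards [Measure.ae_ae_of_ae_prod h1] with x hx
  exact integral_congr_ae hx

lemma lintegral_halfLeb (u : ℝ → ℝ≥0∞) :
    ∫⁻ t in Set.Ici (0 : ℝ), u t = 2 * ∫⁻ t, u t ∂halfLeb := by
  unfold halfLeb
  rw [lintegral_smul_measure, smul_eq_mul, ← mul_assoc, ENNReal.mul_inv_cancel (by norm_num)
    (by norm_num), one_mul]

lemma ae_restrict_Ici_of_ae_halfLeb {P : ℝ → Prop} (h : ∀ᵐ t ∂halfLeb, P t) :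
    ∀ᵐ t ∂(volume : Measure ℝ).restrict (Set.Ici 0), P t := by
  unfold halfLeb at h
  rwa [Measure.ae_ennreal_smul_measure_iff (by norm_num)] at h

/-- The second sum of the main estimate in terms of a degenerate version of the kernel. -/
lemma sum_lintegral_kernelG_eq (h : f =ᵐ[halfPow (m + 1)] f') (hf' : Measurable f') :
    ∑ k ∈ Finset.range (2 * m + 1), (k ! : ℝ≥0∞) * ∫⁻ t in Set.Ici (0 : ℝ),
      eLpNorm (kernelG m k (sliceAt f t)) 2 (halfPow k) ^ 2
      = 2 * ∫⁻ t, kernelMass m (sliceAt f' t) ∂halfLeb := by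
  unfold kernelMass
  rw [lintegral_finsetSum, Finset.mul_sum]
  · refine Finset.sum_congr rfl fun k _ => ?_
    rw [lintegral_const_mul' _ _ (by finiteness), mul_left_comm, ← lintegral_halfLeb]
    congr 1
    refine lintegral_congr_ae ?_
    filter_upwards [ae_restrict_Ici_of_ae_halfLeb (ae_kernelG_sliceAt_ae_eq h k)] with t ht
    rw [eLpNorm_congr_ae ht, eLpNorm_two_sq]
  · intro k _
    refine Measurable.const_mul ?_ _
    exact Measurable.lintegral_prod_right' (f := fun q : ℝ × (Fin k → ℝ) =>
      ‖kernelG m k (sliceAt f' q.1) q.2‖ₑ ^ 2)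
      ((measurable_kernelG_param (measurable_uncurry_sliceAt hf')).enorm.pow_const 2)

lemma contraction_zero {p r l : ℕ} (x : Fin k → ℝ) :
    contraction r l (0 : (Fin p → ℝ) → ℝ) (0 : (Fin p → ℝ) → ℝ) x = 0 := by
  simp [contraction]

lemma kernelMass_zero (p : ℕ) : kernelMass p 0 = 0 := by
  simp [kernelMass, kernelG, symmetrize, contraction_zero, Set.indicator]

/-- Used in contrapositive form: an infinite second sum forces `f` to be nonzero, so that the bound
really is infinite and the convention `0 · ∞ = 0` does no harm. -/
lemma lintegral_kernelMass_eq_zero (h : f =ᵐ[halfPow (m + 1)] 0) :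
    ∑ k ∈ Finset.range (2 * m + 1), (k ! : ℝ≥0∞) * ∫⁻ t in Set.Ici (0 : ℝ),
      eLpNorm (kernelG m k (sliceAt f t)) 2 (halfPow k) ^ 2 = 0 := by
  rw [sum_lintegral_kernelG_eq h measurable_zero]
  have : ∀ t, sliceAt (0 : (Fin (m + 1) → ℝ) → ℝ) t = 0 := fun t => rfl
  simp [this, kernelMass_zero]

end UniformChaos

namespace UniformChaos

variable {m : ℕ} {f f' : (Fin (m + 1) → ℝ) → ℝ}

/-! ### The configuration of a sequence of uniform random variables -/

section Config
variable {Ω : Type*} [MeasurableSpace Ω]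

/-- The configuration `(2k + 1 + U_k)_k`. -/
def config (U : ℕ → Ω → ℝ) (ω : Ω) (k : ℕ) : ℝ := 2 * (k : ℝ) + 1 + U k ω

lemma map_config_eq {P : Measure Ω} {U : Ω → ℝ} (hU : Measurable U)
    (h : pdf.IsUniform U (Set.Icc (-1 : ℝ) 1) P volume) (k : ℕ) :
    P.map (fun ω => 2 * (k : ℝ) + 1 + U ω) = blockMeas k := by
  have h1 : (fun ω => 2 * (k : ℝ) + 1 + U ω) = (fun u => 2 * (k : ℝ) + 1 + u) ∘ U := rfl
  have hm : Measurable fun u : ℝ => 2 * (k : ℝ) + 1 + u := measurable_const_add _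
  rw [h1, ← Measure.map_map hm hU]
  unfold pdf.IsUniform at h
  rw [h, ProbabilityTheory.cond, Measure.map_smul, blockMeas_eq]
  have h2 : (fun u : ℝ => 2 * (k : ℝ) + 1 + u) ⁻¹' Set.Icc (2 * (k : ℝ)) (2 * (k : ℝ) + 2)
      = Set.Icc (-1 : ℝ) 1 := by
    ext u
    simp only [Set.mem_preimage, Set.mem_Icc]
    constructor
    · rintro ⟨h1, h2⟩; constructor <;> linarith
    · rintro ⟨h1, h2⟩; constructor <;> linarith
  rw [← h2, ← Measure.restrict_map hm measurableSet_Icc, map_add_left_eq_self, h2,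
    Real.volume_Icc, block, restrict_Ico_eq_restrict_Icc]
  norm_num

lemma measurable_config {U : ℕ → Ω → ℝ} (hU : ∀ k, Measurable (U k)) : Measurable (config U) :=
  measurable_pi_iff.2 fun k => (hU k).const_add _

lemma measurePreserving_config {P : Measure Ω} [IsProbabilityMeasure P] {U : ℕ → Ω → ℝ}
    (hU : ∀ k, Measurable (U k)) (hi : iIndepFun U P)
    (hunif : ∀ k, pdf.IsUniform (U k) (Set.Icc (-1 : ℝ) 1) P volume) :
    MeasurePreserving (config U) P conf := by
  refine ⟨measurable_config hU, ?_⟩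
  have h1 : iIndepFun (fun (k : ℕ) ω => 2 * (k : ℝ) + 1 + U k ω) P :=
    hi.comp (fun (k : ℕ) u => 2 * (k : ℝ) + 1 + u) fun k => measurable_const_add _
  have h2 := h1.map_fun_eq_infinitePi_map fun k => (hU k).const_add _
  change P.map (fun ω (k : ℕ) => 2 * (k : ℝ) + 1 + U k ω) = conf
  rw [h2, conf]
  congr 1
  funext k
  exact map_config_eq (hU k) (hunif k) k

end Config

/-! ### The explicit formula on truncated canonical functions -/

/-- The arguments of the integrand in the explicit formula. -/
def joined {n r : ℕ} (e : Fin r → ℕ) (x : ℕ → ℝ) (y : Fin (n - r) → ℝ) (j : Fin n) : ℝ :=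
  if h : (j : ℕ) < r then x (e ⟨j, h⟩) else y ⟨j - r, by omega⟩

lemma quasiMeasurePreserving_joined {n r : ℕ} (hr : r ≤ n) {e : Fin r → ℕ}
    (he : Function.Injective e) :
    Measure.QuasiMeasurePreserving (fun q : (ℕ → ℝ) × (Fin (n - r) → ℝ) =>
      joined (n := n) e q.1 q.2) (conf.prod (halfPow (n - r))) (halfPow n) := by
  let s : Fin n → Fin r ⊕ Fin (n - r) := fun j =>
    if h : (j : ℕ) < r then Sum.inl ⟨j, h⟩ else Sum.inr ⟨j - r, by omega⟩
  have hs : Function.Injective s := by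
    intro i j hij
    simp only [s] at hij
    ext
    split_ifs at hij <;> simp at hij <;> omega
  have h1 := QuasiMeasurePreserving.prodMap (quasiMeasurePreserving_conf_comp he)
    (Measure.QuasiMeasurePreserving.id (halfPow (n - r)))
  have h2 := (measurePreserving_sumElim (fun _ : Fin r => halfLeb)
    (fun _ : Fin (n - r) => halfLeb)).quasiMeasurePreserving
  have e2 : Sum.elim (fun _ : Fin r => halfLeb) (fun _ : Fin (n - r) => halfLeb)
      = fun _ => halfLeb := by
    funext c; rcases c with c | c <;> rfl
  rw [e2] at h2
  have h3 := (quasiMeasurePreserving_selection (fun _ : Fin r ⊕ Fin (n - r) => halfLeb) hs).comp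
    (h2.comp h1)
  refine (congrArg (fun u => Measure.QuasiMeasurePreserving u (conf.prod (halfPow (n - r)))
    (halfPow n)) ?_).mpr h3
  funext q j
  simp only [joined, Function.comp_apply, Prod.map_fst, Prod.map_snd, s]
  split_ifs <;> simp

lemma ae_integrableOn_block_sliceAt (hf : Kern f) :
    ∀ᵐ y ∂halfPow m, ∀ k, IntegrableOn (fun t => sliceAt f t y) (block k) halfLeb := by
  have h1 : ∀ᵐ y ∂halfPow m, Integrable (fun t => sliceAt f t y ^ 2) halfLeb :=
    (memLp_uncurry_sliceAt hf).integrable_sq.prod_left_ae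
  have hm : ∀ y, Measurable fun t => sliceAt f t y := fun y =>
    (measurable_uncurry_sliceAt hf.meas).comp measurable_prodMk_right
  filter_upwards [h1] with y hy k
  have h2 : MemLp (fun t => sliceAt f t y) 2 (blockMeas k) :=
    ((memLp_two_iff_integrable_sq (hm y).aestronglyMeasurable).2 hy).mono_measure
      Measure.restrict_le_self
  exact h2.integrable (by norm_num)

/-- Up to a null set, the truncated half-line is the union of the first `N` blocks, over each of
which the integral vanishes. -/
lemma ae_integral_trunc_eq_zero (hf : Kern f)
    (h0 : ∀ᵐ y ∂halfPow m, ∀ k : ℕ, ∫ t in block k, sliceAt f t y ∂halfLeb = 0) (N : ℕ) :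
    ∀ᵐ y ∂halfPow m, ∫ t in Set.Iio (2 * (N : ℝ)), sliceAt f t y ∂halfLeb = 0 := by
  have hset : (Set.Iio (2 * (N : ℝ)) : Set ℝ) =ᵐ[halfLeb] ⋃ k ∈ Finset.range N, block k := by
    filter_upwards [halfLeb_ae_mem_block] with t ⟨k, hk⟩
    refine propext ⟨fun h => ?_, fun h => ?_⟩
    · refine Set.mem_biUnion (Finset.mem_coe.2 (Finset.mem_range.2 ?_)) hk
      have h1 : (k : ℝ) < N := by
        have : t < 2 * (N : ℝ) := h
        linarith [hk.1]
      exact_mod_cast h1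
    · obtain ⟨j, hj, ht⟩ := Set.mem_iUnion₂.1 h
      have h1 : ((j + 1 : ℕ) : ℝ) ≤ N := by
        exact_mod_cast Finset.mem_range.1 (Finset.mem_coe.1 hj)
      have h2 : t < 2 * (N : ℝ) := by push_cast at h1; linarith [ht.2]
      exact h2
  filter_upwards [h0, ae_integrableOn_block_sliceAt hf] with y h1 h2
  rw [setIntegral_congr_set hset, integral_biUnion_finset _ (fun k _ => measurableSet_block k)
    (pairwiseDisjoint_block _) fun k _ => h2 k]
  exact Finset.sum_eq_zero fun k _ => h1 k

/-- The first of the integrated variables stands at position `r` of the joined argument. -/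
lemma joined_cons {r q : ℕ} (hq : m + 1 - r = q + 1) (e : Fin r → ℕ) (x : ℕ → ℝ) (t : ℝ)
    (y : Fin q → ℝ) :
    joined (n := m + 1) e x (fun i => (Fin.cons t y : Fin (q + 1) → ℝ) (Fin.cast hq i))
      = Fin.insertNth (⟨r, by omega⟩ : Fin (m + 1)) t
        (joined (n := m) e x fun i : Fin (m - r) => y (Fin.cast (by omega) i)) := by
  refine Fin.eq_insertNth_iff.2 ⟨?_, ?_⟩
  · simp [joined]
  · funext j
    by_cases hj : (j : ℕ) < r
    · have h1 : (⟨r, by omega⟩ : Fin (m + 1)).succAbove j = j.castSucc :=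
        Fin.succAbove_of_castSucc_lt _ _ (by simpa [Fin.lt_def] using hj)
      simp [Fin.removeNth, h1, joined, hj]
    · have h1 : (⟨r, by omega⟩ : Fin (m + 1)).succAbove j = j.succ :=
        Fin.succAbove_of_le_castSucc _ _ (by simpa [Fin.le_def] using hj)
      have h2 : ¬ (j : ℕ) + 1 < r := by omega
      have h3 : Fin.cast hq (⟨(j : ℕ) + 1 - r, by omega⟩ : Fin (m + 1 - r))
          = Fin.succ ⟨j - r, by omega⟩ := by
        ext; simp; omega
      simp only [Fin.removeNth, h1, joined, hj, Fin.val_succ, h2, h3, dite_false, Fin.cons_succ]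
      rfl

lemma measurePreserving_finCast {a b : ℕ} (h : a = b) :
    MeasurePreserving (fun (y : Fin b → ℝ) (i : Fin a) => y (Fin.cast h i)) (halfPow b)
      (halfPow a) := by
  subst h
  exact MeasurePreserving.id _

lemma truncSupp_apply (N : ℕ) {n : ℕ} (g : (Fin n → ℝ) → ℝ) (x : Fin n → ℝ) [Decidable (∀ i, x i < 2 * (N : ℝ))] :
    truncSupp N g x = if ∀ i, x i < 2 * (N : ℝ) then g x else 0 := by
  simp [truncSupp, Set.indicator]

lemma symmFun_truncSupp {n : ℕ} {g : (Fin n → ℝ) → ℝ} (hg : SymmFun g) (N : ℕ) :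
    SymmFun (truncSupp N g) := by
  classical
  intro σ x
  have : (∀ i, (x ∘ σ) i < 2 * (N : ℝ)) ↔ ∀ i, x i < 2 * (N : ℝ) :=
    ⟨fun h i => by simpa using h (σ.symm i), fun h i => h _⟩
  simp only [truncSupp_apply, this, hg σ x]

lemma integral_truncSupp_cons_eq_zero {N : ℕ} {y : Fin m → ℝ}
    (h : ∫ t in Set.Iio (2 * (N : ℝ)), sliceAt f t y ∂halfLeb = 0) :
    ∫ t, truncSupp N f (Fin.cons t y) ∂halfLeb = 0 := by
  classical
  by_cases hy : ∀ i, y i < 2 * (N : ℝ)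
  · rw [← h, ← integral_indicator measurableSet_Iio]
    refine integral_congr_ae (ae_of_all _ fun t => ?_)
    simp only [truncSupp_apply, Fin.forall_fin_succ, Fin.cons_zero, Fin.cons_succ, hy,
      implies_true, and_true, Set.indicator, Set.mem_Iio]
    rfl
  · refine integral_eq_zero_of_ae (ae_of_all _ fun t => ?_)
    simp only [truncSupp_apply, Fin.forall_fin_succ, Fin.cons_zero, Fin.cons_succ, hy, and_false,
      if_false, Pi.zero_apply]

/-- The lower order terms of the explicit formula vanish for canonical functions. -/
lemma ae_integral_truncSupp_joined_eq_zero (hf' : Kern f') (h : f =ᵐ[halfPow (m + 1)] f')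
    (hcan : IsCanonical f) {r : ℕ} (hr : r < m + 1) {e : Fin r → ℕ} (he : Function.Injective e)
    (N : ℕ) :
    ∀ᵐ x ∂conf, ∫ y : Fin (m + 1 - r) → ℝ, truncSupp N f (joined e x y) ∂halfPow (m + 1 - r) = 0 := by
  classical
  obtain ⟨q, hq⟩ : ∃ q, m + 1 - r = q + 1 := ⟨m - r, by omega⟩
  have hq' : m - r = q := by omega
  have hA := Measure.ae_ae_of_ae_prod ((quasiMeasurePreserving_joined hr.le he).ae h)
  have hZ := ae_integral_trunc_eq_zero hf' (ae_integral_block_eq_zero hcan h) N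
  have hJ : Measure.QuasiMeasurePreserving (fun w : (ℕ → ℝ) × (Fin q → ℝ) =>
      joined (n := m) e w.1 fun i : Fin (m - r) => w.2 (Fin.cast hq' i))
      (conf.prod (halfPow q)) (halfPow m) :=
    (quasiMeasurePreserving_joined (n := m) (by omega) he).comp
      (QuasiMeasurePreserving.prodMap (Measure.QuasiMeasurePreserving.id conf)
        (measurePreserving_finCast hq').quasiMeasurePreserving)
  have hB := Measure.ae_ae_of_ae_prod (hJ.ae hZ)
  have hC : MeasurePreserving (fun (w : ℝ × (Fin q → ℝ)) (i : Fin (m + 1 - r)) =>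
      (Fin.cons w.1 w.2 : Fin (q + 1) → ℝ) (Fin.cast hq i)) (halfLeb.prod (halfPow q))
      (halfPow (m + 1 - r)) := (measurePreserving_finCast hq).comp (measurePreserving_fin_cons q)
  filter_upwards [hA, hB] with x hx1 hx2
  have e1 : ∫ y : Fin (m + 1 - r) → ℝ, truncSupp N f (joined e x y) ∂halfPow (m + 1 - r)
      = ∫ y : Fin (m + 1 - r) → ℝ, truncSupp N f' (joined e x y) ∂halfPow (m + 1 - r) := by
    refine integral_congr_ae ?_
    filter_upwards [hx1] with y hy
    rw [truncSupp_apply, truncSupp_apply, hy]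
  rw [e1]
  -- No integrability for fixed `x` has to be proved: without it the integral is zero by convention.
  by_cases hi : Integrable (fun y : Fin (m + 1 - r) → ℝ => truncSupp N f' (joined e x y))
    (halfPow (m + 1 - r))
  swap
  · exact integral_undef hi
  have hi' := hC.integrable_comp_of_integrable hi
  simp only [Function.comp_def] at hi'
  have e2 : ∫ y : Fin (m + 1 - r) → ℝ, truncSupp N f' (joined e x y) ∂halfPow (m + 1 - r)
      = ∫ w : ℝ × (Fin q → ℝ), truncSupp N f' (joined e x fun i : Fin (m + 1 - r) =>
        (Fin.cons w.1 w.2 : Fin (q + 1) → ℝ) (Fin.cast hq i)) ∂halfLeb.prod (halfPow q) := by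
    have hs : AEStronglyMeasurable (fun y : Fin (m + 1 - r) → ℝ => truncSupp N f' (joined e x y))
        (Measure.map (fun (w : ℝ × (Fin q → ℝ)) (i : Fin (m + 1 - r)) =>
      (Fin.cons w.1 w.2 : Fin (q + 1) → ℝ) (Fin.cast hq i)) (halfLeb.prod (halfPow q))) := by
      rw [hC.map_eq]; exact hi.aestronglyMeasurable
    rw [← integral_map hC.measurable.aemeasurable hs, hC.map_eq]
  rw [e2, integral_prod_symm _ hi']
  refine integral_eq_zero_of_ae ?_
  filter_upwards [hx2] with y hy
  simp only [Pi.zero_apply]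
  rw [← integral_truncSupp_cons_eq_zero hy]
  refine integral_congr_ae (ae_of_all _ fun t => ?_)
  simp only
  -- By symmetry a cyclic permutation brings the variable at position `r` to the front, where the
  -- canonical property applies.
  rw [joined_cons hq, ← Fin.cons_comp_cycleRange, symmFun_truncSupp hf'.symm N]

/-- No variable is left to integrate; the measure on the one-point space has mass one. -/
lemma integral_truncSupp_joined_self {n : ℕ} (g : (Fin n → ℝ) → ℝ) (e : Fin n → ℕ) (x : ℕ → ℝ)
    (N : ℕ) :
    ∫ y : Fin (n - n) → ℝ, truncSupp N g (joined e x y) ∂halfPow (n - n) = truncSupp N g (x ∘ e) := by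
  have h1 : ∀ y : Fin (n - n) → ℝ, joined e x y = x ∘ e := fun y => by
    funext j
    simp [joined]
  have h2 : ∀ q : ℕ, q = 0 → (halfPow q).real Set.univ = 1 := fun q hq => by
    subst hq
    simp [halfPow, Measure.real]
  simp_rw [h1]
  rw [integral_const, h2 _ (Nat.sub_self n), one_smul]

/-- The top order term of the explicit formula is the multiple sum. -/
lemma tsum_truncSupp_eq_chaos {n : ℕ} {g : (Fin n → ℝ) → ℝ} (hg : SymmFun g) (N : ℕ) {x : ℕ → ℝ}
    (hx : ∀ k, x k ∈ block k) : ∑' e : Fin n ↪ ℕ, truncSupp N g (x ∘ e) = chaos g N x := by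
  classical
  have hlt : ∀ k : ℕ, x k < 2 * (N : ℝ) ↔ k < N := fun k => by
    constructor
    · intro h
      have : (k : ℝ) < N := by linarith [(hx k).1]
      exact_mod_cast this
    · intro h
      have : ((k + 1 : ℕ) : ℝ) ≤ N := by exact_mod_cast h
      push_cast at this
      linarith [(hx k).2]
  rw [chaos, ← sum_injective_image (p := n) (Finset.range N) fun B => setEval g B x,
    ← (Equiv.subtypeInjectiveEquivEmbedding (Fin n) ℕ).tsum_eq]
  have h1 := tsum_subtype {e : Fin n → ℕ | Function.Injective e} fun e => truncSupp N g (x ∘ e)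
  refine Eq.trans h1 ?_
  rw [tsum_eq_sum (s := (Fintype.piFinset fun _ : Fin n => Finset.range N).filter
    Function.Injective)]
  · refine Finset.sum_congr rfl fun e he => ?_
    obtain ⟨he1, he2⟩ := Finset.mem_filter.1 he
    rw [Set.indicator_of_mem (show e ∈ {e : Fin n → ℕ | Function.Injective e} from he2),
      setEval_eq hg he2 rfl, truncSupp_apply, if_pos]
    exact fun i => (hlt _).2 (Finset.mem_range.1 (Fintype.mem_piFinset.1 he1 i))
  · intro e he
    by_cases hinj : Function.Injective e
    · rw [Set.indicator_of_mem (show e ∈ {e : Fin n → ℕ | Function.Injective e} from hinj),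
        truncSupp_apply, if_neg]
      intro hall
      exact he (Finset.mem_filter.2 ⟨Fintype.mem_piFinset.2 fun i =>
        Finset.mem_range.2 ((hlt _).1 (hall i)), hinj⟩)
    · exact Set.indicator_of_notMem hinj _

/-- The explicit formula applied to the truncations of a canonical function. -/
theorem explicitIntegral_truncSupp_ae_eq {Ω : Type*} [MeasurableSpace Ω] {P : Measure Ω}
    {U : ℕ → Ω → ℝ} (hU : MeasurePreserving (config U) P conf) (hf' : Kern f')
    (h : f =ᵐ[halfPow (m + 1)] f') (hcan : IsCanonical f) (N : ℕ) :
    explicitIntegral U (truncSupp N f) =ᵐ[P] fun ω => chaos f' N (config U ω) := by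
  classical
  have hcount : ∀ r, Countable (Fin r ↪ ℕ) := fun r => DFunLike.coe_injective.countable
  have h1 : ∀ᵐ x ∂conf, ∀ r : ℕ, r < m + 1 → ∀ e : Fin r ↪ ℕ,
      ∫ y : Fin (m + 1 - r) → ℝ, truncSupp N f (joined e x y) ∂halfPow (m + 1 - r) = 0 := by
    refine ae_all_iff.2 fun r => ?_
    by_cases hr : r < m + 1
    · have := ae_all_iff.2 fun e : Fin r ↪ ℕ =>
        ae_integral_truncSupp_joined_eq_zero hf' h hcan hr e.injective N
      filter_upwards [this] with x hx _ using hx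
    · exact ae_of_all _ fun x hr' => absurd hr' hr
  have h2 : ∀ᵐ x ∂conf, ∀ e : Fin (m + 1) ↪ ℕ, f (x ∘ e) = f' (x ∘ e) :=
    ae_all_iff.2 fun e => (quasiMeasurePreserving_conf_comp e.injective).ae h
  have h3 : ∀ᵐ x ∂conf, (∑ r ∈ Finset.range (m + 1 + 1), (-1 : ℝ) ^ (m + 1 - r) *
      ((m + 1).choose r : ℝ) * ∑' e : Fin r ↪ ℕ, ∫ y : Fin (m + 1 - r) → ℝ,
        truncSupp N f (joined e x y) ∂halfPow (m + 1 - r)) = chaos f' N x := by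
    filter_upwards [h1, h2, conf_ae_mem] with x hx1 hx2 hx3
    rw [Finset.sum_range_succ, Finset.sum_eq_zero, zero_add,
      show (-1 : ℝ) ^ (m + 1 - (m + 1)) = 1 by simp, Nat.choose_self, Nat.cast_one, one_mul, one_mul, ← tsum_truncSupp_eq_chaos hf'.symm N hx3]
    · refine tsum_congr fun e => ?_
      have := integral_truncSupp_joined_self f e x N
      refine this.trans ?_
      rw [truncSupp_apply, truncSupp_apply, hx2]
    · intro r hr
      have : ∀ e : Fin r ↪ ℕ, ∫ y : Fin (m + 1 - r) → ℝ,
        truncSupp N f (joined e x y) ∂halfPow (m + 1 - r) = 0 := hx1 r (Finset.mem_range.1 hr)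
      simp_rw [this, tsum_zero, mul_zero]
  exact hU.quasiMeasurePreserving.ae h3

end UniformChaos

namespace UniformChaos

/-! ### The limit of the multiple sums -/

lemma toReal_eLpNorm_two {X : Type*} [MeasurableSpace X] {μ : Measure X} {u : X → ℝ}
    (hu : MemLp u 2 μ) : (eLpNorm u 2 μ).toReal = √(∫ x, u x ^ 2 ∂μ) := by
  have h0 : 0 ≤ ∫ x, u x ^ 2 ∂μ := integral_nonneg fun _ => sq_nonneg _
  have h1 := eLpNorm_two_sq (μ := μ) u
  rw [lintegral_enorm_sq_eq hu] at h1
  have h2 := congrArg ENNReal.toReal h1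
  rw [ENNReal.toReal_pow, ENNReal.toReal_ofReal h0] at h2
  rw [← h2, Real.sqrt_sq ENNReal.toReal_nonneg]

/-- The sums form an L²-bounded martingale, whose increments after `M` have squared norm at most the
limit of the second moments minus the one at `M`. -/
lemma exists_limit_chaos {p : ℕ} {g : (Fin p → ℝ) → ℝ} (hg : Kern g) :
    ∃ Y, MemLp Y 2 conf ∧
      Tendsto (fun N => eLpNorm (chaos g N - Y) 2 conf) atTop (𝓝 0) := by
  obtain ⟨a, hlim, hle⟩ := exists_tendsto_integral_chaos_sq hg
  let u : ℕ → Lp ℝ 2 conf := fun N => (memLp_chaos hg N).toLp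
  have hd : ∀ M N, M ≤ N → dist (u N) (u M) ≤ √(a - ∫ x, chaos g M x ^ 2 ∂conf) := fun M N h => by
    rw [dist_edist, Lp.edist_toLp_toLp,
      toReal_eLpNorm_two ((memLp_chaos hg N).sub (memLp_chaos hg M))]
    refine Real.sqrt_le_sqrt ?_
    simp only [Pi.sub_apply]
    rw [integral_chaos_sub_sq hg h]
    linarith [hle N]
  have hc : CauchySeq u := by
    refine cauchySeq_of_le_tendsto_0
      (fun N => 2 * √(a - ∫ x, chaos g N x ^ 2 ∂conf)) (fun n m N hn hm => ?_) ?_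
    · refine (dist_triangle_right (u n) (u m) (u N)).trans ?_
      rw [two_mul]
      exact add_le_add (hd N n hn) (hd N m hm)
    · have h1 := ((hlim.const_sub a).sqrt).const_mul 2
      simpa using h1
  obtain ⟨Y, hY⟩ := cauchySeq_tendsto_of_complete hc
  refine ⟨Y, Lp.memLp Y, ?_⟩
  rw [← Lp.tendsto_Lp_iff_tendsto_eLpNorm'' _ (memLp_chaos hg) _ (Lp.memLp Y), Lp.toLp_coeFn]
  exact hY

/-! ### Lipschitz functions of square-integrable variables. -/

section
variable {Ω : Type*} [MeasurableSpace Ω] {P : Measure Ω} [IsProbabilityMeasure P]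

lemma integrable_lipschitz_comp {h : ℝ → ℝ} (hh : LipschitzWith 1 h) {A : Ω → ℝ}
    (hA : MemLp A 2 P) : Integrable (fun ω => h (A ω)) P := by
  refine ((integrable_const |h 0|).add (hA.integrable (by norm_num)).abs).mono'
    (hh.continuous.comp_aestronglyMeasurable hA.aestronglyMeasurable) (ae_of_all _ fun ω => ?_)
  exact LipschitzWith.abs_le_add hh (A ω)

lemma abs_integral_lipschitz_sub_le {h : ℝ → ℝ} (hh : LipschitzWith 1 h) {A B : Ω → ℝ}
    (hA : MemLp A 2 P) (hB : MemLp B 2 P) :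
    |∫ ω, h (A ω) ∂P - ∫ ω, h (B ω) ∂P| ≤ (eLpNorm (fun ω => A ω - B ω) 2 P).toReal := by
  have hAB : MemLp (fun ω => A ω - B ω) 2 P := hA.sub hB
  have i1 := integrable_lipschitz_comp hh hA
  have i2 := integrable_lipschitz_comp hh hB
  rw [← integral_sub i1 i2, toReal_eLpNorm_two hAB]
  refine abs_integral_le_integral_abs.trans ?_
  have h1 : ∫ ω, |h (A ω) - h (B ω)| ∂P ≤ ∫ ω, |A ω - B ω| ∂P := by
    refine integral_mono (i1.sub i2).abs (hAB.integrable (by norm_num)).abs fun ω => ?_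
    have := hh.dist_le_mul (A ω) (B ω)
    simpa [Real.dist_eq] using this
  refine h1.trans ?_
  have h2 := abs_integral_mul_le_sqrt (memLp_const (μ := P) (p := 2) (1 : ℝ)) hAB.abs
  have h3 : 0 ≤ ∫ ω, |A ω - B ω| ∂P := integral_nonneg fun _ => abs_nonneg _
  simpa [abs_of_nonneg h3] using h2

end

/-! ### Passage from the multiple sums to the stochastic integral. -/

section
variable {Ω : Type*} [MeasurableSpace Ω] {P : Measure Ω}
  {U : ℕ → Ω → ℝ} {m : ℕ} {f f' : (Fin (m + 1) → ℝ) → ℝ}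

/-- The multiple stochastic integral of a canonical function is the limit of multiple sums. -/
theorem isMultipleIntegral_multipleIntegral (hU : MeasurePreserving (config U) P conf)
    (hf' : Kern f') (h : f =ᵐ[halfPow (m + 1)] f') (hcan : IsCanonical f) :
    IsMultipleIntegral P U f (multipleIntegral P U f) := by
  obtain ⟨Y, hY, hlim⟩ := exists_limit_chaos hf'
  have hex : ∃ X : Ω → ℝ, IsMultipleIntegral P U f X := by
    refine ⟨Y ∘ config U, hY.comp_measurePreserving hU, hlim.congr fun N => ?_⟩
    rw [← eLpNorm_comp_measurePreserving
      ((memLp_chaos hf' N).sub hY).aestronglyMeasurable hU]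
    refine eLpNorm_congr_ae ?_
    filter_upwards [explicitIntegral_truncSupp_ae_eq hU hf' h hcan N] with ω hω
    simp [hω]
  unfold multipleIntegral
  rw [dif_pos hex]
  exact hex.choose_spec

/-- The normal approximation of multiple stochastic integrals of canonical functions. -/
theorem abs_integral_multipleIntegral_sub_gaussian_le [IsProbabilityMeasure P]
    (hU : MeasurePreserving (config U) P conf)
    (hf' : Kern f') (he : f =ᵐ[halfPow (m + 1)] f') (hcan : IsCanonical f) {Z : Ω → ℝ}
    (hZ : IsMultipleIntegral P U f Z)
    (hG : ∀ k ∈ Finset.Icc 1 (2 * m), MemLp (kernelGhat m k f') 2 (halfPow k))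
    (hK : ∫⁻ t, kernelMass m (sliceAt f' t) ∂halfLeb ≠ ∞) {h : ℝ → ℝ} (hh : LipschitzWith 1 h) :
    |∫ x, h x ∂(P.map Z) - ∫ x, h x ∂gaussianReal 0 1| ≤
      √(varDefect m f') + 2 * ((m + 1 : ℕ) : ℝ) ^ 2 * (√((m ! : ℝ) * normSq f') *
          √(∫⁻ t, kernelMass m (sliceAt f' t) ∂halfLeb).toReal) := by
  obtain ⟨hZ2, hlim⟩ := hZ
  rw [integral_map hZ2.aestronglyMeasurable.aemeasurable
    hh.continuous.measurable.aestronglyMeasurable]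
  have hF : ∀ N, MemLp (fun ω => chaos f' N (config U ω)) 2 P := fun N =>
    (memLp_chaos hf' N).comp_measurePreserving hU
  have hlim' : Tendsto (fun N => eLpNorm (fun ω => chaos f' N (config U ω) - Z ω) 2 P) atTop
      (𝓝 0) := by
    refine hlim.congr fun N => eLpNorm_congr_ae ?_
    filter_upwards [explicitIntegral_truncSupp_ae_eq hU hf' he hcan N] with ω hω
    rw [hω]
  have hreal := (ENNReal.tendsto_toReal ENNReal.zero_ne_top).comp hlim'
  have hconv : Tendsto (fun N => ∫ x, h (chaos f' N x) ∂conf) atTop (𝓝 (∫ ω, h (Z ω) ∂P)) := by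
    refine tendsto_iff_dist_tendsto_zero.2 (squeeze_zero (fun _ => dist_nonneg) (fun N => ?_) hreal)
    have hm : Measurable fun x => h (chaos f' N x) :=
      hh.continuous.measurable.comp (measurable_chaos hf'.meas N)
    rw [Real.dist_eq, ← hU.map_eq, integral_map hU.measurable.aemeasurable hm.aestronglyMeasurable]
    exact abs_integral_lipschitz_sub_le hh (hF N) hZ2
  have hconv2 := (hconv.sub_const (∫ x, h x ∂gaussianReal 0 1)).abs
  refine le_of_forall_pos_le_add fun δ hδ => le_of_tendsto hconv2 ?_
  filter_upwards [eventually_abs_integral_chaos_sub_gaussian_le hf' hG hK hδ] with N hN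
  linarith [hN h hh]

end

/-! ### The two terms of the bound in extended real form. -/

section
variable {m : ℕ} {f f' : (Fin (m + 1) → ℝ) → ℝ}

lemma eLpNorm_two_sq_eq_normSq {p : ℕ} {g g' : (Fin p → ℝ) → ℝ} (h : g =ᵐ[halfPow p] g')
    (hg' : MemLp g' 2 (halfPow p)) : eLpNorm g 2 (halfPow p) ^ 2 = ENNReal.ofReal (normSq g') := by
  rw [eLpNorm_congr_ae h, eLpNorm_two_sq, lintegral_enorm_sq_eq hg']
  rfl

lemma eLpNorm_two_eq_sqrt {p : ℕ} {g g' : (Fin p → ℝ) → ℝ} (h : g =ᵐ[halfPow p] g')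
    (hg' : MemLp g' 2 (halfPow p)) : eLpNorm g 2 (halfPow p) = ENNReal.ofReal (√(normSq g')) := by
  rw [eLpNorm_congr_ae h, ← ENNReal.ofReal_toReal hg'.2.ne, toReal_eLpNorm_two hg']
  rfl

lemma variance_term_eq (hf' : MemLp f' 2 (halfPow (m + 1))) (he : f =ᵐ[halfPow (m + 1)] f')
    (hG : ∀ k ∈ Finset.Icc 1 (2 * m), MemLp (kernelGhat m k f') 2 (halfPow k)) :
    (ENNReal.ofReal
          ((1 - ((m + 1)! : ℝ) * (eLpNorm f 2 (halfPow (m + 1))).toReal ^ 2) ^ 2) +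
        ((m + 1 : ℕ) : ℝ≥0∞) ^ 2 * ∑ k ∈ Finset.Icc 1 (2 * m),
          (k ! : ℝ≥0∞) * eLpNorm (kernelGhat m k f) 2 (halfPow k) ^ 2) ^ (1 / 2 : ℝ)
      = ENNReal.ofReal (√(varDefect m f')) := by
  have h0 : ∀ k, 0 ≤ (k ! : ℝ) * normSq (kernelGhat m k f') := fun k =>
    mul_nonneg (by positivity) (normSq_nonneg _)
  have hs0 : 0 ≤ ∑ k ∈ Finset.Icc 1 (2 * m), (k ! : ℝ) * normSq (kernelGhat m k f') :=
    Finset.sum_nonneg fun k _ => h0 k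
  rw [eLpNorm_two_eq_sqrt he hf', ENNReal.toReal_ofReal (Real.sqrt_nonneg _),
    Real.sq_sqrt (normSq_nonneg _), ← ofReal_rpow_half (by unfold varDefect; positivity), varDefect,
    ENNReal.ofReal_add (sq_nonneg _) (by positivity), ENNReal.ofReal_mul (by positivity),
    ENNReal.ofReal_pow (Nat.cast_nonneg (m + 1)), ENNReal.ofReal_natCast,
    ENNReal.ofReal_sum_of_nonneg fun k _ => h0 k]
  congr 3
  refine Finset.sum_congr rfl fun k hk => ?_
  rw [eLpNorm_two_sq_eq_normSq (kernelGhat_ae_eq he k) (hG k hk), ENNReal.ofReal_mul (by positivity),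
    ENNReal.ofReal_natCast]

/-- One `√2` comes from integrating against `dt` rather than `dt/2`, the other stands in `√(2 m!)`;
together they make the factor `2` of Stein's bound. -/
lemma remainder_term_eq (hf' : Kern f') (he : f =ᵐ[halfPow (m + 1)] f')
    (hK : ∫⁻ t, kernelMass m (sliceAt f' t) ∂halfLeb ≠ ∞) :
    ((m + 1 : ℕ) : ℝ≥0∞) ^ 2 * ENNReal.ofReal (Real.sqrt (2 * (m ! : ℝ))) *
        eLpNorm f 2 (halfPow (m + 1)) *
        (∑ k ∈ Finset.range (2 * m + 1),
          (k ! : ℝ≥0∞) * ∫⁻ t in Set.Ici (0 : ℝ),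
            eLpNorm (kernelG m k (sliceAt f t)) 2 (halfPow k) ^ 2) ^ (1 / 2 : ℝ)
      = ENNReal.ofReal (2 * ((m + 1 : ℕ) : ℝ) ^ 2 * (√((m ! : ℝ) * normSq f') *
          √(∫⁻ t, kernelMass m (sliceAt f' t) ∂halfLeb).toReal)) := by
  rw [sum_lintegral_kernelG_eq he hf'.meas, eLpNorm_two_eq_sqrt he hf'.memLp]
  set K := ∫⁻ t, kernelMass m (sliceAt f' t) ∂halfLeb
  have hn := normSq_nonneg f'
  have h2 : (2 : ℝ≥0∞) * K = ENNReal.ofReal (2 * K.toReal) := by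
    rw [ENNReal.ofReal_mul (by norm_num), ENNReal.ofReal_toReal hK, ENNReal.ofReal_ofNat]
  rw [h2, ofReal_rpow_half (by positivity), ← ENNReal.ofReal_natCast (m + 1),
    ← ENNReal.ofReal_pow (by positivity), ← ENNReal.ofReal_mul (by positivity),
    ← ENNReal.ofReal_mul (by positivity), ← ENNReal.ofReal_mul (by positivity)]
  congr 1
  rw [Real.sqrt_mul (by norm_num), Real.sqrt_mul (by norm_num), Real.sqrt_mul (by positivity)]
  have h3 : √(2 : ℝ) * √2 = 2 := Real.mul_self_sqrt (by norm_num)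
  calc _ = (√(2 : ℝ) * √2) * (((m + 1 : ℕ) : ℝ) ^ 2 * (√(m ! : ℝ) * √(normSq f') * √K.toReal)) := by
        ring
    _ = _ := by rw [h3]; ring

end

end UniformChaos

/-- The order of the stochastic integral is `n = m + 1 ≥ 1`. -/
theorem corollary5p2 {Ω : Type*} [MeasurableSpace Ω] (P : Measure Ω) [IsProbabilityMeasure P]
    (U : ℕ → Ω → ℝ) (hU_meas : ∀ k, Measurable (U k)) (hU_indep : iIndepFun U P)
    (hU_unif : ∀ k, pdf.IsUniform (U k) (Set.Icc (-1 : ℝ) 1) P volume)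
    (m : ℕ) (f : (Fin (m + 1) → ℝ) → ℝ) (hf : MemHatL2 f) (hcan : IsCanonical f)
    (hG : ∀ k ∈ Finset.Icc 1 (2 * m), MemLp (kernelGhat m k f) 2 (halfPow k)) :
    IsMultipleIntegral P U f (multipleIntegral P U f) ∧
    wassersteinDist (P.map (multipleIntegral P U f)) (gaussianReal 0 1) ≤
      (ENNReal.ofReal
          ((1 - ((m + 1)! : ℝ) * (eLpNorm f 2 (halfPow (m + 1))).toReal ^ 2) ^ 2) +
        ((m + 1 : ℕ) : ℝ≥0∞) ^ 2 * ∑ k ∈ Finset.Icc 1 (2 * m),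
          (k ! : ℝ≥0∞) * eLpNorm (kernelGhat m k f) 2 (halfPow k) ^ 2) ^ (1 / 2 : ℝ) +
      ((m + 1 : ℕ) : ℝ≥0∞) ^ 2 * ENNReal.ofReal (Real.sqrt (2 * (m ! : ℝ))) *
        eLpNorm f 2 (halfPow (m + 1)) *
        (∑ k ∈ Finset.range (2 * m + 1),
          (k ! : ℝ≥0∞) * ∫⁻ t in Set.Ici (0 : ℝ),
            eLpNorm (kernelG m k (sliceAt f t)) 2 (halfPow k) ^ 2) ^ (1 / 2 : ℝ) := by
  obtain ⟨f', hf', he⟩ := exists_kern hf hcan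
  have hU := measurePreserving_config hU_meas hU_indep hU_unif
  have hI := isMultipleIntegral_multipleIntegral hU hf' he hcan
  refine ⟨hI, ?_⟩
  have hG' : ∀ k ∈ Finset.Icc 1 (2 * m), MemLp (kernelGhat m k f') 2 (halfPow k) := fun k hk =>
    (memLp_congr_ae (kernelGhat_ae_eq he k)).1 (hG k hk)
  by_cases hK : ∫⁻ t, kernelMass m (sliceAt f' t) ∂halfLeb = ∞
  -- If the kernel mass is infinite, the right-hand side is infinite and nothing remains to be
  -- shown, provided the prefactor does not vanish.
  · have hne : eLpNorm f 2 (halfPow (m + 1)) ≠ 0 := fun h0 => by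
      rw [eLpNorm_eq_zero_iff hf.memLp.aestronglyMeasurable (by norm_num)] at h0
      have h1 := sum_lintegral_kernelG_eq he hf'.meas
      rw [lintegral_kernelMass_eq_zero h0, hK] at h1
      simp at h1
    have hc : ((m + 1 : ℕ) : ℝ≥0∞) ^ 2 * ENNReal.ofReal (Real.sqrt (2 * (m ! : ℝ))) *
        eLpNorm f 2 (halfPow (m + 1)) ≠ 0 := by
      have : 0 < Real.sqrt (2 * (m ! : ℝ)) := Real.sqrt_pos.2 (by positivity)
      refine mul_ne_zero (mul_ne_zero (by positivity) ?_) hne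
      exact (ENNReal.ofReal_pos.2 this).ne'
    rw [sum_lintegral_kernelG_eq he hf'.meas, hK, ENNReal.mul_top (by norm_num),
      ENNReal.top_rpow_of_pos (by norm_num), ENNReal.mul_top hc, add_top]
    exact le_top
  · rw [variance_term_eq hf'.memLp he hG', remainder_term_eq hf' he hK,
      ← ENNReal.ofReal_add (Real.sqrt_nonneg _) (by positivity)]
    refine iSup₂_le fun h hh => ENNReal.ofReal_le_ofReal ?_
    exact abs_integral_multipleIntegral_sub_gaussian_le hU hf' he hcan hI hG' hK hh
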